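/- **Setting.** A *triangle-pentagon complex* $X$ of a graph $G$ is a two-dimensional cell complex with $1$-skeleton $G$ whose $2$-cells are solid triangles and solid pentagons attached along triangles of $G$ and along pentagons of $G$ without diagonals, and such that $G$ has no full (i.e. induced) $4$-cycles; a solid triangle is determined by its three vertices. We metrize $X$ as a piecewise Euclidean complex, with the length metric $d$ for which all solid triangles are equilateral and all solid pentagons are regular, with all edges of length $1$, and we call $X$ *CAT(0)* if $(X,d)$ is a CAT(0) space (a geodesic space all of whose geodesic triangles satisfy the CAT(0) inequality). Let $X^\star$ be the simplicial complex obtained from $X$ by coning off each pentagon at its center. It carries the metric $d^\star$ in which the five triangles of each pentagon form a regular pentagon (a flattened wheel) and all other triangles are equilateral; so $X^\star$ is a subdivision of $X$ and $d^\star=d$. In a simplicial complex $K$, write $u\sim v$ if $u=v$ or $u,v$ span an edge. A subcomplex $L$ is *full* if every simplex of $K$ with vertices in $L$ belongs to $L$. A full *$k$-wheel* $(c;\gamma_1,\dots,\gamma_k)$, $k\ge 3$, consists of a cycle $(\gamma_1,\dots,\gamma_k)$ of distinct vertices that is full as a subcomplex, and a vertex $c$ not on it, such that the simplices spanned by the subsets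 of the sets $\{c,\gamma_i,\gamma_{i+1}\}$ (indices mod $k$) form a full subcomplex of $K$. A *$(k,l)$-dwheel* is a union $W=W_1\cup W_2$ of two full wheels $$W_1=(w_l;v_1,v_2,\dots,v_k),\qquad W_2=(v_2;w_1,w_2,\dots,w_l),\qquad v_3=w_{l-1},\quad v_1\sim w_1 .$$ Its boundary is the loop $\partial W=(w_1,\dots,w_{l-1}=v_3,v_4,\dots,v_k,v_1)$, whose length is $k+l-4$ if $v_1=w_1$ (planar case) and $k+l-3$ if $v_1\neq w_1$ (nonplanar case). The *link* $K_u$ of a vertex $u$ consists of all simplices $s$ of $K$ with $u\notin s$ and $s\cup\{u\}\in K$. The complex $K$ is *$m$-located* if it is flag (every finite nonempty set of pairwise adjacent vertices spans a simplex) and every dwheel $W$ in $K$ whose boundary length is at most $m$ is contained in the link $K_u$ of some vertex $u$. (This condition on $K$ does not involve a metric.) **Theorem 3.3.** Let $X$ be a CAT(0) triangle-pentagon complex. Then $X^\star$ is $7$-located. Moreover, every loop of length at most $7$ in $X^\star$ that is the boundary of a dwheel lies in the link of a single vertex of $X^\star$. -/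

import Mathlib

open scoped ENNReal

/-! ### CAT(0) spaces -/

/-- `γ : [0, ℓ] → M` is a geodesic of length `ℓ` from `x` to `y`. -/
structure IsGeodesicFromTo {M : Type*} [PseudoEMetricSpace M] (γ : ℝ → M) (ℓ : ℝ) (x y : M) :
    Prop where
  length_nonneg : 0 ≤ ℓ
  source : γ 0 = x
  target : γ ℓ = y
  isometry : ∀ s ∈ Set.Icc 0 ℓ, ∀ t ∈ Set.Icc 0 ℓ, edist (γ s) (γ t) = ENNReal.ofReal |s - t|

/-- A CAT(0) space: a geodesic space in which all geodesic triangles satisfy the CAT(0) inequality.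
The triangle has the vertices `p 0, p 1, p 2` and the sides `γ i` from `p i` to `p (i + 1)`;
`q 0, q 1, q 2` are the vertices of a comparison triangle in the Euclidean plane, and `x'`, `y'` are
the comparison points of `x = γ i s` and `y = γ j t`. -/
structure IsCAT0 (M : Type*) [PseudoEMetricSpace M] : Prop where
  geodesic : ∀ x y : M, ∃ (ℓ : ℝ) (γ : ℝ → M), IsGeodesicFromTo γ ℓ x y
  comparison : ∀ (p : Fin 3 → M) (ℓ : Fin 3 → ℝ) (γ : Fin 3 → ℝ → M)
    (q : Fin 3 → EuclideanSpace ℝ (Fin 2)),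
    (∀ i, IsGeodesicFromTo (γ i) (ℓ i) (p i) (p (i + 1))) →
    (∀ i, dist (q i) (q (i + 1)) = ℓ i) →
    ∀ (i j : Fin 3), ∀ s ∈ Set.Icc 0 (ℓ i), ∀ t ∈ Set.Icc 0 (ℓ j),
    ∀ x' y' : EuclideanSpace ℝ (Fin 2),
      dist (q i) x' = s → dist x' (q (i + 1)) = ℓ i - s →
      dist (q j) y' = t → dist y' (q (j + 1)) = ℓ j - t →
      edist (γ i s) (γ j t) ≤ ENNReal.ofReal (dist x' y')

/-! ### Simplicial complexes: links, flagness, wheels, dwheels, location -/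

namespace AbstractSimplicialComplex

variable {U : Type*} (K : AbstractSimplicialComplex U)

/-- Pairwise adjacent vertices span a simplex. -/
def IsFlag : Prop :=
  open scoped Classical in
  ∀ s : Finset U, s.Nonempty → (∀ a ∈ s, ∀ b ∈ s, ({a, b} : Finset U) ∈ K.faces) → s ∈ K.faces

/-- The simplices of the link of the vertex `u`. -/
def linkFaces (u : U) : Set (Finset U) :=
  open scoped Classical in
  {s | s ∈ K.faces ∧ u ∉ s ∧ insert u s ∈ K.faces}

/-- `L` is (the set of simplices of) a subcomplex of `K` containing each simplex of `K` that is
spanned by vertices in `L`. -/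
def IsFullSubcomplex (L : Set (Finset U)) : Prop :=
  L ⊆ K.faces ∧ ∀ s ∈ K.faces, (∀ a ∈ s, {a} ∈ L) → s ∈ L

/-- The simplices of the cycle `(γ 1, …, γ k)`; note that `γ 0 = γ k` as `0 = k` in `ZMod k`. -/
def cycleFaces {k : ℕ} (γ : ZMod k → U) : Set (Finset U) :=
  open scoped Classical in
  {s | s.Nonempty ∧ ∃ i, s ⊆ {γ i, γ (i + 1)}}

/-- `(γ 1, …, γ k)` is a full cycle in `K`. -/
structure IsFullCycle {k : ℕ} (γ : ZMod k → U) : Prop where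
  three_le : 3 ≤ k
  injective : Function.Injective γ
  full : K.IsFullSubcomplex (cycleFaces γ)

/-- The simplices of the wheel `(c; γ 1, …, γ k)`. -/
def wheelFaces (c : U) {k : ℕ} (γ : ZMod k → U) : Set (Finset U) :=
  open scoped Classical in
  {s | s.Nonempty ∧ ∃ i, s ⊆ {c, γ i, γ (i + 1)}}

/-- `(c; γ 1, …, γ k)` is a `k`-wheel in `K` that is full as a subcomplex. -/
structure IsFullWheel (c : U) {k : ℕ} (γ : ZMod k → U) : Prop where
  isFullCycle : K.IsFullCycle γ
  center_ne : ∀ i, c ≠ γ i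
  full : K.IsFullSubcomplex (wheelFaces c γ)

/-- The `(k, l)`-dwheel `(w_l; v_1, …, v_k) ∪ (v_2; w_1, …, w_l)`, with `v_3 = w_{l-1}`, and with
`v_1 = w_1` (planar) or `v_1 ∼ w_1` (nonplanar). Indices are modulo `k` and `l`: so `w 0` is `w_l`,
and `w (-1)` is `w_{l-1}`. -/
structure IsDwheel {k l : ℕ} (v : ZMod k → U) (w : ZMod l → U) : Prop where
  wheel₁ : K.IsFullWheel (w 0) v
  wheel₂ : K.IsFullWheel (v 2) w
  glue : v 3 = w (-1)
  close : open scoped Classical in v 1 = w 1 ∨ ({v 1, w 1} : Finset U) ∈ K.faces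

/-- The simplices of a dwheel. -/
def dwheelFaces {k l : ℕ} (v : ZMod k → U) (w : ZMod l → U) : Set (Finset U) :=
  wheelFaces (w 0) v ∪ wheelFaces (v 2) w

/-- The simplices of the boundary loop of a dwheel, which runs through
`w_1, …, w_{l-1} = v_3, v_4, …, v_k, v_1` and back to `w_1` (where `v_1 = w_1` if it is planar). -/
def dwheelBoundaryFaces {k l : ℕ} (v : ZMod k → U) (w : ZMod l → U) : Set (Finset U) :=
  open scoped Classical in
  {s | s.Nonempty ∧
    ((∃ i : ℕ, 1 ≤ i ∧ i + 2 ≤ l ∧ s ⊆ {w i, w (i + 1)}) ∨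
     (∃ i : ℕ, 3 ≤ i ∧ i ≤ k ∧ s ⊆ {v i, v (i + 1)}) ∨
     s ⊆ {v 1, w 1})}

/-- The boundary length of a dwheel. -/
noncomputable def dwheelBoundaryLength {k l : ℕ} (v : ZMod k → U) (w : ZMod l → U) : ℕ :=
  open scoped Classical in
  if v 1 = w 1 then k + l - 4 else k + l - 3

/-- `m`-located complexes (the wheels of a dwheel are full subcomplexes by definition). -/
structure IsLocated (m : ℕ) : Prop where
  isFlag : K.IsFlag
  located : ∀ (k l : ℕ) (v : ZMod k → U) (w : ZMod l → U), K.IsDwheel v w →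
    dwheelBoundaryLength v w ≤ m → ∃ u : U, dwheelFaces v w ⊆ K.linkFaces u

/-- The points of the geometric realization of `K`, in barycentric coordinates. -/
def Realization : Type _ :=
  {x : U → ℝ // (∀ a, 0 ≤ x a) ∧
    ∃ s ∈ K.faces, (∀ a, a ∉ s → x a = 0) ∧ ∑ a ∈ s, x a = 1}

end AbstractSimplicialComplex

/-! ### Triangle-pentagon complexes -/

/-- A triangle-pentagon complex of a graph `G`: a two-dimensional cell complex with `1`-skeleton `G`
whose `2`-cells are solid triangles and solid pentagons, attached along triangles of `G` and along
pentagons of `G` without diagonals (i.e. induced `5`-cycles), such that `G` has no full `4`-cycles.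
Solid triangles are given by their vertex sets. -/
structure TrianglePentagonComplex {V : Type*} (G : SimpleGraph V) where
  triangles : Set (Finset V)
  triangles_isNClique : ∀ t ∈ triangles, G.IsNClique 3 t
  /-- The type of solid pentagons. -/
  Pentagon : Type*
  /-- The attaching isomorphism of each solid pentagon with an induced pentagon of `G`. -/
  boundary : Pentagon → (SimpleGraph.cycleGraph 5 ↪g G)
  no_full_four_cycle : IsEmpty (SimpleGraph.cycleGraph 4 ↪g G)

namespace TrianglePentagonComplex

variable {V : Type*} {G : SimpleGraph V} (X : TrianglePentagonComplex G)

/-- The complex `X*`, obtained by coning off each pentagon at its center. Its vertices are the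
vertices `Sum.inl v` of `X` and the centers `Sum.inr P` of the pentagons; its maximal simplices are
among: the vertices, edges and triangles of `X`, and the five triangles into which each pentagon is
divided. -/
def star : AbstractSimplicialComplex (V ⊕ X.Pentagon) where
  faces :=
    open scoped Classical in
    {s | s.Nonempty ∧
      ((∃ v : V, s ⊆ {Sum.inl v}) ∨
       (∃ u v : V, G.Adj u v ∧ s ⊆ {Sum.inl u, Sum.inl v}) ∨
       (∃ t ∈ X.triangles, s ⊆ t.map Function.Embedding.inl) ∨
       (∃ (P : X.Pentagon) (i : Fin 5),
          s ⊆ {Sum.inr P, Sum.inl (X.boundary P i), Sum.inl (X.boundary P (i + 1))}))}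
  isRelLowerSet_faces := by
    rintro s ⟨hs, h⟩
    refine ⟨hs, fun t hts ht => ⟨ht, ?_⟩⟩
    rcases h with ⟨v, h⟩ | ⟨u, v, huv, h⟩ | ⟨r, hr, h⟩ | ⟨P, i, h⟩
    · exact Or.inl ⟨v, hts.trans h⟩
    · exact Or.inr (Or.inl ⟨u, v, huv, hts.trans h⟩)
    · exact Or.inr (Or.inr (Or.inl ⟨r, hr, hts.trans h⟩))
    · exact Or.inr (Or.inr (Or.inr ⟨P, i, hts.trans h⟩))
  singleton_mem := by
    rintro (v | P)
    · exact ⟨Finset.singleton_nonempty _, Or.inl ⟨v, subset_rfl⟩⟩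
    · exact ⟨Finset.singleton_nonempty _, Or.inr (Or.inr (Or.inr ⟨P, 0, by simp⟩))⟩

/-- The underlying space of `X`, which is also that of its subdivision `X*`: points are written in
barycentric coordinates with respect to the simplices of `X*`. -/
def Space : Type _ := X.star.Realization

open scoped Classical in
/-- The closed cells of `X` of positive dimension (with a labelling of their vertices). -/
inductive Cell
  | edge (u v : V) (h : G.Adj u v) : Cell
  | triangle (u v w : V) (h : ({u, v, w} : Finset V) ∈ X.triangles) : Cell
  | pentagon (P : X.Pentagon) : Cell

variable {X}

/-- The number of vertices of a cell. -/
def Cell.size : X.Cell → ℕ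
  | .edge _ _ _ => 2
  | .triangle _ _ _ _ => 3
  | .pentagon _ => 5

/-- The vertices of a cell, in cyclic order. -/
def Cell.vertex : (C : X.Cell) → Fin C.size → V
  | .edge u v _ => ![u, v]
  | .triangle u v w _ => ![u, v, w]
  | .pentagon P => X.boundary P

/-- The vertices of `X*` that lie in the closed cell. -/
def Cell.starVertices : X.Cell → Set (V ⊕ X.Pentagon)
  | .edge u v _ => {Sum.inl u, Sum.inl v}
  | .triangle u v w _ => {Sum.inl u, Sum.inl v, Sum.inl w}
  | .pentagon P => insert (Sum.inr P) (Set.range fun i => Sum.inl (X.boundary P i))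

/-- The points of a closed cell. -/
def Cell.carrier (C : X.Cell) : Set X.Space :=
  {x | ∀ a, x.1 a ≠ 0 → a ∈ C.starVertices}

/-- The vertices of the regular `n`-gon with side length `1` and center `0` in the plane
(for `n = 2`, the end points of a segment of length `1`). -/
noncomputable def regularPolygonVertex (n : ℕ) (i : Fin n) : ℂ :=
  ((1 / (2 * Real.sin (Real.pi / n)) : ℝ) : ℂ) *
    Complex.exp (((2 * Real.pi * (i : ℕ) / n : ℝ) : ℂ) * Complex.I)

/-- The identification of a closed cell with the regular polygon of side length `1`, affine on each
simplex of `X*`: the vertices of the cell go to the vertices of the polygon, and the center of a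
pentagon goes to `0`. -/
noncomputable def Cell.chart (C : X.Cell) (x : X.Space) : ℂ :=
  ∑ i, (x.1 (Sum.inl (C.vertex i)) : ℂ) * regularPolygonVertex C.size i

/-- The length of the straight segment between two points in a common closed cell (and `⊤` if they
have no common closed cell). -/
noncomputable def stepLength (x y : X.Space) : ℝ≥0∞ :=
  ⨅ (C : X.Cell) (_ : x ∈ C.carrier) (_ : y ∈ C.carrier), edist (C.chart x) (C.chart y)

/-- The intrinsic distance: the infimum of the lengths of the piecewise straight paths. -/
noncomputable def intrinsicDist (x y : X.Space) : ℝ≥0∞ :=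
  ⨅ (n : ℕ) (z : ℕ → X.Space) (_ : z 0 = x) (_ : z n = y),
    ∑ i ∈ Finset.range n, stepLength (z i) (z (i + 1))

theorem stepLength_comm (x y : X.Space) : stepLength x y = stepLength y x := by
  unfold stepLength
  refine iInf_congr fun C => ?_
  rw [iInf_comm]
  simp only [edist_comm]

theorem intrinsicDist_le {x y : X.Space} (n : ℕ) (z : ℕ → X.Space) (h0 : z 0 = x) (hn : z n = y) :
    intrinsicDist x y ≤ ∑ i ∈ Finset.range n, stepLength (z i) (z (i + 1)) :=
  iInf_le_of_le n (iInf_le_of_le z (iInf_le_of_le h0 (iInf_le_of_le hn le_rfl)))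

theorem intrinsicDist_comm_le (x y : X.Space) : intrinsicDist x y ≤ intrinsicDist y x := by
  conv_rhs => unfold intrinsicDist
  refine le_iInf fun n => le_iInf fun z => le_iInf fun h0 => le_iInf fun hn => ?_
  refine (intrinsicDist_le n (fun i => z (n - i)) (by simpa using hn) (by simpa using h0)).trans ?_
  rw [← Finset.sum_range_reflect (fun i => stepLength (z i) (z (i + 1)))]
  refine le_of_eq (Finset.sum_congr rfl fun i hi => ?_)
  have hi := Finset.mem_range.1 hi
  rw [stepLength_comm, show n - 1 - i + 1 = n - i by omega, show n - 1 - i = n - (i + 1) by omega]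

theorem intrinsicDist_triangle (x y z : X.Space) :
    intrinsicDist x z ≤ intrinsicDist x y + intrinsicDist y z := by
  conv_rhs => unfold intrinsicDist
  simp only [ENNReal.iInf_add, ENNReal.add_iInf]
  refine le_iInf fun m => le_iInf fun g => le_iInf fun hg0 => le_iInf fun hgm => le_iInf fun n =>
    le_iInf fun f => le_iInf fun hf0 => le_iInf fun hfn => ?_
  refine (intrinsicDist_le (n + m) (fun i => if i < n then f i else g (i - n)) ?_ ?_).trans ?_
  · rcases Nat.eq_zero_or_pos n with rfl | hn
    · simp [hg0, ← hfn, hf0]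
    · simp [hn, hf0]
  · simp [hgm]
  · rw [Finset.sum_range_add]
    refine le_of_eq (congrArg₂ _ (Finset.sum_congr rfl fun i hi => ?_)
      (Finset.sum_congr rfl fun i _ => ?_))
    · have hi := Finset.mem_range.1 hi
      rcases Nat.lt_or_ge (i + 1) n with h | h
      · simp [hi, h]
      · obtain rfl : n = i + 1 := by omega
        simp [hg0, hfn]
    · simp [show n + i + 1 - n = i + 1 by omega, show ¬ n + i + 1 < n by omega]

/-- The piecewise Euclidean metric of `X`, in which each triangle is equilateral with sides of
length `1` and each pentagon is a regular pentagon with sides of length `1`. As a center sits at the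
center of its regular pentagon, this is also the metric of `X*` in which the five triangles of each
pentagon form a flattened wheel and all other triangles are equilateral. -/
noncomputable instance : PseudoEMetricSpace X.Space where
  edist := intrinsicDist
  edist_self x := le_antisymm ((intrinsicDist_le 0 (fun _ => x) rfl rfl).trans (by simp)) bot_le
  edist_comm x y := le_antisymm (intrinsicDist_comm_le x y) (intrinsicDist_comm_le y x)
  edist_triangle := intrinsicDist_triangle

end TrianglePentagonComplex

/-! ### CAT(0) inequalities -/

/-! No dwheel has a boundary of length at most 7, so both location claims hold vacuously. What needs
proof is flagness and a lower bound for the lengths of full wheels.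

Wheels. Vertex links of a CAT(0) complex have girth at least 2π (`two_pi_le_sum_sectorAngle`). In
the link of a vertex of X, subdivided as in X*, an edge coming from a triangle has length π/3 and
one coming from half a pentagon corner has length 3π/10 < π/3. Hence a full wheel about a vertex of
X has at least 6 sides, and at least 7 if a pentagon center lies on its rim. A full wheel about a
pentagon center has at least 5 sides, since its rim lies in a 5-cycle. The hubs of a dwheel are
adjacent, so they are not both pentagon centers, and k + l is at least 6 + 6 or 5 + 7
(`twelve_le_of_isDwheel`). The boundary then has length at least 12 - 4 = 8.

Girth. The metric is an infimum over chains of segments. Barycentric coordinates are Lipschitz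
(`edist_coord_le`), so short chains stay in an open star, and there the triangles on an edge can be
unfolded into the plane (`development`). This gives local distances; `IsCAT0.dist_eq_of_local` makes
them global. Sector by sector, a chain of triangles around a vertex with total angle below π is seen
to have the distances of a planar sector (`dist_polarPoint_chain`). If a closed chain had total
angle below 2π, a point reached in the two directions would lie at two different distances from the
start.

Flagness. The girth bound excludes four pairwise adjacent vertices of X, once every triangle of G is
known to be solid (`mem_triangles_of_adj`). If the triangle were not solid, comparison with a
Euclidean equilateral triangle would keep two of its edges close together, while a function that is
1-Lipschitz near their common vertex separates them faster. -/

theorem isGeodesicFromTo_concat {M : Type*} [PseudoMetricSpace M] {x m y : M} {γ₁ γ₂ : ℝ → M}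
    {a b : ℝ} (h₁ : IsGeodesicFromTo γ₁ a x m) (h₂ : IsGeodesicFromTo γ₂ b m y) (ha : 0 < a)
    (hb : 0 < b) (hd : a + b ≤ dist x y) :
    IsGeodesicFromTo (fun t => if t ≤ a then γ₁ t else γ₂ (t - a)) (a + b) x y := by
  have d₁ : ∀ s ∈ Set.Icc 0 a, ∀ t ∈ Set.Icc 0 a, dist (γ₁ s) (γ₁ t) = |s - t| := by
    intro s hs t ht
    rw [dist_edist, h₁.isometry s hs t ht, ENNReal.toReal_ofReal (abs_nonneg _)]
  have d₂ : ∀ s ∈ Set.Icc 0 b, ∀ t ∈ Set.Icc 0 b, dist (γ₂ s) (γ₂ t) = |s - t| := by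
    intro s hs t ht
    rw [dist_edist, h₂.isometry s hs t ht, ENNReal.toReal_ofReal (abs_nonneg _)]
  -- The path through `m` gives the upper bound. Any shorter passage from `γ₁ s` to `γ₂ t` would
  -- bring `dist x y` below `a + b`.
  have key : ∀ s ∈ Set.Icc 0 a, ∀ t ∈ Set.Icc 0 b, dist (γ₁ s) (γ₂ t) = a - s + t := by
    intro s hs t ht
    have e1 := d₁ 0 ⟨le_rfl, ha.le⟩ s hs
    have e2 := d₁ s hs a ⟨ha.le, le_rfl⟩
    have e3 := d₂ 0 ⟨le_rfl, hb.le⟩ t ht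
    have e4 := d₂ t ht b ⟨hb.le, le_rfl⟩
    rw [h₁.source, abs_of_nonpos (by linarith [hs.1])] at e1
    rw [h₁.target, abs_of_nonpos (by linarith [hs.2])] at e2
    rw [h₂.source, abs_of_nonpos (by linarith [ht.1])] at e3
    rw [h₂.target, abs_of_nonpos (by linarith [ht.2])] at e4
    have t1 := dist_triangle4 x (γ₁ s) (γ₂ t) y
    have t2 := dist_triangle (γ₁ s) m (γ₂ t)
    linarith
  refine ⟨by linarith, by simp [ha.le, h₁.source], ?_, ?_⟩
  · simp [hb, h₂.target]
  · intro s hs t ht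
    rw [edist_dist]
    congr 1
    by_cases h : s ≤ a <;> by_cases h' : t ≤ a <;> simp only [h, h', if_true, if_false]
    · exact d₁ s ⟨hs.1, h⟩ t ⟨ht.1, h'⟩
    · rw [key s ⟨hs.1, h⟩ (t - a) ⟨by linarith, by linarith [ht.2]⟩, abs_of_nonpos (by linarith)]
      ring
    · rw [dist_comm, key t ⟨ht.1, h'⟩ (s - a) ⟨by linarith, by linarith [hs.2]⟩,
        abs_of_nonneg (by linarith)]
      ring
    · rw [d₂ _ ⟨by linarith, by linarith [hs.2]⟩ _ ⟨by linarith, by linarith [ht.2]⟩]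
      ring_nf

theorem IsCAT0.exists_geodesic {M : Type*} [PseudoMetricSpace M] (hM : IsCAT0 M) (x y : M) :
    ∃ γ : ℝ → M, IsGeodesicFromTo γ (dist x y) x y := by
  obtain ⟨ℓ, γ, h⟩ := hM.geodesic x y
  have := h.isometry 0 ⟨le_rfl, h.length_nonneg⟩ ℓ ⟨h.length_nonneg, le_rfl⟩
  rw [h.source, h.target, zero_sub, abs_neg, abs_of_nonneg h.length_nonneg] at this
  have h' : dist x y = ℓ := by rw [dist_edist, this, ENNReal.toReal_ofReal h.length_nonneg]
  exact ⟨γ, h' ▸ h⟩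

theorem exists_comparison_triangle {d e f : ℝ} (hd : 0 < d) (he : 0 ≤ e) (hf : 0 ≤ f)
    (h₁ : d ≤ e + f) (h₂ : e ≤ d + f) (h₃ : f ≤ d + e) :
    ∃ x y : ℝ, x ^ 2 + y ^ 2 = e ^ 2 ∧ (d - x) ^ 2 + y ^ 2 = f ^ 2 := by
  refine ⟨(d ^ 2 + e ^ 2 - f ^ 2) / (2 * d), √(e ^ 2 - ((d ^ 2 + e ^ 2 - f ^ 2) / (2 * d)) ^ 2), ?_⟩
  rw [Real.sq_sqrt]
  · constructor
    · ring
    · field_simp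
      ring
  · rw [sub_nonneg, div_pow, div_le_iff₀ (by positivity)]
    have : 0 ≤ (f ^ 2 - (d - e) ^ 2) * ((d + e) ^ 2 - f ^ 2) := by
      refine mul_nonneg ?_ ?_ <;> nlinarith
    nlinarith

/-- The CAT(0) inequality for a vertex of a triangle and a point of the opposite side, in the form
of Stewart's theorem. -/
theorem IsCAT0.stewart {M : Type*} [PseudoMetricSpace M] (hM : IsCAT0 M) {p q m r : M}
    (h₁ : 0 < dist q m) (h₂ : 0 < dist m r) (hm : dist q m + dist m r = dist q r) :
    dist q r * dist p m ^ 2 ≤ dist m r * dist p q ^ 2 + dist q m * dist p r ^ 2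
      - dist q m * dist m r * dist q r := by
  obtain ⟨γ₀, g₀⟩ := hM.exists_geodesic p q
  obtain ⟨γ₂, g₂⟩ := hM.exists_geodesic r p
  obtain ⟨δ₁, k₁⟩ := hM.exists_geodesic q m
  obtain ⟨δ₂, k₂⟩ := hM.exists_geodesic m r
  have g₁ := isGeodesicFromTo_concat k₁ k₂ h₁ h₂ hm.le
  obtain ⟨x, y, e₁, e₂⟩ := exists_comparison_triangle (d := dist q r) (e := dist p q)
    (f := dist p r) (by linarith) dist_nonneg dist_nonneg
    (by simpa [dist_comm] using dist_triangle q p r)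
    (by linarith [dist_triangle p r q, dist_comm r q]) (by linarith [dist_triangle p q r])
  -- The side from `q` to `r` is built to pass through `m`, so uniqueness of geodesics is not
  -- needed. The other point is `p`, entered as the start of side 0.
  have key := hM.comparison ![p, q, r] ![dist p q, dist q m + dist m r, dist r p]
    ![γ₀, fun t => if t ≤ dist q m then δ₁ t else δ₂ (t - dist q m), γ₂]
    ![!₂[x, y], !₂[0, 0], !₂[dist q r, 0]] (by intro i; fin_cases i <;> assumption) (by
      intro i
      fin_cases i
      · simp [EuclideanSpace.dist_eq, e₁, Real.sqrt_sq]
      · simp [EuclideanSpace.dist_eq, hm, Real.sqrt_sq]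
      · change dist (!₂[dist q r, 0] : EuclideanSpace ℝ (Fin 2)) !₂[x, y] = dist r p
        rw [EuclideanSpace.dist_eq, Fin.sum_univ_two, dist_comm r p,
          ← Real.sqrt_sq (dist_nonneg (x := p) (y := r)), ← e₂]
        simp [Real.dist_eq]) 1 0 (dist q m)
    ⟨h₁.le, by simp⟩ 0 ⟨le_rfl, dist_nonneg⟩ !₂[dist q m, 0] !₂[x, y]
    (by simp [EuclideanSpace.dist_eq, Real.dist_eq])
    (by
      simp only [EuclideanSpace.dist_eq, Fin.sum_univ_two, Real.dist_eq]
      simp [← hm, abs_of_nonneg])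
    (by simp) (by simp [EuclideanSpace.dist_eq, e₁, Real.sqrt_sq])
  simp only [EuclideanSpace.dist_eq, Fin.sum_univ_two, Real.dist_eq] at key
  simp only [Matrix.cons_val_one, Matrix.cons_val_zero, le_refl, if_true, k₁.target, g₀.source]
    at key
  rw [edist_dist, ENNReal.ofReal_le_ofReal_iff (Real.sqrt_nonneg _), dist_comm] at key
  have key2 := pow_le_pow_left₀ dist_nonneg key 2
  rw [Real.sq_sqrt (by positivity)] at key2
  simp only [sq_abs] at key2
  have := mul_le_mul_of_nonneg_left key2 (dist_nonneg (x := q) (y := r))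
  refine this.trans (le_of_eq ?_)
  have : dist m r = dist q r - dist q m := by linarith
  rw [this, ← e₁]
  have e₃ : dist p r ^ 2 = (dist q r - x) ^ 2 + y ^ 2 := e₂.symm
  rw [e₃]
  simp
  ring

/-- Let a, b, c be the distances from `x` to `x'`, `x'` to `e` and `e` to `y`. Stewart's inequality
for `y` and the point `x'` between `x` and `e` simplifies to b (a + b + c)² ≤ b d(x, y)², and b > 0
can be cancelled. -/
theorem IsCAT0.dist_eq_add_of_local {M : Type*} [PseudoMetricSpace M] (hM : IsCAT0 M)
    {x x' e y : M} (h : 0 < dist x' e) (hx : dist x x' + dist x' e = dist x e)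
    (hy : dist x' e + dist e y = dist x' y) : dist x e + dist e y = dist x y := by
  refine le_antisymm ?_ (dist_triangle _ _ _)
  rcases (dist_nonneg (x := x) (y := x')).eq_or_lt with h0 | h0
  · linarith [dist_triangle x' x y, dist_comm x x']
  · have := hM.stewart (p := y) h0 h hx
    rw [dist_comm y x', ← hy, dist_comm y x, dist_comm y e, ← hx] at this
    rw [← hx]
    refine abs_le_of_sq_le_sq' ?_ dist_nonneg |>.2
    refine le_of_mul_le_mul_left ?_ h
    nlinarith

/-- Two geodesics meeting at `e` join to a geodesic as soon as their pieces near `e` do: extend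
first on one side, then on the other. -/
theorem IsCAT0.dist_eq_add_of_local' {M : Type*} [PseudoMetricSpace M] (hM : IsCAT0 M)
    {x x' e y' y : M} (h : 0 < dist x' e) (h' : 0 < dist e y')
    (hx : dist x x' + dist x' e = dist x e) (hy : dist e y' + dist y' y = dist e y)
    (hl : dist x' e + dist e y' = dist x' y') : dist x e + dist e y = dist x y := by
  have h1 := hM.dist_eq_add_of_local h hx hl
  have h2 := hM.dist_eq_add_of_local (x := y) (x' := y') (e := e) (y := x)
    (by rwa [dist_comm]) (by simp only [dist_comm y, dist_comm y' e]; linarith)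
    (by simp only [dist_comm y', dist_comm e x]; linarith)
  simp only [dist_comm y, dist_comm e x] at h2
  linarith

/-- In a CAT(0) space, local geodesics are geodesics. -/
theorem IsCAT0.dist_eq_of_local {M : Type*} [PseudoMetricSpace M] (hM : IsCAT0 M)
    {c : ℝ → M} {L δ : ℝ} (hδ : 0 < δ) (hL : 0 ≤ L)
    (hc : ∀ s ∈ Set.Icc (0 : ℝ) 1, ∀ t ∈ Set.Icc (0 : ℝ) 1, |s - t| < δ →
      dist (c s) (c t) = |s - t| * L) : dist (c 0) (c 1) = L := by
  -- With 2/n < δ, two consecutive steps of length 1/n lie within the range of the local hypothesis.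
  obtain ⟨n, hn⟩ := exists_nat_gt (2 / δ)
  have hn0 : (0 : ℝ) < n := lt_trans (by positivity) hn
  have hn2 : 2 / (n : ℝ) < δ := by
    rw [div_lt_iff₀ hδ] at hn
    rw [div_lt_iff₀ hn0]; linarith
  have hmem : ∀ k : ℕ, k ≤ n → (k / n : ℝ) ∈ Set.Icc (0 : ℝ) 1 := fun k hk =>
    ⟨by positivity, by rw [div_le_one hn0]; exact_mod_cast hk⟩
  have step : ∀ k j : ℕ, j ≤ 2 → k + j ≤ n →
      dist (c (k / n)) (c ((k + j : ℕ) / n)) = j / n * L := by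
    intro k j hj hk
    have e : (k / n : ℝ) - ((k + j : ℕ) / n) = -(j / n) := by push_cast; ring
    have hj' : (j : ℝ) ≤ 2 := by exact_mod_cast hj
    rw [hc _ (hmem k (by omega)) _ (hmem _ hk), e, abs_neg, abs_of_nonneg (by positivity)]
    rw [e, abs_neg, abs_of_nonneg (by positivity)]
    exact lt_of_le_of_lt (by gcongr) hn2
  -- Zero speed is treated apart because the extension lemma needs consecutive points at positive
  -- distance.
  rcases hL.eq_or_lt with rfl | hL
  · have : ∀ k : ℕ, k ≤ n → dist (c 0) (c (k / n)) = 0 := by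
      intro k
      induction k with
      | zero => simp
      | succ k ih =>
        intro hk
        have h1 := step k 1 (by norm_num) hk
        have h2 := ih (by omega)
        refine le_antisymm ((dist_triangle _ (c (k / n)) _).trans ?_) dist_nonneg
        simp only [mul_zero] at h1
        rw [h1, h2, add_zero]
    simpa [hn0.ne'] using this n le_rfl
  have key : ∀ k : ℕ, k + 1 ≤ n → dist (c 0) (c ((k + 1 : ℕ) / n)) = (k + 1 : ℕ) / n * L ∧
      dist (c 0) (c (k / n)) + dist (c (k / n)) (c ((k + 1 : ℕ) / n)) =
        dist (c 0) (c ((k + 1 : ℕ) / n)) := by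
    intro k
    induction k with
    | zero =>
      intro hk
      have := step 0 1 (by norm_num) hk
      simp at this ⊢
      exact this
    | succ k ih =>
      intro hk
      obtain ⟨h1, h2⟩ := ih (by omega)
      have e1 := step k 1 (by norm_num) (by omega)
      have e2 := step (k + 1) 1 (by norm_num) (by omega)
      have e3 := step k 2 (by norm_num) (by omega)
      have h3 := hM.dist_eq_add_of_local (x := c 0) (x' := c (k / n)) (e := c ((k + 1 : ℕ) / n))
        (y := c ((k + 1 + 1 : ℕ) / n)) (by rw [e1]; positivity) h2
        (by rw [e1, e2, e3]; push_cast; ring)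
      refine ⟨?_, h3⟩
      rw [← h3, h1, e2]; push_cast; ring
  have hn1 : 1 ≤ n := by exact_mod_cast hn0
  have := (key (n - 1) (by omega)).1
  rw [Nat.sub_add_cancel hn1, div_self hn0.ne', one_mul] at this
  exact this

/-! ### Plane geometry -/

open Complex in
-- The decomposition of a unit vector of argument θ along those of arguments 0 and α. It underlies
-- the polar formulas for chords and for sectors.
theorem sin_sub_add_sin_mul_exp (α θ : ℝ) :
    (Real.sin (α - θ) : ℂ) + Real.sin θ * exp (α * I) = Real.sin α * exp (θ * I) := by
  rw [exp_mul_I, exp_mul_I, ← ofReal_cos, ← ofReal_cos, ← ofReal_sin, ← ofReal_sin, Real.sin_sub]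
  push_cast
  ring

/-- For weights of sum zero the squared norm is -½ ∑ wᵢ wⱼ ‖fᵢ - fⱼ‖², which involves only mutual
distances. So affine maps of a simplex with equal edge lengths measure equal distances. -/
theorem norm_sum_smul_eq {ι : Type*} {s : Finset ι} {w : ι → ℝ} (hw : ∑ i ∈ s, w i = 0)
    {f g : ι → ℂ} (h : ∀ i ∈ s, ∀ j ∈ s, ‖f i - f j‖ = ‖g i - g j‖) :
    ‖∑ i ∈ s, w i • f i‖ = ‖∑ i ∈ s, w i • g i‖ := by
  have key : ∀ f : ι → ℂ, ‖∑ i ∈ s, w i • f i‖ ^ 2 =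
      (-∑ i ∈ s, ∑ j ∈ s, w i * w j * (‖f i - f j‖ * ‖f i - f j‖)) / 2 := by
    intro f
    have := EuclideanGeometry.inner_weightedVSub (s₁ := s) (w₁ := w) f hw (s₂ := s) (w₂ := w) f hw
    simp only [dist_eq_norm] at this
    rw [← this, s.weightedVSub_eq_linear_combination hw, real_inner_self_eq_norm_sq]
  have : ‖∑ i ∈ s, w i • f i‖ ^ 2 = ‖∑ i ∈ s, w i • g i‖ ^ 2 := by
    rw [key, key]
    congr 2
    refine Finset.sum_congr rfl fun i hi => Finset.sum_congr rfl fun j hj => ?_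
    rw [h i hi j hj]
  exact (sq_eq_sq₀ (norm_nonneg _) (norm_nonneg _)).1 this

/-! ### Metric data of the regular pentagon, the equilateral triangle and the unit segment -/

/-- The circumradius of the regular pentagon with side length `1`. -/
noncomputable def pentagonRadius : ℝ := 1 / (2 * Real.sin (Real.pi / 5))

theorem sin_pi_div_five_pos : 0 < Real.sin (Real.pi / 5) :=
  Real.sin_pos_of_pos_of_lt_pi (by positivity) (by linarith [Real.pi_pos])

theorem pentagonRadius_mul_sin : pentagonRadius * Real.sin (Real.pi / 5) = 1 / 2 := by
  have := sin_pi_div_five_pos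
  unfold pentagonRadius
  field_simp

theorem sin_pi_div_five_sq : Real.sin (Real.pi / 5) ^ 2 = (5 - √5) / 8 := by
  have h5 : √5 ^ 2 = (5 : ℝ) := Real.sq_sqrt (by norm_num)
  rw [Real.sin_sq, Real.cos_pi_div_five]
  linear_combination (-1 / 16) * h5

theorem sqrt_five_bounds : (2.236 : ℝ) < √5 ∧ √5 < 2.2361 :=
  ⟨Real.lt_sqrt_of_sq_lt (by norm_num), by rw [Real.sqrt_lt'] <;> norm_num⟩

theorem pentagonRadius_sq : pentagonRadius ^ 2 = (5 + √5) / 10 := by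
  have h5 : √5 ^ 2 = (5 : ℝ) := Real.sq_sqrt (by norm_num)
  have := sqrt_five_bounds
  have h1 : pentagonRadius ^ 2 * Real.sin (Real.pi / 5) ^ 2 = 1 / 4 := by
    rw [← mul_pow, pentagonRadius_mul_sin]; norm_num
  rw [sin_pi_div_five_sq] at h1
  have h2 : (0 : ℝ) < 5 - √5 := by linarith
  refine mul_right_cancel₀ h2.ne' ?_
  linear_combination 8 * h1 + (1 / 10) * h5

theorem pentagonRadius_pos : 0 < pentagonRadius := by
  have := sin_pi_div_five_pos
  unfold pentagonRadius
  positivity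

theorem pentagonRadius_bounds : 0.85 < pentagonRadius ∧ pentagonRadius < 0.86 := by
  have h := pentagonRadius_sq
  have h5 := sqrt_five_bounds
  have h0 := pentagonRadius_pos
  constructor <;> nlinarith

theorem cos_three_pi_div_ten : Real.cos (3 * Real.pi / 10) = Real.sin (Real.pi / 5) := by
  rw [← Real.cos_pi_div_two_sub]; congr 1; ring

theorem sin_three_pi_div_ten : Real.sin (3 * Real.pi / 10) = (1 + √5) / 4 := by
  rw [← Real.cos_pi_div_five, ← Real.cos_pi_div_two_sub]; congr 1; ring

theorem cos_two_pi_div_five : Real.cos (2 * Real.pi / 5) = (√5 - 1) / 4 := by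
  have h5 : √5 ^ 2 = (5 : ℝ) := Real.sq_sqrt (by norm_num)
  rw [show 2 * Real.pi / 5 = 2 * (Real.pi / 5) by ring, Real.cos_two_mul, Real.cos_pi_div_five]
  linear_combination (1 / 8) * h5

theorem sin_two_pi_div_five :
    Real.sin (2 * Real.pi / 5) = 2 * Real.sin (Real.pi / 5) * ((1 + √5) / 4) := by
  rw [show 2 * Real.pi / 5 = 2 * (Real.pi / 5) by ring, Real.sin_two_mul, Real.cos_pi_div_five]

open TrianglePentagonComplex (regularPolygonVertex)

theorem regularPolygonVertex_eq {n : ℕ} (i : Fin n) :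
    regularPolygonVertex n i = ((1 / (2 * Real.sin (Real.pi / n)) : ℝ) : ℂ) *
      Complex.exp (((2 * Real.pi / n : ℝ) : ℂ) * Complex.I) ^ (i : ℕ) := by
  unfold regularPolygonVertex
  rw [← Complex.exp_nat_mul]
  congr 2
  push_cast
  ring

theorem regularPolygonVertex_add {n : ℕ} [NeZero n] (i j : Fin n) :
    regularPolygonVertex n (i + j) =
      Complex.exp (((2 * Real.pi / n : ℝ) : ℂ) * Complex.I) ^ (i : ℕ) *
        regularPolygonVertex n j := by
  have h : Complex.exp (((2 * Real.pi / n : ℝ) : ℂ) * Complex.I) ^ n = 1 := by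
    rw [← Complex.exp_nat_mul, ← Complex.exp_two_pi_mul_I]
    congr 1
    have : (n : ℂ) ≠ 0 := by exact_mod_cast NeZero.ne n
    push_cast
    field_simp
  rw [regularPolygonVertex_eq, regularPolygonVertex_eq, Fin.val_add, ← pow_eq_pow_mod _ h,
    pow_add]
  ring

theorem norm_regularPolygonVertex_add_sub {n : ℕ} [NeZero n] (i j k : Fin n) :
    ‖regularPolygonVertex n (i + j) - regularPolygonVertex n (i + k)‖ =
      ‖regularPolygonVertex n j - regularPolygonVertex n k‖ := by
  rw [regularPolygonVertex_add, regularPolygonVertex_add, ← mul_sub, norm_mul, norm_pow,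
    Complex.norm_exp_ofReal_mul_I, one_pow, one_mul]

theorem regularPolygonVertex_re {n : ℕ} (i : Fin n) : (regularPolygonVertex n i).re =
    1 / (2 * Real.sin (Real.pi / n)) * Real.cos (2 * Real.pi * (i : ℕ) / n) := by
  rw [regularPolygonVertex, Complex.re_ofReal_mul, Complex.exp_ofReal_mul_I_re]

theorem regularPolygonVertex_im {n : ℕ} (i : Fin n) : (regularPolygonVertex n i).im =
    1 / (2 * Real.sin (Real.pi / n)) * Real.sin (2 * Real.pi * (i : ℕ) / n) := by
  rw [regularPolygonVertex, Complex.im_ofReal_mul, Complex.exp_ofReal_mul_I_im]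

theorem pentagonVertex_re (i : Fin 5) : (regularPolygonVertex 5 i).re = pentagonRadius *
    ![1, (√5 - 1) / 4, -((1 + √5) / 4), -((1 + √5) / 4), (√5 - 1) / 4] i := by
  rw [regularPolygonVertex_re, ← Real.cos_pi_div_five, ← cos_two_pi_div_five, pentagonRadius,
    Nat.cast_ofNat]
  congr 1
  fin_cases i
  · simp
  · simp
  · simp only [Fin.reduceFinMk, Matrix.cons_val]
    rw [← Real.cos_pi_sub]; congr 1; push_cast; ring
  · simp only [Fin.reduceFinMk, Matrix.cons_val]
    rw [← Real.cos_add_pi]; congr 1; push_cast; ring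
  · simp only [Fin.reduceFinMk, Matrix.cons_val]
    rw [← Real.cos_two_pi_sub]; congr 1; push_cast; ring

theorem pentagonVertex_im (i : Fin 5) : (regularPolygonVertex 5 i).im =
    ![0, (1 + √5) / 4, 1 / 2, -(1 / 2), -((1 + √5) / 4)] i := by
  have h1 := pentagonRadius_mul_sin
  have h2 : pentagonRadius * Real.sin (2 * Real.pi / 5) = (1 + √5) / 4 := by
    rw [sin_two_pi_div_five]; linear_combination ((1 + √5) / 2) * h1
  rw [regularPolygonVertex_im, Nat.cast_ofNat, ← pentagonRadius]
  fin_cases i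
  · simp
  · simpa using h2
  · simp only [Fin.reduceFinMk, Matrix.cons_val]
    rw [← h1, ← Real.sin_pi_sub (Real.pi / 5)]; congr 2; push_cast; ring
  · simp only [Fin.reduceFinMk, Matrix.cons_val]
    rw [← h1, ← mul_neg, ← Real.sin_add_pi (Real.pi / 5)]; congr 2; push_cast; ring
  · simp only [Fin.reduceFinMk, Matrix.cons_val]
    rw [← h2, ← mul_neg, ← Real.sin_two_pi_sub]; congr 2; push_cast; ring

theorem Complex.norm_eq_of_sq {z : ℂ} {r : ℝ} (hr : 0 ≤ r) (h : z.re ^ 2 + z.im ^ 2 = r ^ 2) :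
    ‖z‖ = r := by
  rw [← sq_eq_sq₀ (norm_nonneg _) hr, Complex.sq_norm, Complex.normSq_apply, ← h]; ring

theorem norm_pentagonVertex (i : Fin 5) : ‖regularPolygonVertex 5 i‖ = pentagonRadius := by
  rw [regularPolygonVertex_eq, norm_mul, norm_pow, Complex.norm_exp_ofReal_mul_I, one_pow, mul_one,
    Complex.norm_real, Nat.cast_ofNat, ← pentagonRadius, Real.norm_of_nonneg pentagonRadius_pos.le]

theorem norm_pentagonVertex_succ_sub (i : Fin 5) :
    ‖regularPolygonVertex 5 (i + 1) - regularPolygonVertex 5 i‖ = 1 := by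
  have := norm_regularPolygonVertex_add_sub i 1 0
  rw [add_zero] at this
  rw [this]
  have h5 : √5 ^ 2 = (5 : ℝ) := Real.sq_sqrt (by norm_num)
  refine Complex.norm_eq_of_sq zero_le_one ?_
  rw [Complex.sub_re, Complex.sub_im, pentagonVertex_re, pentagonVertex_re, pentagonVertex_im,
    pentagonVertex_im]
  simp only [Matrix.cons_val]
  linear_combination ((√5 - 1) / 4 - 1) ^ 2 * pentagonRadius_sq + (√5 / 160 + 1 / 32) * h5

theorem norm_pentagonVertex_add_two_sub (i : Fin 5) :
    ‖regularPolygonVertex 5 (i + 2) - regularPolygonVertex 5 i‖ = (1 + √5) / 2 := by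
  have := norm_regularPolygonVertex_add_sub i 2 0
  rw [add_zero] at this
  rw [this]
  have h5 : √5 ^ 2 = (5 : ℝ) := Real.sq_sqrt (by norm_num)
  refine Complex.norm_eq_of_sq (by positivity) ?_
  rw [Complex.sub_re, Complex.sub_im, pentagonVertex_re, pentagonVertex_re, pentagonVertex_im,
    pentagonVertex_im]
  simp only [Matrix.cons_val]
  linear_combination (-((1 + √5) / 4) - 1) ^ 2 * pentagonRadius_sq + (√5 / 160 - 5 / 32) * h5

/-- Writes the center 0 as an affine combination of a vertex and its two neighbours, so that a
function affine near a corner of a pentagon is determined by its values on the two edges there. -/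
theorem pentagon_center_eq (i : Fin 5) :
    (pentagonRadius : ℂ) ^ 2 * ((regularPolygonVertex 5 (i + 1) - regularPolygonVertex 5 i) +
      (regularPolygonVertex 5 (i - 1) - regularPolygonVertex 5 i)) =
      -regularPolygonVertex 5 i := by
  have h5 : √5 ^ 2 = (5 : ℝ) := Real.sq_sqrt (by norm_num)
  have key : (pentagonRadius : ℂ) ^ 2 * ((regularPolygonVertex 5 1 - regularPolygonVertex 5 0) +
      (regularPolygonVertex 5 (-1) - regularPolygonVertex 5 0)) = -regularPolygonVertex 5 0 := by
    rw [← Complex.ofReal_pow, (by decide : (-1 : Fin 5) = 4), pentagonRadius_sq]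
    apply Complex.ext
    · rw [Complex.re_ofReal_mul]
      simp only [Complex.add_re, Complex.sub_re, Complex.neg_re, pentagonVertex_re, Matrix.cons_val]
      linear_combination (pentagonRadius / 20) * h5
    · rw [Complex.im_ofReal_mul]
      simp only [Complex.add_im, Complex.sub_im, Complex.neg_im, pentagonVertex_im, Matrix.cons_val]
      ring
  have h0 := regularPolygonVertex_add i 0
  rw [add_zero] at h0
  rw [sub_eq_add_neg i 1, regularPolygonVertex_add i 1, regularPolygonVertex_add i (-1), h0]
  linear_combination (Complex.exp (((2 * Real.pi / (5 : ℕ) : ℝ) : ℂ) * Complex.I) ^ (i : ℕ)) * key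

theorem norm_triangleVertex_sub {i j : Fin 3} (h : i ≠ j) :
    ‖regularPolygonVertex 3 i - regularPolygonVertex 3 j‖ = 1 := by
  have key : ∀ i : Fin 3, ‖regularPolygonVertex 3 (i + 1) - regularPolygonVertex 3 i‖ = 1 := by
    intro i
    have := norm_regularPolygonVertex_add_sub i 1 0
    rw [add_zero] at this
    rw [this]
    have h3 : √3 ^ 2 = (3 : ℝ) := Real.sq_sqrt (by norm_num)
    have h0 : √3 ≠ 0 := by positivity
    have e1 : Real.cos (2 * Real.pi / 3) = - (1 / 2) := by
      rw [← Real.cos_pi_div_three, ← Real.cos_pi_sub]; congr 1; ring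
    have e2 : Real.sin (2 * Real.pi / 3) = √3 / 2 := by
      rw [← Real.sin_pi_div_three, ← Real.sin_pi_sub]; congr 1; ring
    refine Complex.norm_eq_of_sq zero_le_one ?_
    rw [Complex.sub_re, Complex.sub_im, regularPolygonVertex_re, regularPolygonVertex_re,
      regularPolygonVertex_im, regularPolygonVertex_im]
    simp [e1, e2]
    field_simp
    rw [h3]; norm_num
  fin_cases i <;> fin_cases j <;> try exact absurd rfl h
  · rw [norm_sub_rev]; exact key 0
  · exact key 2
  · exact key 0
  · rw [norm_sub_rev]; exact key 1
  · rw [norm_sub_rev]; exact key 2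
  · exact key 1

theorem norm_segmentVertex_sub {i j : Fin 2} (h : i ≠ j) :
    ‖regularPolygonVertex 2 i - regularPolygonVertex 2 j‖ = 1 := by
  have key : ‖regularPolygonVertex 2 0 - regularPolygonVertex 2 1‖ = 1 := by
    refine Complex.norm_eq_of_sq zero_le_one ?_
    rw [Complex.sub_re, Complex.sub_im, regularPolygonVertex_re, regularPolygonVertex_re,
      regularPolygonVertex_im, regularPolygonVertex_im]
    simp
    norm_num
  fin_cases i <;> fin_cases j <;> try exact absurd rfl h
  · exact key
  · rw [norm_sub_rev]; exact key

/-- The function on the regular pentagon that is affine on the five triangles with apex `0`, equals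
`1` at the vertex with index `0` and vanishes at the other vertices and at `0`. -/
noncomputable def pentagonHat (z : ℂ) : ℝ :=
  max 0 (min (z.re / pentagonRadius - z.im * ((3 - √5) / 2))
    (z.re / pentagonRadius + z.im * ((3 - √5) / 2)))

/-- The hat is built by maxima and minima from linear functions whose coefficients are at most 1.2
and 0.8 in absolute value. -/
theorem abs_pentagonHat_sub_le (z w : ℂ) : |pentagonHat z - pentagonHat w| ≤ 2 * ‖z - w‖ := by
  have hR := pentagonRadius_bounds
  have h5 := sqrt_five_bounds
  have key : ∀ ε : ℝ, |ε| = 1 → |(z.re / pentagonRadius + ε * (z.im * ((3 - √5) / 2))) -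
      (w.re / pentagonRadius + ε * (w.im * ((3 - √5) / 2)))| ≤ 2 * ‖z - w‖ := by
    intro ε hε
    have h1 : |(z.re - w.re) / pentagonRadius| ≤ 1.2 * ‖z - w‖ := by
      rw [abs_div, abs_of_pos pentagonRadius_pos, div_le_iff₀ pentagonRadius_pos, ← Complex.sub_re]
      have := Complex.abs_re_le_norm (z - w)
      have := norm_nonneg (z - w)
      nlinarith
    have h2 : |ε * ((z.im - w.im) * ((3 - √5) / 2))| ≤ 0.8 * ‖z - w‖ := by
      rw [abs_mul, hε, one_mul, abs_mul, ← Complex.sub_im, abs_of_pos (by linarith : (0 : ℝ) < (3 - √5) / 2)]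
      have := Complex.abs_im_le_norm (z - w)
      have := norm_nonneg (z - w)
      nlinarith
    refine (le_of_eq ?_).trans ((abs_add_le _ _).trans ((add_le_add h1 h2).trans (by linarith)))
    congr 1
    ring
  have k1 := key 1 (by simp)
  have k2 := key (-1) (by simp)
  simp only [one_mul, neg_mul, ← sub_eq_add_neg] at k1 k2
  unfold pentagonHat
  refine (abs_max_sub_max_le_max _ _ _ _).trans (max_le (by simp) ?_)
  exact (abs_min_sub_min_le_max _ _ _ _).trans (max_le k2 k1)

/-- Both linear functions in the hat are 1 at vertex 0; one vanishes at vertex 1, the other at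
vertex 4. On each of the three triangles away from vertex 0 one of them is at most 0. -/
theorem pentagonHat_sum {y : Fin 5 → ℝ} (hy : ∀ i, 0 ≤ y i) {j : Fin 5}
    (hj : ∀ i, i ≠ j → i ≠ j + 1 → y i = 0) :
    pentagonHat (∑ k, (y k : ℂ) * regularPolygonVertex 5 k) = y 0 := by
  have hR := pentagonRadius_pos.ne'
  have h5 : √5 ^ 2 = (5 : ℝ) := Real.sq_sqrt (by norm_num)
  have hb := sqrt_five_bounds
  have hre : (∑ k, (y k : ℂ) * regularPolygonVertex 5 k).re / pentagonRadius =
      y 0 + (√5 - 1) / 4 * (y 1 + y 4) - (1 + √5) / 4 * (y 2 + y 3) := by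
    rw [Complex.re_sum]
    simp only [Complex.re_ofReal_mul, Fin.sum_univ_five, pentagonVertex_re, Matrix.cons_val]
    field_simp
    ring
  have him : (∑ k, (y k : ℂ) * regularPolygonVertex 5 k).im * ((3 - √5) / 2) =
      (√5 - 1) / 4 * (y 1 - y 4) + (3 - √5) / 4 * (y 2 - y 3) := by
    rw [Complex.im_sum]
    simp only [Complex.im_ofReal_mul, Fin.sum_univ_five, pentagonVertex_im, Matrix.cons_val]
    linear_combination ((y 4 - y 1) / 8) * h5
  rw [pentagonHat, hre, him]
  have n0 := hy 0
  have n1 := mul_nonneg (hy 1) (by linarith : (0 : ℝ) ≤ √5 - 1)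
  have n2 := mul_nonneg (hy 2) (by linarith : (0 : ℝ) ≤ √5 - 1)
  have n3 := mul_nonneg (hy 3) (by linarith : (0 : ℝ) ≤ √5 - 1)
  have n4 := mul_nonneg (hy 4) (by linarith : (0 : ℝ) ≤ √5 - 1)
  have m2 := hy 2
  have m3 := hy 3
  fin_cases j <;> simp only [Fin.zero_eta, Fin.mk_one, Fin.reduceFinMk] at hj
  · rw [hj 2 (by decide) (by decide), hj 3 (by decide) (by decide), hj 4 (by decide) (by decide),
      min_eq_left (by linarith), max_eq_right (by linarith)]
    ring
  · rw [hj 0 (by decide) (by decide), hj 3 (by decide) (by decide), hj 4 (by decide) (by decide),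
      max_eq_left]
    exact (min_le_left _ _).trans (by linarith)
  · rw [hj 0 (by decide) (by decide), hj 1 (by decide) (by decide), hj 4 (by decide) (by decide),
      max_eq_left]
    exact (min_le_left _ _).trans (by linarith)
  · rw [hj 0 (by decide) (by decide), hj 1 (by decide) (by decide), hj 2 (by decide) (by decide),
      max_eq_left]
    exact (min_le_right _ _).trans (by linarith)
  · rw [hj 1 (by decide) (by decide), hj 2 (by decide) (by decide), hj 3 (by decide) (by decide),
      min_eq_right (by linarith), max_eq_right (by linarith)]
    ring

/-- A rotation of the pentagon moves index `i` to 0, where the coordinate is the hat function of the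
position. -/
theorem abs_sub_le_norm_pentagon_sum {y y' : Fin 5 → ℝ} (hy : ∀ i, 0 ≤ y i) (hy' : ∀ i, 0 ≤ y' i)
    {j j' : Fin 5} (hj : ∀ i, i ≠ j → i ≠ j + 1 → y i = 0)
    (hj' : ∀ i, i ≠ j' → i ≠ j' + 1 → y' i = 0) (i : Fin 5) :
    |y i - y' i| ≤ 2 * ‖∑ k, (y k : ℂ) * regularPolygonVertex 5 k -
      ∑ k, (y' k : ℂ) * regularPolygonVertex 5 k‖ := by
  have shift : ∀ y : Fin 5 → ℝ, ∑ k, (y k : ℂ) * regularPolygonVertex 5 k =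
      Complex.exp (((2 * Real.pi / (5 : ℕ) : ℝ) : ℂ) * Complex.I) ^ (i : ℕ) *
        ∑ k, (y (i + k) : ℂ) * regularPolygonVertex 5 k := by
    intro y
    rw [← Equiv.sum_comp (Equiv.addLeft i), Finset.mul_sum]
    refine Finset.sum_congr rfl fun k _ => ?_
    rw [Equiv.coe_addLeft, regularPolygonVertex_add]
    ring
  have hat : ∀ y : Fin 5 → ℝ, (∀ i, 0 ≤ y i) → ∀ j, (∀ i, i ≠ j → i ≠ j + 1 → y i = 0) →
      pentagonHat (∑ k, (y (i + k) : ℂ) * regularPolygonVertex 5 k) = y i := by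
    intro y hy j hj
    have := pentagonHat_sum (y := fun k => y (i + k)) (fun k => hy _) (j := j - i) fun k h1 h2 =>
      hj _ (fun h => h1 (by rw [← h]; abel)) (fun h => h2 (by rw [sub_add_eq_add_sub, ← h]; abel))
    rw [this, add_zero]
  rw [← hat y hy j hj, ← hat y' hy' j' hj']
  refine (abs_pentagonHat_sub_le _ _).trans (le_of_eq ?_)
  rw [shift y, shift y', ← mul_sub, norm_mul, norm_pow, Complex.norm_exp_ofReal_mul_I, one_pow,
    one_mul]

/-! ### Points of a segment in polar coordinates -/

/-- The distance from `0` to the point with argument `η` of the segment between `s` and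
`r * exp (Θ * I)`. -/
noncomputable def chordRadius (s r Θ η : ℝ) : ℝ :=
  s * r * Real.sin Θ / (s * Real.sin η + r * Real.sin (Θ - η))

/-- The point with argument `η` of the segment between `s` and `r * exp (Θ * I)`. -/
noncomputable def chordPoint (s r Θ η : ℝ) : ℂ :=
  chordRadius s r Θ η * Complex.exp (η * Complex.I)

section Chord

variable {s r Θ : ℝ}

theorem chord_denom_pos (hs : 0 < s) (hr : 0 < r) (h₀ : 0 < Θ) (hπ : Θ < Real.pi) {η : ℝ}
    (hη : η ∈ Set.Icc 0 Θ) : 0 < s * Real.sin η + r * Real.sin (Θ - η) := by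
  have a1 : 0 ≤ Real.sin η := Real.sin_nonneg_of_nonneg_of_le_pi hη.1 (by linarith [hη.2])
  have a2 : 0 ≤ Real.sin (Θ - η) :=
    Real.sin_nonneg_of_nonneg_of_le_pi (by linarith [hη.2]) (by linarith [hη.1])
  rcases hη.1.eq_or_lt with rfl | h
  · have := Real.sin_pos_of_pos_of_lt_pi h₀ hπ
    rw [sub_zero, Real.sin_zero]
    positivity
  · have := Real.sin_pos_of_pos_of_lt_pi h (by linarith [hη.2])
    positivity

theorem chordRadius_pos (hs : 0 < s) (hr : 0 < r) (h₀ : 0 < Θ) (hπ : Θ < Real.pi) {η : ℝ}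
    (hη : η ∈ Set.Icc 0 Θ) : 0 < chordRadius s r Θ η := by
  have := chord_denom_pos hs hr h₀ hπ hη
  have := Real.sin_pos_of_pos_of_lt_pi h₀ hπ
  unfold chordRadius
  positivity

theorem chordPoint_zero (hr : 0 < r) (h₀ : 0 < Θ) (hπ : Θ < Real.pi) :
    chordPoint s r Θ 0 = s := by
  have := (Real.sin_pos_of_pos_of_lt_pi h₀ hπ).ne'
  have h : chordRadius s r Θ 0 = s := by
    simp only [chordRadius, sub_zero, Real.sin_zero, mul_zero, zero_add]
    field_simp
  simp [chordPoint, h]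

theorem chordRadius_self (hs : 0 < s) (h₀ : 0 < Θ) (hπ : Θ < Real.pi) :
    chordRadius s r Θ Θ = r := by
  have := (Real.sin_pos_of_pos_of_lt_pi h₀ hπ).ne'
  simp only [chordRadius, sub_self, Real.sin_zero, mul_zero, add_zero]
  field_simp

/-- The position in the segment between `s` and `r * exp (Θ * I)` of the point with argument `η`. -/
noncomputable def chordParam (s r Θ η : ℝ) : ℝ :=
  s * Real.sin η / (s * Real.sin η + r * Real.sin (Θ - η))

theorem chordPoint_eq (hs : 0 < s) (hr : 0 < r) (h₀ : 0 < Θ) (hπ : Θ < Real.pi) {η : ℝ}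
    (hη : η ∈ Set.Icc 0 Θ) : chordPoint s r Θ η =
      s + (chordParam s r Θ η : ℂ) * (r * Complex.exp (Θ * Complex.I) - s) := by
  have hd := chord_denom_pos hs hr h₀ hπ hη
  have hd' : ((s * Real.sin η + r * Real.sin (Θ - η) : ℝ) : ℂ) ≠ 0 := by exact_mod_cast hd.ne'
  have key := sin_sub_add_sin_mul_exp Θ η
  rw [chordPoint, chordRadius, chordParam, Complex.ofReal_div, Complex.ofReal_div,
    div_mul_eq_mul_div, div_mul_eq_mul_div, div_eq_iff hd', add_mul, div_mul_cancel₀ _ hd']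
  push_cast at key ⊢
  linear_combination (-(s * r : ℂ)) * key

theorem chordParam_strictMonoOn (hs : 0 < s) (hr : 0 < r) (h₀ : 0 < Θ) (hπ : Θ < Real.pi) :
    StrictMonoOn (chordParam s r Θ) (Set.Icc 0 Θ) := by
  intro η₁ h₁ η₂ h₂ h
  have d₁ := chord_denom_pos hs hr h₀ hπ h₁
  have d₂ := chord_denom_pos hs hr h₀ hπ h₂
  rw [chordParam, chordParam, div_lt_div_iff₀ d₁ d₂]
  have e : Real.sin η₂ * Real.sin (Θ - η₁) - Real.sin η₁ * Real.sin (Θ - η₂) =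
      Real.sin Θ * Real.sin (η₂ - η₁) := by
    simp only [Real.sin_sub]; ring
  have p₁ := Real.sin_pos_of_pos_of_lt_pi h₀ hπ
  have p₂ := Real.sin_pos_of_pos_of_lt_pi (sub_pos.2 h) (by linarith [h₁.1, h₂.2])
  have := mul_pos (mul_pos hs hr) (mul_pos p₁ p₂)
  rw [← e] at this
  nlinarith

theorem norm_chordPoint_sub (hs : 0 < s) (hr : 0 < r) (h₀ : 0 < Θ) (hπ : Θ < Real.pi)
    {η₁ η₂ : ℝ} (h₁ : 0 ≤ η₁) (h : η₁ ≤ η₂) (h₂ : η₂ ≤ Θ) :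
    ‖chordPoint s r Θ η₁ - chordPoint s r Θ η₂‖ =
      (chordParam s r Θ η₂ - chordParam s r Θ η₁) * ‖r * Complex.exp (Θ * Complex.I) - s‖ := by
  have m₁ : η₁ ∈ Set.Icc 0 Θ := ⟨h₁, by linarith⟩
  have m₂ : η₂ ∈ Set.Icc 0 Θ := ⟨by linarith, h₂⟩
  rw [chordPoint_eq hs hr h₀ hπ m₁, chordPoint_eq hs hr h₀ hπ m₂, add_sub_add_left_eq_sub,
    ← sub_mul, norm_mul, ← Complex.ofReal_sub, Complex.norm_real, Real.norm_eq_abs,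
    abs_sub_comm, abs_of_nonneg]
  exact sub_nonneg.2 ((chordParam_strictMonoOn hs hr h₀ hπ).monotoneOn m₁ m₂ h)

theorem norm_chordPoint_add (hs : 0 < s) (hr : 0 < r) (h₀ : 0 < Θ) (hπ : Θ < Real.pi)
    {η₁ η₂ η₃ : ℝ} (h₁ : 0 ≤ η₁) (h : η₁ ≤ η₂) (h' : η₂ ≤ η₃) (h₃ : η₃ ≤ Θ) :
    ‖chordPoint s r Θ η₁ - chordPoint s r Θ η₂‖ + ‖chordPoint s r Θ η₂ - chordPoint s r Θ η₃‖ =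
      ‖chordPoint s r Θ η₁ - chordPoint s r Θ η₃‖ := by
  rw [norm_chordPoint_sub hs hr h₀ hπ h₁ h (h'.trans h₃),
    norm_chordPoint_sub hs hr h₀ hπ (h₁.trans h) h' h₃,
    norm_chordPoint_sub hs hr h₀ hπ h₁ (h.trans h') h₃]
  ring

theorem norm_chordPoint_sub_pos (hs : 0 < s) (hr : 0 < r) (h₀ : 0 < Θ) (hπ : Θ < Real.pi)
    {η₁ η₂ : ℝ} (h₁ : 0 ≤ η₁) (h : η₁ < η₂) (h₂ : η₂ ≤ Θ) :
    0 < ‖chordPoint s r Θ η₁ - chordPoint s r Θ η₂‖ := by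
  rw [norm_chordPoint_sub hs hr h₀ hπ h₁ h.le h₂]
  refine mul_pos (sub_pos.2 (chordParam_strictMonoOn hs hr h₀ hπ ⟨h₁, by linarith⟩
    ⟨by linarith, h₂⟩ h)) (norm_pos_iff.2 fun h => ?_)
  have := congrArg Complex.im h
  rw [Complex.sub_im, Complex.im_ofReal_mul, Complex.exp_ofReal_mul_I_im] at this
  simp at this
  exact this.elim hr.ne' (Real.sin_pos_of_pos_of_lt_pi h₀ hπ).ne'

/-- The disc of radius ρ is convex. Thus a chord between points close to a vertex stays where polar
coordinates describe the complex. -/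
theorem chordRadius_le (hs : 0 < s) (hr : 0 < r) (h₀ : 0 < Θ) (hπ : Θ < Real.pi) {η ρ : ℝ}
    (hη : η ∈ Set.Icc 0 Θ) (hsρ : s ≤ ρ) (hrρ : r ≤ ρ) : chordRadius s r Θ η ≤ ρ := by
  have hd := chord_denom_pos hs hr h₀ hπ hη
  have hn : ‖chordPoint s r Θ η‖ = chordRadius s r Θ η := by
    rw [chordPoint, norm_mul, Complex.norm_exp_ofReal_mul_I, mul_one, Complex.norm_real,
      Real.norm_of_nonneg (chordRadius_pos hs hr h₀ hπ hη).le]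
  have a1 : 0 ≤ Real.sin η := Real.sin_nonneg_of_nonneg_of_le_pi hη.1 (by linarith [hη.2])
  have a2 : 0 ≤ Real.sin (Θ - η) :=
    Real.sin_nonneg_of_nonneg_of_le_pi (by linarith [hη.2]) (by linarith [hη.1])
  have l0 : 0 ≤ chordParam s r Θ η := by unfold chordParam; positivity
  have l1 : chordParam s r Θ η ≤ 1 := by
    rw [chordParam, div_le_one hd]
    have := mul_nonneg hr.le a2
    linarith
  have e : chordPoint s r Θ η = ((1 - chordParam s r Θ η : ℝ) : ℂ) * s +
      (chordParam s r Θ η : ℂ) * (r * Complex.exp (Θ * Complex.I)) := by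
    rw [chordPoint_eq hs hr h₀ hπ hη]; push_cast; ring
  rw [← hn, e]
  refine (norm_add_le _ _).trans ?_
  rw [norm_mul, norm_mul, norm_mul, Complex.norm_exp_ofReal_mul_I, Complex.norm_real,
    Complex.norm_real, Complex.norm_real, Complex.norm_real, Real.norm_of_nonneg l0,
    Real.norm_of_nonneg (sub_nonneg.2 l1), Real.norm_of_nonneg hs.le, Real.norm_of_nonneg hr.le]
  nlinarith

theorem continuousOn_chordRadius (hs : 0 < s) (hr : 0 < r) (h₀ : 0 < Θ) (hπ : Θ < Real.pi) :
    ContinuousOn (chordRadius s r Θ) (Set.Icc 0 Θ) :=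
  ContinuousOn.div (by fun_prop) (by fun_prop) fun _ hη => (chord_denom_pos hs hr h₀ hπ hη).ne'

theorem continuousOn_chordPoint (hs : 0 < s) (hr : 0 < r) (h₀ : 0 < Θ) (hπ : Θ < Real.pi) :
    ContinuousOn (chordPoint s r Θ) (Set.Icc 0 Θ) :=
  (Complex.continuous_ofReal.comp_continuousOn (continuousOn_chordRadius hs hr h₀ hπ)).mul
    (by fun_prop)

end Chord

/-- Invariance under rotation about 0: arguments may be measured from the start of a chain of
sectors or from any side of a sector. -/
theorem norm_polar_sub_eq (ρ ρ' : ℝ) {η₁ η₂ η₁' η₂' : ℝ} (h : η₁ - η₂ = η₁' - η₂') :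
    ‖ρ * Complex.exp (η₁ * Complex.I) - ρ' * Complex.exp (η₂ * Complex.I)‖ =
      ‖ρ * Complex.exp (η₁' * Complex.I) - ρ' * Complex.exp (η₂' * Complex.I)‖ := by
  obtain rfl : η₁ = (η₂ - η₂') + η₁' := by linarith
  obtain ⟨β, rfl⟩ : ∃ β, η₂ = β + η₂' := ⟨η₂ - η₂', by ring⟩
  rw [add_sub_cancel_right]
  simp only [Complex.ofReal_add, add_mul, Complex.exp_add]
  rw [mul_left_comm, mul_left_comm (ρ' : ℂ), ← mul_sub, norm_mul, Complex.norm_exp_ofReal_mul_I,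
    one_mul]

/-! ### Simplices of `X*` -/

namespace TrianglePentagonComplex

open scoped Classical

variable {V : Type*} {G : SimpleGraph V} {X : TrianglePentagonComplex G}

theorem cycleGraph_five_adj {i j : Fin 5} :
    (SimpleGraph.cycleGraph 5).Adj i j ↔ j = i + 1 ∨ i = j + 1 := by
  revert i j; decide

theorem adj_boundary {P : X.Pentagon} {i j : Fin 5} :
    G.Adj (X.boundary P i) (X.boundary P j) ↔ j = i + 1 ∨ i = j + 1 := by
  rw [(X.boundary P).map_adj_iff, cycleGraph_five_adj]

theorem adj_of_mem_face {s : Finset (V ⊕ X.Pentagon)} (hs : s ∈ X.star.faces) {u v : V}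
    (hu : Sum.inl u ∈ s) (hv : Sum.inl v ∈ s) (h : u ≠ v) : G.Adj u v := by
  obtain ⟨-, ⟨w, hw⟩ | ⟨w, w', hw, hws⟩ | ⟨t, ht, hts⟩ | ⟨P, i, hP⟩⟩ := hs
  · have h1 := hw hu
    have h2 := hw hv
    simp only [Finset.mem_singleton, Sum.inl.injEq] at h1 h2
    exact absurd (h1.trans h2.symm) h
  · have h1 := hws hu
    have h2 := hws hv
    simp only [Finset.mem_insert, Finset.mem_singleton, Sum.inl.injEq] at h1 h2
    rcases h1 with rfl | rfl <;> rcases h2 with rfl | rfl <;>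
      first | exact hw | exact hw.symm | exact absurd rfl h
  · have h1 := hts hu
    have h2 := hts hv
    simp only [Finset.mem_map, Function.Embedding.inl_apply, Sum.inl.injEq, exists_eq_right]
      at h1 h2
    exact (X.triangles_isNClique t ht).isClique h1 h2 h
  · have h1 := hP hu
    have h2 := hP hv
    simp only [Finset.mem_insert, Finset.mem_singleton, Sum.inl.injEq, reduceCtorEq, false_or]
      at h1 h2
    rcases h1 with rfl | rfl <;> rcases h2 with rfl | rfl <;>
      first | exact absurd rfl h | exact adj_boundary.2 (by simp)

theorem exists_of_inr_mem_face {s : Finset (V ⊕ X.Pentagon)} (hs : s ∈ X.star.faces)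
    {P : X.Pentagon} (hP : Sum.inr P ∈ s) :
    ∃ i, ∀ b ∈ s, b = Sum.inr P ∨ b = Sum.inl (X.boundary P i) ∨
      b = Sum.inl (X.boundary P (i + 1)) := by
  obtain ⟨-, ⟨w, hw⟩ | ⟨w, w', hw, hws⟩ | ⟨t, ht, hts⟩ | ⟨Q, i, hQ⟩⟩ := hs
  · simpa using hw hP
  · simpa using hws hP
  · simpa using hts hP
  · have := hQ hP
    simp only [Finset.mem_insert, Finset.mem_singleton, Sum.inr.injEq, reduceCtorEq, or_false]
      at this
    subst this
    exact ⟨i, fun b hb => by simpa using hQ hb⟩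

theorem inr_eq_of_mem_face {s : Finset (V ⊕ X.Pentagon)} (hs : s ∈ X.star.faces)
    {P Q : X.Pentagon} (hP : Sum.inr P ∈ s) (hQ : Sum.inr Q ∈ s) : P = Q := by
  obtain ⟨i, hi⟩ := exists_of_inr_mem_face hs hP
  simpa [eq_comm] using hi _ hQ

theorem card_face_le {s : Finset (V ⊕ X.Pentagon)} (hs : s ∈ X.star.faces) : s.card ≤ 3 := by
  obtain ⟨-, ⟨w, hw⟩ | ⟨w, w', hw, hws⟩ | ⟨t, ht, hts⟩ | ⟨Q, i, hQ⟩⟩ := hs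
  · exact (Finset.card_le_card hw).trans (by simp)
  · exact (Finset.card_le_card hws).trans (Finset.card_le_two.trans (by norm_num))
  · exact (Finset.card_le_card hts).trans
      (by rw [Finset.card_map, (X.triangles_isNClique t ht).card_eq])
  · exact (Finset.card_le_card hQ).trans Finset.card_le_three

/-! ### Barycentric coordinates -/

theorem Space.nonneg (x : X.Space) (a : V ⊕ X.Pentagon) : 0 ≤ x.1 a := x.2.1 a

theorem Space.exists_face (x : X.Space) : ∃ s ∈ X.star.faces, ∀ a, x.1 a ≠ 0 → a ∈ s := by
  obtain ⟨s, hs, h, -⟩ := x.2.2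
  exact ⟨s, hs, fun a ha => by_contra fun h' => ha (h a h')⟩

theorem Space.sum_eq_one (x : X.Space) {s : Finset (V ⊕ X.Pentagon)}
    (hs : ∀ a, x.1 a ≠ 0 → a ∈ s) : ∑ a ∈ s, x.1 a = 1 := by
  obtain ⟨t, -, h, ht⟩ := x.2.2
  have h1 : ∑ a ∈ s ∪ t, x.1 a = ∑ a ∈ t, x.1 a :=
    (Finset.sum_subset Finset.subset_union_right fun a _ ha => h a ha).symm
  have h2 : ∑ a ∈ s ∪ t, x.1 a = ∑ a ∈ s, x.1 a :=
    (Finset.sum_subset Finset.subset_union_left fun a _ ha =>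
      by_contra fun h' => ha (hs a h')).symm
  rw [← h2, h1, ht]

/-- The extension of a function on the vertices of `X*` that is affine on each simplex. -/
noncomputable def affineExt {E : Type*} [AddCommGroup E] [Module ℝ E] (D : V ⊕ X.Pentagon → E)
    (x : X.Space) : E :=
  ∑ᶠ a, x.1 a • D a

theorem affineExt_eq_sum {E : Type*} [AddCommGroup E] [Module ℝ E] (D : V ⊕ X.Pentagon → E)
    {x : X.Space} {s : Finset (V ⊕ X.Pentagon)} (hs : ∀ a, x.1 a ≠ 0 → a ∈ s) :
    affineExt D x = ∑ a ∈ s, x.1 a • D a := by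
  refine finsum_eq_sum_of_support_subset _ fun a ha => hs a fun h => ?_
  simp [h] at ha

theorem affineExt_sub {E : Type*} [AddCommGroup E] [Module ℝ E] (D : V ⊕ X.Pentagon → E)
    {x y : X.Space} {s : Finset (V ⊕ X.Pentagon)} (hx : ∀ a, x.1 a ≠ 0 → a ∈ s)
    (hy : ∀ a, y.1 a ≠ 0 → a ∈ s) :
    affineExt D x - affineExt D y = ∑ a ∈ s, (x.1 a - y.1 a) • D a := by
  simp [affineExt_eq_sum D hx, affineExt_eq_sum D hy, sub_smul]

theorem sum_sub_eq_zero {x y : X.Space} {s : Finset (V ⊕ X.Pentagon)}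
    (hx : ∀ a, x.1 a ≠ 0 → a ∈ s) (hy : ∀ a, y.1 a ≠ 0 → a ∈ s) :
    ∑ a ∈ s, (x.1 a - y.1 a) = 0 := by
  rw [Finset.sum_sub_distrib, x.sum_eq_one hx, y.sum_eq_one hy, sub_self]

/-! ### Charts -/

/-- The positions of the vertices of `X*` in the chart of a cell. -/
noncomputable def Cell.pos (C : X.Cell) (a : V ⊕ X.Pentagon) : ℂ :=
  ∑ i, if a = Sum.inl (C.vertex i) then regularPolygonVertex C.size i else 0

theorem Cell.chart_eq (C : X.Cell) (x : X.Space) : C.chart x = affineExt C.pos x := by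
  obtain ⟨s, -, hs⟩ := x.exists_face
  rw [affineExt_eq_sum _ hs]
  simp only [Cell.pos, Finset.smul_sum]
  rw [Finset.sum_comm, Cell.chart]
  refine Finset.sum_congr rfl fun i _ => ?_
  simp only [smul_ite, smul_zero, Finset.sum_ite_eq', Complex.real_smul]
  split_ifs with h
  · rfl
  · rw [by_contra fun h' => h (hs _ h')]; simp

theorem pairwise_ne_of_mem_triangles {u v w : V} (h : {u, v, w} ∈ X.triangles) :
    u ≠ v ∧ u ≠ w ∧ v ≠ w := by
  have h3 := (X.triangles_isNClique _ h).card_eq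
  refine ⟨?_, ?_, ?_⟩ <;> rintro rfl <;> simp at h3 <;>
    exact absurd (h3.symm.le.trans Finset.card_le_two) (by norm_num)

theorem injective_vecCons_two {α : Type*} {a b : α} (h : a ≠ b) :
    Function.Injective ![a, b] := by
  intro i j hij
  fin_cases i <;> fin_cases j <;> simp_all

theorem injective_vecCons_three {α : Type*} {a b c : α} (h₁ : a ≠ b) (h₂ : a ≠ c) (h₃ : b ≠ c) :
    Function.Injective ![a, b, c] := by
  intro i j hij
  fin_cases i <;> fin_cases j <;> simp_all [eq_comm]

theorem Cell.vertex_injective (C : X.Cell) : Function.Injective C.vertex := by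
  cases C with
  | edge u v h => exact injective_vecCons_two h.ne
  | triangle u v w h =>
    obtain ⟨h1, h2, h3⟩ := pairwise_ne_of_mem_triangles h
    exact injective_vecCons_three h1 h2 h3
  | pentagon P => exact (X.boundary P).injective

theorem Cell.pos_vertex (C : X.Cell) (i : Fin C.size) :
    C.pos (Sum.inl (C.vertex i)) = regularPolygonVertex C.size i := by
  rw [Cell.pos, Finset.sum_eq_single i]
  · simp
  · intro j _ hj
    rw [if_neg]
    intro h
    exact hj (C.vertex_injective (Sum.inl_injective h)).symm
  · simp

@[simp] theorem Cell.pos_inr (C : X.Cell) (P : X.Pentagon) : C.pos (Sum.inr P) = 0 := by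
  simp [Cell.pos]

/-- The distance between two adjacent vertices of `X*`. -/
noncomputable def starLength : V ⊕ X.Pentagon → V ⊕ X.Pentagon → ℝ
  | Sum.inl u, Sum.inl v => if u = v then 0 else 1
  | Sum.inr _, Sum.inr _ => 0
  | _, _ => pentagonRadius

/-- Edge lengths of a simplex of X* do not depend on the cell in which they are measured. The common
simplex `s` is what rules out the diagonals of a pentagon. -/
theorem Cell.norm_pos_sub (C : X.Cell) {a b : V ⊕ X.Pentagon} (ha : a ∈ C.starVertices)
    (hb : b ∈ C.starVertices) {s : Finset (V ⊕ X.Pentagon)} (hs : s ∈ X.star.faces) (has : a ∈ s)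
    (hbs : b ∈ s) : ‖C.pos a - C.pos b‖ = starLength a b := by
  cases C with
  | edge u v h =>
    have key : ∀ c ∈ (Cell.edge u v h : X.Cell).starVertices, ∃ i : Fin 2, c = Sum.inl (![u, v] i) := by
      rintro c (rfl | rfl)
      · exact ⟨0, rfl⟩
      · exact ⟨1, rfl⟩
    obtain ⟨i, rfl⟩ := key a ha
    obtain ⟨j, rfl⟩ := key b hb
    rcases eq_or_ne i j with rfl | hij
    · simp [starLength]
    · have := (Cell.edge u v h : X.Cell).vertex_injective.ne hij
      have e := norm_segmentVertex_sub hij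
      have p1 := (Cell.edge u v h : X.Cell).pos_vertex i
      have p2 := (Cell.edge u v h : X.Cell).pos_vertex j
      simp only [Cell.vertex, Cell.size] at this p1 p2
      rw [p1, p2, e, starLength, if_neg this]
  | triangle u v w h =>
    have key : ∀ c ∈ (Cell.triangle u v w h : X.Cell).starVertices,
        ∃ i : Fin 3, c = Sum.inl (![u, v, w] i) := by
      rintro c (rfl | rfl | rfl)
      · exact ⟨0, rfl⟩
      · exact ⟨1, rfl⟩
      · exact ⟨2, rfl⟩
    obtain ⟨i, rfl⟩ := key a ha
    obtain ⟨j, rfl⟩ := key b hb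
    rcases eq_or_ne i j with rfl | hij
    · simp [starLength]
    · have := (Cell.triangle u v w h : X.Cell).vertex_injective.ne hij
      have e := norm_triangleVertex_sub hij
      have p1 := (Cell.triangle u v w h : X.Cell).pos_vertex i
      have p2 := (Cell.triangle u v w h : X.Cell).pos_vertex j
      simp only [Cell.vertex, Cell.size] at this p1 p2
      rw [p1, p2, e, starLength, if_neg this]
  | pentagon P =>
    have pv := (Cell.pentagon P : X.Cell).pos_vertex
    simp only [Cell.vertex, Cell.size] at pv
    rcases ha with rfl | ⟨i, rfl⟩ <;> rcases hb with rfl | ⟨j, rfl⟩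
    · simp [starLength]
    · rw [pv, Cell.pos_inr, zero_sub, norm_neg, norm_pentagonVertex]; rfl
    · rw [pv, Cell.pos_inr, sub_zero, norm_pentagonVertex]; rfl
    · beta_reduce at *
      rw [pv, pv]
      rcases eq_or_ne (X.boundary P i) (X.boundary P j) with hij | hij
      · rw [(X.boundary P).injective hij]; simp [starLength]
      · rw [starLength, if_neg hij]
        rcases adj_boundary.1 (adj_of_mem_face hs has hbs hij) with rfl | rfl
        · rw [norm_sub_rev, norm_pentagonVertex_succ_sub]
        · rw [norm_pentagonVertex_succ_sub]

/-- Instance of `norm_sum_smul_eq`. The set `s` need not be a simplex; it is also used for two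
triangles of one pentagon together. -/
theorem norm_affineExt_sub_eq_chart (C : X.Cell) {D : V ⊕ X.Pentagon → ℂ} {x y : X.Space}
    {s : Finset (V ⊕ X.Pentagon)} (hx : ∀ a, x.1 a ≠ 0 → a ∈ s) (hy : ∀ a, y.1 a ≠ 0 → a ∈ s)
    (hD : ∀ a ∈ s, ∀ b ∈ s, ‖D a - D b‖ = ‖C.pos a - C.pos b‖) :
    ‖affineExt D x - affineExt D y‖ = ‖C.chart x - C.chart y‖ := by
  rw [C.chart_eq, C.chart_eq, affineExt_sub D hx hy, affineExt_sub C.pos hx hy]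
  exact norm_sum_smul_eq (sum_sub_eq_zero hx hy) hD

end TrianglePentagonComplex

/-! ### Barycentric coordinates are Lipschitz; local lower bounds for the distance -/

theorem abs_le_norm_triangle_sum {w : Fin 3 → ℝ} (hw : ∑ i, w i = 0) (i : Fin 3) :
    |w i| ≤ 2 * ‖∑ k, (w k : ℂ) * TrianglePentagonComplex.regularPolygonVertex 3 k‖ := by
  have e1 : Real.cos (2 * Real.pi / 3) = - (1 / 2) := by
    rw [← Real.cos_pi_div_three, ← Real.cos_pi_sub]; congr 1; ring
  have e2 : Real.sin (2 * Real.pi / 3) = √3 / 2 := by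
    rw [← Real.sin_pi_div_three, ← Real.sin_pi_sub]; congr 1; ring
  have e3 : Real.cos (2 * Real.pi * 2 / 3) = - (1 / 2) := by
    rw [← Real.cos_pi_div_three, ← Real.cos_add_pi]; congr 1; ring
  have e4 : Real.sin (2 * Real.pi * 2 / 3) = - (√3 / 2) := by
    rw [← Real.sin_pi_div_three, ← Real.sin_add_pi]; congr 1; ring
  set Z := ∑ k, (w k : ℂ) * TrianglePentagonComplex.regularPolygonVertex 3 k with hZ
  have h3 : (0 : ℝ) < √3 := by positivity
  have h3' : √3 < 2 := by rw [Real.sqrt_lt'] <;> norm_num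
  rw [Fin.sum_univ_three] at hw
  have hre : √3 * Z.re = (3 / 2) * w 0 := by
    rw [hZ, Complex.re_sum]
    simp [regularPolygonVertex_re, Fin.sum_univ_three, e1, e3]
    field_simp
    linarith
  have him : Z.im = (w 1 - w 2) / 2 := by
    rw [hZ, Complex.im_sum]
    simp [regularPolygonVertex_im, Fin.sum_univ_three, e2, e4]
    field_simp
    ring
  have r1 := abs_le.1 (Complex.abs_re_le_norm Z)
  have i1 := abs_le.1 (Complex.abs_im_le_norm Z)
  have hn := norm_nonneg Z
  have k1 : w 0 ≤ (4 / 3) * ‖Z‖ := by nlinarith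
  have k2 : -((4 / 3) * ‖Z‖) ≤ w 0 := by nlinarith
  rw [abs_le]
  fin_cases i <;> simp only [Fin.zero_eta, Fin.mk_one, Fin.reduceFinMk] <;>
    constructor <;> linarith

namespace TrianglePentagonComplex

open scoped Classical

variable {V : Type*} {G : SimpleGraph V} {X : TrianglePentagonComplex G}

theorem exists_boundary_edge (P : X.Pentagon) (x : X.Space) :
    ∃ j : Fin 5, ∀ i, i ≠ j → i ≠ j + 1 → x.1 (Sum.inl (X.boundary P i)) = 0 := by
  obtain ⟨s, hs, hxs⟩ := x.exists_face
  have h : ∀ i j : Fin 5, x.1 (Sum.inl (X.boundary P i)) ≠ 0 →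
      x.1 (Sum.inl (X.boundary P j)) ≠ 0 → i = j ∨ j = i + 1 ∨ i = j + 1 := by
    intro i j hi hj
    rcases eq_or_ne i j with hij | hij
    · exact Or.inl hij
    · exact Or.inr (adj_boundary.1 (adj_of_mem_face hs (hxs _ hi) (hxs _ hj)
        fun h => hij ((X.boundary P).injective h)))
  -- Pairwise adjacent vertices of a 5-cycle lie on one edge; checked over all indicator functions.
  have dec : ∀ f : Fin 5 → Bool, (∀ i j, f i = true → f j = true → i = j ∨ j = i + 1 ∨ i = j + 1) →
      ∃ j, ∀ i, i ≠ j → i ≠ j + 1 → f i = false := by decide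
  obtain ⟨j, hj⟩ := dec (fun i => decide (x.1 (Sum.inl (X.boundary P i)) ≠ 0)) (by simpa using h)
  exact ⟨j, by simpa using hj⟩

/-- The worst case is the center of a pentagon: its coordinate is 1 minus the five boundary
coordinates, each of which is 2-Lipschitz. This gives 10, and 11 leaves room. -/
theorem abs_sub_le_chart (C : X.Cell) {x y : X.Space} (hx : x ∈ C.carrier) (hy : y ∈ C.carrier)
    (a : V ⊕ X.Pentagon) : |x.1 a - y.1 a| ≤ 11 * ‖C.chart x - C.chart y‖ := by
  by_cases ha : a ∈ C.starVertices
  swap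
  · have h1 : x.1 a = 0 := by_contra fun h => ha (hx a h)
    have h2 : y.1 a = 0 := by_contra fun h => ha (hy a h)
    rw [h1, h2]; simp
  have hn := norm_nonneg (C.chart x - C.chart y)
  cases C with
  | edge u v h =>
    have hJ : ∀ z : X.Space, z ∈ (Cell.edge u v h : X.Cell).carrier →
        ∀ a, z.1 a ≠ 0 → a ∈ ({Sum.inl u, Sum.inl v} : Finset (V ⊕ X.Pentagon)) :=
      fun z hz a ha => by simpa [Cell.starVertices] using hz a ha
    have hs := sum_sub_eq_zero (hJ x hx) (hJ y hy)
    rw [Finset.sum_pair (by simpa using h.ne)] at hs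
    have e : (Cell.edge u v h : X.Cell).chart x - (Cell.edge u v h : X.Cell).chart y =
        (x.1 (Sum.inl u) - y.1 (Sum.inl u) : ℝ) *
          (regularPolygonVertex 2 0 - regularPolygonVertex 2 1) := by
      have hs' : ((x.1 (Sum.inl v) - y.1 (Sum.inl v) : ℝ) : ℂ) =
        -((x.1 (Sum.inl u) - y.1 (Sum.inl u) : ℝ) : ℂ) := by
          rw [← Complex.ofReal_neg]; congr 1; linarith
      have c : ∀ z : X.Space, (Cell.edge u v h : X.Cell).chart z =
          z.1 (Sum.inl u) * regularPolygonVertex 2 0 + z.1 (Sum.inl v) * regularPolygonVertex 2 1 :=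
        fun z => Fin.sum_univ_two _
      rw [c, c]
      push_cast at hs' ⊢
      linear_combination (regularPolygonVertex 2 1) * hs'
    rw [e, norm_mul, Complex.norm_real, norm_segmentVertex_sub (by decide), mul_one, Real.norm_eq_abs]
    have hnn := abs_nonneg (x.1 (Sum.inl u) - y.1 (Sum.inl u))
    rcases ha with rfl | rfl
    · linarith
    · rw [show x.1 (Sum.inl v) - y.1 (Sum.inl v) = -(x.1 (Sum.inl u) - y.1 (Sum.inl u)) by linarith,
        abs_neg]
      linarith
  | triangle u v w h =>
    obtain ⟨h1, h2, h3⟩ := pairwise_ne_of_mem_triangles h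
    have hJ : ∀ z : X.Space, z ∈ (Cell.triangle u v w h : X.Cell).carrier →
        ∀ a, z.1 a ≠ 0 → a ∈ ({Sum.inl u, Sum.inl v, Sum.inl w} : Finset (V ⊕ X.Pentagon)) :=
      fun z hz a ha => by simpa [Cell.starVertices] using hz a ha
    have hs := sum_sub_eq_zero (hJ x hx) (hJ y hy)
    rw [Finset.sum_insert (by simp [h1, h2]), Finset.sum_pair (by simpa using h3)] at hs
    have key := abs_le_norm_triangle_sum (w := fun i => x.1 (Sum.inl (![u, v, w] i)) -
      y.1 (Sum.inl (![u, v, w] i))) (by rw [Fin.sum_univ_three, add_assoc]; exact hs)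
    have c : (Cell.triangle u v w h : X.Cell).chart x - (Cell.triangle u v w h : X.Cell).chart y =
        ∑ k, ((x.1 (Sum.inl (![u, v, w] k)) - y.1 (Sum.inl (![u, v, w] k)) : ℝ) : ℂ) *
          regularPolygonVertex 3 k := by
      simp only [Complex.ofReal_sub, sub_mul, Finset.sum_sub_distrib]
      rfl
    rw [← c] at key
    rcases ha with rfl | rfl | rfl
    · exact (key 0).trans (by linarith)
    · exact (key 1).trans (by linarith)
    · exact (key 2).trans (by linarith)
  | pentagon P =>
    obtain ⟨j, hj⟩ := exists_boundary_edge P x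
    obtain ⟨j', hj'⟩ := exists_boundary_edge P y
    have key : ∀ i, |x.1 (Sum.inl (X.boundary P i)) - y.1 (Sum.inl (X.boundary P i))| ≤
        2 * ‖(Cell.pentagon P).chart x - (Cell.pentagon P).chart y‖ :=
      abs_sub_le_norm_pentagon_sum (y := fun i => x.1 (Sum.inl (X.boundary P i)))
        (y' := fun i => y.1 (Sum.inl (X.boundary P i))) (fun _ => x.nonneg _) (fun _ => y.nonneg _)
        hj hj'
    rcases ha with rfl | ⟨i, rfl⟩
    · have hJ : ∀ z : X.Space, z ∈ (Cell.pentagon P : X.Cell).carrier → ∀ a, z.1 a ≠ 0 →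
          a ∈ insert (Sum.inr P) (Finset.univ.image fun i => Sum.inl (X.boundary P i)) :=
        fun z hz a ha => by simpa [Cell.starVertices] using hz a ha
      have hs := sum_sub_eq_zero (hJ x hx) (hJ y hy)
      rw [Finset.sum_insert (by simp), Finset.sum_image
        (fun i _ j _ hij => (X.boundary P).injective (Sum.inl_injective hij))] at hs
      rw [eq_neg_of_add_eq_zero_left hs, abs_neg]
      refine (Finset.abs_sum_le_sum_abs _ _).trans ((Finset.sum_le_sum fun i _ => key i).trans ?_)
      simp
      linarith
    · exact (key i).trans (by linarith)

/-- The bound for one cell, summed along a chain. A coordinate of value at least m cannot vanish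
within distance less than m/11, so open stars are open with an explicit radius. -/
theorem edist_coord_le (x y : X.Space) (a : V ⊕ X.Pentagon) :
    edist (x.1 a) (y.1 a) ≤ 11 * edist x y := by
  have step : ∀ x y : X.Space, edist (x.1 a) (y.1 a) ≤ 11 * stepLength x y := by
    intro x y
    unfold stepLength
    rw [ENNReal.mul_iInf_of_ne (by norm_num) (by norm_num)]
    refine le_iInf fun C => ?_
    rw [ENNReal.mul_iInf_of_ne (by norm_num) (by norm_num)]
    refine le_iInf fun hx => ?_
    rw [ENNReal.mul_iInf_of_ne (by norm_num) (by norm_num)]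
    refine le_iInf fun hy => ?_
    rw [edist_dist, edist_dist, Real.dist_eq, dist_eq_norm,
      show (11 : ℝ≥0∞) = ENNReal.ofReal 11 by simp, ← ENNReal.ofReal_mul (by norm_num)]
    exact ENNReal.ofReal_le_ofReal (abs_sub_le_chart C hx hy a)
  change _ ≤ 11 * intrinsicDist x y
  unfold intrinsicDist
  simp only [ENNReal.mul_iInf_of_ne (show (11 : ℝ≥0∞) ≠ 0 by norm_num)
    (show (11 : ℝ≥0∞) ≠ ⊤ by norm_num)]
  refine le_iInf fun n => le_iInf fun z => le_iInf fun h0 => le_iInf fun hn => ?_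
  rw [Finset.mul_sum, ← h0, ← hn]
  exact (edist_le_range_sum_edist (fun i => (z i).1 a) n).trans
    (Finset.sum_le_sum fun i _ => step _ _)

theorem edist_le_stepLength (x y : X.Space) : edist x y ≤ stepLength x y := by
  refine (intrinsicDist_le 1 (fun i => if i = 0 then x else y) rfl rfl).trans ?_
  simp

theorem edist_le_chart (C : X.Cell) {x y : X.Space} (hx : x ∈ C.carrier) (hy : y ∈ C.carrier) :
    edist x y ≤ edist (C.chart x) (C.chart y) :=
  (edist_le_stepLength x y).trans (iInf_le_of_le C (iInf_le_of_le hx (iInf_le_of_le hy le_rfl)))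

/-- A function that is `1`-Lipschitz on the part of each cell in the open star of `σ` yields a local
lower bound for the distance. -/
theorem le_edist_of_lipschitz_on_star {E : Type*} [PseudoEMetricSpace E] (f : X.Space → E)
    (σ : Finset (V ⊕ X.Pentagon))
    (hf : ∀ (C : X.Cell) (x y : X.Space), x ∈ C.carrier → y ∈ C.carrier → (∀ a ∈ σ, x.1 a ≠ 0) →
      (∀ a ∈ σ, y.1 a ≠ 0) → edist (f x) (f y) ≤ edist (C.chart x) (C.chart y))
    {x y : X.Space} {m : ℝ} (hx : ∀ a ∈ σ, m ≤ x.1 a) :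
    min (edist (f x) (f y)) (ENNReal.ofReal (m / 11)) ≤ edist x y := by
  change _ ≤ intrinsicDist x y
  refine le_iInf fun n => le_iInf fun z => le_iInf fun h0 => le_iInf fun hn => ?_
  set S := ∑ i ∈ Finset.range n, stepLength (z i) (z (i + 1)) with hS
  by_cases hSm : ENNReal.ofReal (m / 11) ≤ S
  · exact (min_le_right _ _).trans hSm
  push Not at hSm
  -- A chain shorter than m/11 cannot bring a coordinate from at least `m` down to 0, so it never
  -- leaves the open star of `σ`.
  have mem : ∀ i ≤ n, ∀ a ∈ σ, (z i).1 a ≠ 0 := by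
    intro i hi a ha h
    have h1 : edist x (z i) ≤ S := by
      refine (intrinsicDist_le i z h0 rfl).trans ?_
      exact Finset.sum_le_sum_of_subset (Finset.range_mono hi)
    have h2 := (edist_coord_le x (z i) a).trans (mul_le_mul_right h1 11)
    rw [h, edist_dist, Real.dist_eq, sub_zero, abs_of_nonneg (x.nonneg a)] at h2
    have h3 := (ENNReal.ofReal_le_ofReal (hx a ha)).trans h2
    have h4 := h3.trans_lt (ENNReal.mul_lt_mul_right (a := 11) (by norm_num) (by norm_num) hSm)
    rw [show (11 : ℝ≥0∞) = ENNReal.ofReal 11 by simp, ← ENNReal.ofReal_mul (by norm_num),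
      mul_div_cancel₀ _ (by norm_num)] at h4
    exact lt_irrefl _ h4
  refine (min_le_left _ _).trans ?_
  rw [← h0, ← hn]
  refine (edist_le_range_sum_edist (fun i => f (z i)) n).trans (Finset.sum_le_sum fun i hi => ?_)
  have hi := Finset.mem_range.1 hi
  exact le_iInf fun C => le_iInf fun hx => le_iInf fun hy =>
    hf C _ _ hx hy (mem _ hi.le) (mem _ hi)

theorem edist_ne_top (hX : IsCAT0 X.Space) (x y : X.Space) : edist x y ≠ ⊤ := by
  obtain ⟨ℓ, γ, h⟩ := hX.geodesic x y
  rw [← h.source, ← h.target,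
    h.isometry 0 ⟨le_rfl, h.length_nonneg⟩ ℓ ⟨h.length_nonneg, le_rfl⟩]
  exact ENNReal.ofReal_ne_top

/-- The metric of a CAT(0) triangle-pentagon complex. -/
noncomputable abbrev metric (hX : IsCAT0 X.Space) : PseudoMetricSpace X.Space :=
  PseudoEMetricSpace.toPseudoMetricSpace (edist_ne_top hX)

theorem metric_isCAT0 (hX : IsCAT0 X.Space) : letI := metric hX; IsCAT0 X.Space := hX

/-! ### Sectors at a vertex of `X` -/

/-- The distance of a vertex of `X*` from an adjacent vertex of `X`. -/
noncomputable def spoke : V ⊕ X.Pentagon → ℝ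
  | Sum.inl _ => 1
  | Sum.inr _ => pentagonRadius

/-- The angle at a vertex of `X` of a triangle of `X*` whose other vertices are given. -/
noncomputable def sectorAngle : V ⊕ X.Pentagon → V ⊕ X.Pentagon → ℝ
  | Sum.inl _, Sum.inl _ => Real.pi / 3
  | _, _ => 3 * Real.pi / 10

/-- The vertices `a`, `b`, `c` are the vertices of a triangle of `X*`. -/
def IsSector (X : TrianglePentagonComplex G) (a : V) (b c : V ⊕ X.Pentagon) : Prop :=
  b ≠ Sum.inl a ∧ c ≠ Sum.inl a ∧ b ≠ c ∧ ∃ s ∈ X.star.faces, Sum.inl a ∈ s ∧ b ∈ s ∧ c ∈ s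

theorem IsSector.symm {a : V} {b c : V ⊕ X.Pentagon} (h : X.IsSector a b c) : X.IsSector a c b := by
  obtain ⟨h1, h2, h3, s, hs, ha, hb, hc⟩ := h
  exact ⟨h2, h1, h3.symm, s, hs, ha, hc, hb⟩

theorem spoke_bounds (b : V ⊕ X.Pentagon) : 0.85 < spoke b ∧ spoke b ≤ 1 := by
  have := pentagonRadius_bounds
  cases b <;> simp only [spoke] <;> constructor <;> linarith

theorem spoke_pos (b : V ⊕ X.Pentagon) : 0 < spoke b := by
  linarith [(spoke_bounds b).1]

theorem sectorAngle_comm (b c : V ⊕ X.Pentagon) : sectorAngle b c = sectorAngle c b := by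
  cases b <;> cases c <;> rfl

theorem sectorAngle_le (b c : V ⊕ X.Pentagon) : sectorAngle b c ≤ Real.pi / 3 := by
  have := Real.pi_pos
  cases b <;> cases c <;> simp only [sectorAngle] <;> linarith

theorem sectorAngle_pos (b c : V ⊕ X.Pentagon) : 0 < sectorAngle b c := by
  have := Real.pi_pos
  cases b <;> cases c <;> simp only [sectorAngle] <;> positivity

theorem le_sin_sectorAngle (b c : V ⊕ X.Pentagon) : 0.8 ≤ Real.sin (sectorAngle b c) := by
  have h3 : (1.7 : ℝ) ≤ √3 := Real.le_sqrt_of_sq_le (by norm_num)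
  have h5 := sqrt_five_bounds
  cases b <;> cases c <;> simp only [sectorAngle, sin_three_pi_div_ten, Real.sin_pi_div_three] <;>
    linarith

theorem starLength_comm (a b : V ⊕ X.Pentagon) : starLength a b = starLength b a := by
  cases a <;> cases b <;> simp [starLength, eq_comm]

theorem starLength_self (a : V ⊕ X.Pentagon) : starLength a a = 0 := by
  cases a <;> simp [starLength]

theorem starLength_inl {a : V} {b : V ⊕ X.Pentagon} (h : b ≠ Sum.inl a) :
    starLength (Sum.inl a) b = spoke b := by
  cases b with
  | inl b => simp only [starLength, spoke]; rw [if_neg]; rintro rfl; exact h rfl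
  | inr P => rfl

/-- The law of cosines; `ε` selects the side of the spoke of `b`. With a pentagon center involved,
it comes down to `pentagonRadius_mul_sin`. -/
theorem norm_spoke_sub {s : Finset (V ⊕ X.Pentagon)} (hs : s ∈ X.star.faces)
    {b c : V ⊕ X.Pentagon} (hb : b ∈ s) (hc : c ∈ s) (h : b ≠ c) {ε : ℝ} (hε : ε = 1 ∨ ε = -1) :
    ‖(spoke b : ℂ) - spoke c * Complex.exp ((ε * sectorAngle b c : ℝ) * Complex.I)‖ =
      starLength b c := by
  have hε2 : ε ^ 2 = 1 := by rcases hε with rfl | rfl <;> norm_num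
  have hcos : Real.cos (ε * sectorAngle b c) = Real.cos (sectorAngle b c) := by
    rcases hε with rfl | rfl <;> simp
  have hsin : Real.sin (ε * sectorAngle b c) ^ 2 = 1 - Real.cos (sectorAngle b c) ^ 2 := by
    rw [Real.sin_sq, hcos]
  refine Complex.norm_eq_of_sq ?_ ?_
  · have := pentagonRadius_pos
    cases b <;> cases c <;> simp only [starLength] <;> positivity
  · rw [Complex.sub_re, Complex.sub_im, Complex.re_ofReal_mul, Complex.im_ofReal_mul,
      Complex.exp_ofReal_mul_I_re, Complex.exp_ofReal_mul_I_im, Complex.ofReal_re,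
      Complex.ofReal_im, zero_sub, neg_sq, mul_pow, hsin, hcos]
    have hR := pentagonRadius_mul_sin
    cases b with
    | inl u =>
      cases c with
      | inl v =>
        simp only [spoke, sectorAngle, Real.cos_pi_div_three, starLength]
        rw [if_neg (by rintro rfl; exact h rfl)]; norm_num
      | inr P =>
        simp only [spoke, sectorAngle, cos_three_pi_div_ten, starLength]
        linear_combination (-2) * hR
    | inr P =>
      cases c with
      | inl v =>
        simp only [spoke, sectorAngle, cos_three_pi_div_ten, starLength]
        linear_combination (-2) * hR
      | inr Q => exact absurd (congrArg _ (inr_eq_of_mem_face hs hb hc)) h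

/-- The positions of the vertices of `X*` adjacent to the vertices `a` and `b` when the triangles
with side `a b` are unfolded into the plane, with `b₂` on the upper side and the others on the lower
side. -/
noncomputable def development (a : V) (b b₂ c : V ⊕ X.Pentagon) : ℂ :=
  if c = Sum.inl a then 0 else if c = b then spoke b else
    spoke c * Complex.exp (((if c = b₂ then 1 else -1) * sectorAngle b c : ℝ) * Complex.I)

/-- A simplex containing `a` and `b` has at most one further vertex, so unfolding about the edge `a
b` distorts none of its edges. -/
theorem norm_development_sub {a : V} {b b₂ : V ⊕ X.Pentagon} (hb : b ≠ Sum.inl a)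
    {s : Finset (V ⊕ X.Pentagon)} (hs : s ∈ X.star.faces) (has : Sum.inl a ∈ s) (hbs : b ∈ s)
    {c d : V ⊕ X.Pentagon} (hc : c ∈ s) (hd : d ∈ s) :
    ‖development a b b₂ c - development a b b₂ d‖ = starLength c d := by
  have key : ∀ c d, c ∈ s → d ∈ s → c ≠ d → (c = Sum.inl a ∨ (c = b ∧ d ≠ Sum.inl a)) →
      ‖development a b b₂ c - development a b b₂ d‖ = starLength c d := by
    intro c d hc hd hcd h
    rcases h with rfl | ⟨rfl, hda⟩
    · rw [starLength_inl hcd.symm]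
      unfold development
      rw [if_pos rfl, if_neg hcd.symm, zero_sub, norm_neg]
      split_ifs with h
      · rw [Complex.norm_real, Real.norm_of_nonneg (spoke_pos _).le, h]
      · rw [norm_mul, Complex.norm_exp_ofReal_mul_I, mul_one, Complex.norm_real,
          Real.norm_of_nonneg (spoke_pos _).le]
      · rw [norm_mul, Complex.norm_exp_ofReal_mul_I, mul_one, Complex.norm_real,
          Real.norm_of_nonneg (spoke_pos _).le]
    · unfold development
      rw [if_neg hb, if_pos rfl, if_neg hda, if_neg hcd.symm]
      exact norm_spoke_sub hs hc hd hcd (by split_ifs <;> simp)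
  rcases eq_or_ne c d with rfl | hcd
  · rw [sub_self, norm_zero, starLength_self]
  by_cases h1 : c = Sum.inl a
  · exact key c d hc hd hcd (Or.inl h1)
  by_cases h2 : d = Sum.inl a
  · rw [norm_sub_rev, starLength_comm]
    exact key d c hd hc hcd.symm (Or.inl h2)
  by_cases h3 : c = b
  · exact key c d hc hd hcd (Or.inr ⟨h3, h2⟩)
  by_cases h4 : d = b
  · rw [norm_sub_rev, starLength_comm]
    exact key d c hd hc hcd.symm (Or.inr ⟨h4, h1⟩)
  have h5 : ({Sum.inl a, b, c, d} : Finset (V ⊕ X.Pentagon)) ⊆ s := by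
    simp [Finset.insert_subset_iff, has, hbs, hc, hd]
  have h6 : ({Sum.inl a, b, c, d} : Finset (V ⊕ X.Pentagon)).card = 4 := by
    rw [Finset.card_insert_of_notMem, Finset.card_insert_of_notMem, Finset.card_pair hcd]
    · simp [Ne.symm h3, Ne.symm h4]
    · simp [Ne.symm h1, Ne.symm h2, hb.symm]
  have := (Finset.card_le_card h5).trans (card_face_le hs)
  omega

/-- Unfolded to opposite sides of the spoke to the center, the two triangles of a pentagon at `a`
form its corner of angle 3π/5, and their outer vertices are a diagonal apart. -/
theorem norm_development_sub_pentagon {a : V} {P : X.Pentagon} {b₂ : V ⊕ X.Pentagon} {i : Fin 5}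
    (hi : X.boundary P i = a)
    (h₂ : b₂ = Sum.inl (X.boundary P (i + 1)) ∨ b₂ = Sum.inl (X.boundary P (i - 1))) :
    ‖development a (Sum.inr P) b₂ (Sum.inl (X.boundary P (i + 1))) -
      development a (Sum.inr P) b₂ (Sum.inl (X.boundary P (i - 1)))‖ = (1 + √5) / 2 := by
  have key : ∀ ε : ℝ, ε = 1 ∨ ε = -1 →
      ‖((1 : ℝ) : ℂ) * Complex.exp ((ε * (3 * Real.pi / 10) : ℝ) * Complex.I) -
        ((1 : ℝ) : ℂ) * Complex.exp ((-ε * (3 * Real.pi / 10) : ℝ) * Complex.I)‖ =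
        (1 + √5) / 2 := by
    intro ε hε
    refine Complex.norm_eq_of_sq (by positivity) ?_
    rw [Complex.sub_re, Complex.sub_im, Complex.re_ofReal_mul, Complex.im_ofReal_mul,
      Complex.re_ofReal_mul, Complex.im_ofReal_mul, Complex.exp_ofReal_mul_I_re,
      Complex.exp_ofReal_mul_I_im, Complex.exp_ofReal_mul_I_re, Complex.exp_ofReal_mul_I_im]
    rcases hε with rfl | rfl
    · simp only [neg_mul, one_mul, Real.cos_neg, Real.sin_neg, sin_three_pi_div_ten]; ring
    · simp only [neg_mul, one_mul, neg_neg, Real.cos_neg, Real.sin_neg, sin_three_pi_div_ten]; ring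
  have n1 : X.boundary P (i + 1) ≠ a := by
    rw [← hi]; exact (X.boundary P).injective.ne (by simp)
  have n2 : X.boundary P (i - 1) ≠ a := by
    rw [← hi]; exact (X.boundary P).injective.ne (by simp)
  have n3 : X.boundary P (i + 1) ≠ X.boundary P (i - 1) :=
    (X.boundary P).injective.ne ((by decide : ∀ i : Fin 5, i + 1 ≠ i - 1) i)
  unfold development
  rw [if_neg (Sum.inl_injective.ne n1), if_neg Sum.inl_ne_inr, if_neg (Sum.inl_injective.ne n2),
    if_neg Sum.inl_ne_inr]
  rcases h₂ with rfl | rfl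
  · rw [if_pos rfl, if_neg (Sum.inl_injective.ne n3.symm)]
    exact key 1 (by simp)
  · rw [if_pos rfl, if_neg (Sum.inl_injective.ne n3)]
    have := key (-1) (by simp)
    rwa [neg_neg] at this

/-- Within a pentagon, the open star of the edge `a b` has two triangles if `b` is the center, and
one if `b` is a neighbour of `a`. -/
theorem mem_face_of_mem_carrier_edge {a : V} {b : V ⊕ X.Pentagon}
    {P : X.Pentagon} {x : X.Space} (hx : x ∈ (Cell.pentagon P).carrier)
    (ha : x.1 (Sum.inl a) ≠ 0) (hb : x.1 b ≠ 0) (hab : b ≠ Sum.inl a) :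
    ∃ i, X.boundary P i = a ∧ ((b = Sum.inr P ∧ ∀ c, x.1 c ≠ 0 → c = Sum.inr P ∨ c = Sum.inl a ∨
      c = Sum.inl (X.boundary P (i + 1)) ∨ c = Sum.inl (X.boundary P (i - 1))) ∨
      ((b = Sum.inl (X.boundary P (i + 1)) ∨ b = Sum.inl (X.boundary P (i - 1))) ∧
      ∀ c, x.1 c ≠ 0 → c = Sum.inr P ∨ c = Sum.inl a ∨ c = b)) := by
  obtain ⟨s, hs, hxs⟩ := x.exists_face
  have hcell : ∀ c, x.1 c ≠ 0 → c = Sum.inr P ∨ ∃ i, c = Sum.inl (X.boundary P i) := by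
    intro c hc
    rcases hx c hc with h | ⟨i, h⟩
    · exact Or.inl h
    · exact Or.inr ⟨i, h.symm⟩
  have hadj : ∀ i j, x.1 (Sum.inl (X.boundary P i)) ≠ 0 → x.1 (Sum.inl (X.boundary P j)) ≠ 0 →
      i = j ∨ j = i + 1 ∨ i = j + 1 := by
    intro i j hi hj
    rcases eq_or_ne i j with hij | hij
    · exact Or.inl hij
    · exact Or.inr (adj_boundary.1 (adj_of_mem_face hs (hxs _ hi) (hxs _ hj)
        fun h => hij ((X.boundary P).injective h)))
  obtain ⟨i, hi⟩ : ∃ i, X.boundary P i = a := by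
    rcases hcell _ ha with h | ⟨i, h⟩
    · simp at h
    · exact ⟨i, (Sum.inl_injective h).symm⟩
  subst hi
  refine ⟨i, rfl, ?_⟩
  rcases hcell b hb with rfl | ⟨j, rfl⟩
  · refine Or.inl ⟨rfl, fun c hc => ?_⟩
    rcases hcell c hc with rfl | ⟨k, rfl⟩
    · exact Or.inl rfl
    · rcases hadj i k ha hc with rfl | rfl | rfl
      · simp
      · simp
      · simp
  · have hij : i ≠ j := by rintro rfl; exact hab rfl
    have h1 := (hadj i j ha hb).resolve_left hij
    refine Or.inr ⟨?_, fun c hc => ?_⟩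
    · rcases h1 with rfl | rfl
      · simp
      · simp
    rcases hcell c hc with rfl | ⟨k, rfl⟩
    · exact Or.inl rfl
    · have h2 := hadj i k ha hc
      have h3 := hadj j k hb hc
      have : k = i ∨ k = j := by
        clear hc hb ha hab hcell hadj hxs hx
        revert i j k; decide
      rcases this with rfl | rfl <;> simp

theorem Cell.pos_boundary (P : X.Pentagon) (i : Fin 5) :
    (Cell.pentagon P).pos (Sum.inl (X.boundary P i)) = regularPolygonVertex 5 i :=
  (Cell.pentagon P : X.Cell).pos_vertex i

/-- On the part of one cell near the edge `a b` the development is isometric, although different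
cells may be folded onto the same lower side. If `b` is a pentagon center this part consists of two
triangles; `h₂` makes `b₂` an outer vertex of one of them, so that they land on opposite sides. -/
theorem edist_development_le {a : V} {b b₂ : V ⊕ X.Pentagon} (hb : b ≠ Sum.inl a)
    (h₂ : ∀ P, b = Sum.inr P → X.IsSector a b b₂) (C : X.Cell) {x y : X.Space}
    (hx : x ∈ C.carrier) (hy : y ∈ C.carrier) (hxa : x.1 (Sum.inl a) ≠ 0) (hxb : x.1 b ≠ 0)
    (hya : y.1 (Sum.inl a) ≠ 0) (hyb : y.1 b ≠ 0) :
    edist (affineExt (development a b b₂) x) (affineExt (development a b b₂) y) ≤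
      edist (C.chart x) (C.chart y) := by
  rw [edist_dist, edist_dist, dist_eq_norm, dist_eq_norm]
  refine ENNReal.ofReal_le_ofReal (le_of_eq ?_)
  have of_face : ∀ s ∈ X.star.faces, (∀ c, x.1 c ≠ 0 → c ∈ s) → (∀ c, y.1 c ≠ 0 → c ∈ s) →
      (∀ c ∈ s, c ∈ C.starVertices) → ‖affineExt (development a b b₂) x -
        affineExt (development a b b₂) y‖ = ‖C.chart x - C.chart y‖ := by
    intro s hs hxs hys hsC
    refine norm_affineExt_sub_eq_chart C hxs hys fun c hc d hd => ?_
    rw [norm_development_sub hb hs (hxs _ hxa) (hxs _ hxb) hc hd,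
      C.norm_pos_sub (hsC _ hc) (hsC _ hd) hs hc hd]
  cases C with
  | edge u v h =>
    have hJ : ∀ z : X.Space, z ∈ (Cell.edge u v h : X.Cell).carrier →
        ∀ a, z.1 a ≠ 0 → a ∈ ({Sum.inl u, Sum.inl v} : Finset (V ⊕ X.Pentagon)) :=
      fun z hz a ha => by simpa [Cell.starVertices] using hz a ha
    exact of_face {Sum.inl u, Sum.inl v}
      ⟨by simp, Or.inr (Or.inl ⟨u, v, h, by simp⟩)⟩ (hJ x hx) (hJ y hy)
      (by simp [Cell.starVertices])
  | triangle u v w h =>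
    have hJ : ∀ z : X.Space, z ∈ (Cell.triangle u v w h : X.Cell).carrier →
        ∀ a, z.1 a ≠ 0 → a ∈ ({Sum.inl u, Sum.inl v, Sum.inl w} : Finset (V ⊕ X.Pentagon)) :=
      fun z hz a ha => by simpa [Cell.starVertices] using hz a ha
    exact of_face {Sum.inl u, Sum.inl v, Sum.inl w}
      ⟨by simp, Or.inr (Or.inr (Or.inl ⟨_, h, by simp⟩))⟩ (hJ x hx) (hJ y hy)
      (by simp [Cell.starVertices])
  | pentagon P =>
    have hface : ∀ i, ({Sum.inr P, Sum.inl (X.boundary P i), Sum.inl (X.boundary P (i + 1))} :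
        Finset (V ⊕ X.Pentagon)) ∈ X.star.faces := fun i =>
      ⟨by simp, Or.inr (Or.inr (Or.inr ⟨P, i, by simp⟩))⟩
    have hface' : ∀ i, ({Sum.inr P, Sum.inl (X.boundary P i), Sum.inl (X.boundary P (i - 1))} :
        Finset (V ⊕ X.Pentagon)) ∈ X.star.faces := fun i => by
      have := hface (i - 1)
      rw [sub_add_cancel] at this
      convert this using 2
      exact Finset.pair_comm _ _
    obtain ⟨i, hi, h⟩ := mem_face_of_mem_carrier_edge hx hxa hxb hb
    obtain ⟨j, hj, h'⟩ := mem_face_of_mem_carrier_edge hy hya hyb hb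
    obtain rfl : i = j := (X.boundary P).injective (hi.trans hj.symm)
    rcases h with ⟨rfl, hxs⟩ | ⟨hbi, hxs⟩
    · have hys := (h'.resolve_right fun h => by simp at h).2
      obtain ⟨-, hne, h3, s, hs, has, hPs, hbs⟩ := h₂ P rfl
      have hb₂ : b₂ = Sum.inl (X.boundary P (i + 1)) ∨ b₂ = Sum.inl (X.boundary P (i - 1)) := by
        obtain ⟨k, hk⟩ := exists_of_inr_mem_face hs hPs
        have e1 := (hk _ has).resolve_left (by simp)
        have e2 := (hk _ hbs).resolve_left h3.symm
        rw [← hi] at e1 hne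
        rcases e1 with e1 | e1
        · have := (X.boundary P).injective (Sum.inl_injective e1)
          subst this
          exact Or.inl (e2.resolve_left hne)
        · have := (X.boundary P).injective (Sum.inl_injective e1)
          subst this
          rw [add_sub_cancel_right]
          exact Or.inr (e2.resolve_right hne)
      refine norm_affineExt_sub_eq_chart _
        (s := {Sum.inr P, Sum.inl a, Sum.inl (X.boundary P (i + 1)),
          Sum.inl (X.boundary P (i - 1))}) (by simpa using hxs) (by simpa using hys) ?_
      have f : ∀ s ∈ X.star.faces, Sum.inl a ∈ s → Sum.inr P ∈ s →
          (∀ c ∈ s, c ∈ (Cell.pentagon P).starVertices) → ∀ c ∈ s, ∀ d ∈ s,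
          ‖development a (Sum.inr P) b₂ c - development a (Sum.inr P) b₂ d‖ =
            ‖(Cell.pentagon P).pos c - (Cell.pentagon P).pos d‖ := fun s hs has hPs hsC c hc d hd => by
        rw [norm_development_sub hb hs has hPs hc hd,
          Cell.norm_pos_sub _ (hsC _ hc) (hsC _ hd) hs hc hd]
      have f₁ := f _ (hface i) (by simp [hi]) (by simp) (by simp [Cell.starVertices])
      have f₂ := f _ (hface' i) (by simp [hi]) (by simp) (by simp [Cell.starVertices])
      have f₃ : ‖development a (Sum.inr P) b₂ (Sum.inl (X.boundary P (i + 1))) -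
          development a (Sum.inr P) b₂ (Sum.inl (X.boundary P (i - 1)))‖ =
          ‖(Cell.pentagon P).pos (Sum.inl (X.boundary P (i + 1))) -
            (Cell.pentagon P).pos (Sum.inl (X.boundary P (i - 1)))‖ := by
        rw [norm_development_sub_pentagon hi hb₂]
        have e := norm_pentagonVertex_add_two_sub (i - 1)
        rw [(by decide : ∀ i : Fin 5, i - 1 + 2 = i + 1) i] at e
        rw [Cell.pos_boundary, Cell.pos_boundary, e]
      rw [hi] at f₁ f₂
      simp only [Finset.mem_insert, Finset.mem_singleton] at f₁ f₂ ⊢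
      -- Every pair of the four vertices except the two outer ones lies in one of the two triangles.
      rintro c (rfl | rfl | rfl | rfl) d (rfl | rfl | rfl | rfl) <;>
        first
        | (refine f₁ _ ?_ _ ?_ <;> (simp; done))
        | (refine f₂ _ ?_ _ ?_ <;> (simp; done))
        | exact f₃
        | (rw [norm_sub_rev, f₃, norm_sub_rev])
    · have hys := (h'.resolve_left fun h => by rcases hbi with rfl | rfl <;> simp at h).2
      rcases hbi with rfl | rfl
      · exact of_face _ (hface i) (by simpa [hi] using hxs) (by simpa [hi] using hys)
          (by simp [Cell.starVertices])
      · exact of_face _ (hface' i) (by simpa [hi] using hxs) (by simpa [hi] using hys)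
          (by simp [Cell.starVertices])

/-! ### Distances near a vertex of `X` -/

theorem exists_cell {s : Finset (V ⊕ X.Pentagon)} (hs : s ∈ X.star.faces) {a b : V ⊕ X.Pentagon}
    (ha : a ∈ s) (hb : b ∈ s) (hab : a ≠ b) : ∃ C : X.Cell, ∀ c ∈ s, c ∈ C.starVertices := by
  obtain ⟨-, ⟨w, hw⟩ | ⟨u, v, h, hws⟩ | ⟨t, ht, hts⟩ | ⟨P, i, hP⟩⟩ := hs
  · exact absurd ((Finset.mem_singleton.1 (hw ha)).trans (Finset.mem_singleton.1 (hw hb)).symm) hab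
  · exact ⟨.edge u v h, fun c hc => by simpa [Cell.starVertices] using hws hc⟩
  · obtain ⟨u, v, w, -, -, -, rfl⟩ := Finset.card_eq_three.1 (X.triangles_isNClique t ht).card_eq
    exact ⟨.triangle u v w ht, fun c hc => by simpa [Cell.starVertices, eq_comm] using hts hc⟩
  · refine ⟨.pentagon P, fun c hc => ?_⟩
    have := hP hc
    simp only [Finset.mem_insert, Finset.mem_singleton] at this
    rcases this with rfl | rfl | rfl <;> simp [Cell.starVertices]

theorem edist_le_development {a : V} {b b₂ : V ⊕ X.Pentagon} (hb : b ≠ Sum.inl a)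
    {s : Finset (V ⊕ X.Pentagon)} (hs : s ∈ X.star.faces) (has : Sum.inl a ∈ s) (hbs : b ∈ s)
    {x y : X.Space} (hx : ∀ c, x.1 c ≠ 0 → c ∈ s) (hy : ∀ c, y.1 c ≠ 0 → c ∈ s) :
    edist x y ≤ ENNReal.ofReal
      ‖affineExt (development a b b₂) x - affineExt (development a b b₂) y‖ := by
  obtain ⟨C, hC⟩ := exists_cell hs has hbs hb.symm
  refine (edist_le_chart C (fun c hc => hC c (hx c hc)) (fun c hc => hC c (hy c hc))).trans ?_
  rw [norm_affineExt_sub_eq_chart C hx hy fun c hc d hd => by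
    rw [norm_development_sub hb hs has hbs hc hd, C.norm_pos_sub (hC _ hc) (hC _ hd) hs hc hd],
    edist_dist, dist_eq_norm]

/-- This is `le_edist_of_lipschitz_on_star` for the edge `a b`: the bound m/11 confines competing
chains to its open star. -/
theorem development_le_edist {a : V} {b b₂ : V ⊕ X.Pentagon} (hb : b ≠ Sum.inl a)
    (h₂ : ∀ P, b = Sum.inr P → X.IsSector a b b₂) {x y : X.Space} {m : ℝ}
    (ha : m ≤ x.1 (Sum.inl a)) (hbm : m ≤ x.1 b)
    (h : ‖affineExt (development a b b₂) x - affineExt (development a b b₂) y‖ ≤ m / 11) :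
    ENNReal.ofReal ‖affineExt (development a b b₂) x - affineExt (development a b b₂) y‖ ≤
      edist x y := by
  have := le_edist_of_lipschitz_on_star (affineExt (development a b b₂)) {Sum.inl a, b}
    (fun C x y hx hy hxσ hyσ => edist_development_le hb h₂ C hx hy (hxσ _ (by simp))
      (hxσ _ (by simp)) (hyσ _ (by simp)) (hyσ _ (by simp))) (x := x) (y := y) (m := m)
    (by simp [ha, hbm])
  rwa [edist_dist, dist_eq_norm, min_eq_left (ENNReal.ofReal_le_ofReal h)] at this

/-! ### Flat coordinates on one sector -/

/-- The barycentric coordinates of the point of the triangle `a b c` with coordinates `p` at `b` and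
`q` at `c`. -/
noncomputable def sectorCoord (a : V) (b c : V ⊕ X.Pentagon) (p q : ℝ) (d : V ⊕ X.Pentagon) : ℝ :=
  (if d = Sum.inl a then 1 - p - q else 0) + (if d = b then p else 0) + (if d = c then q else 0)

/-- The vertex `a` as a point. -/
noncomputable def vertexPoint (X : TrianglePentagonComplex G) (a : V) : X.Space :=
  ⟨fun d => if d = Sum.inl a then 1 else 0, fun d => by dsimp only; split_ifs <;> norm_num,
    {Sum.inl a}, ⟨by simp, Or.inl ⟨a, by simp⟩⟩, fun d hd => by simpa using hd, by simp⟩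

/-- The point with the given barycentric coordinates (and the vertex `a` if there is none). -/
noncomputable def pointOfCoord (a : V) (f : V ⊕ X.Pentagon → ℝ) : X.Space :=
  if h : (∀ d, 0 ≤ f d) ∧ ∃ s ∈ X.star.faces, (∀ d, d ∉ s → f d = 0) ∧ ∑ d ∈ s, f d = 1
  then Subtype.mk f h else vertexPoint X a

theorem pointOfCoord_val (a : V) {f : V ⊕ X.Pentagon → ℝ} (h : (∀ d, 0 ≤ f d) ∧
    ∃ s ∈ X.star.faces, (∀ d, d ∉ s → f d = 0) ∧ ∑ d ∈ s, f d = 1) :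
    (pointOfCoord a f).1 = f :=
  congrArg Subtype.val (dif_pos h)

/-- The point of the triangle `a b c` with barycentric coordinates `p` at `b` and `q` at `c`. -/
noncomputable def sectorPoint (a : V) (b c : V ⊕ X.Pentagon) (p q : ℝ) : X.Space :=
  pointOfCoord a (sectorCoord a b c p q)

theorem sectorPoint_val {a : V} {b c : V ⊕ X.Pentagon} {s : Finset (V ⊕ X.Pentagon)}
    (hs : s ∈ X.star.faces) (ha : Sum.inl a ∈ s) (hb : b ∈ s) (hc : c ∈ s) {p q : ℝ} (hp : 0 ≤ p)
    (hq : 0 ≤ q) (hpq : p + q ≤ 1) : (sectorPoint a b c p q).1 = sectorCoord a b c p q := by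
  refine pointOfCoord_val a ⟨fun d => ?_, s, hs, fun d hd => ?_, ?_⟩
  · unfold sectorCoord
    have : 0 ≤ 1 - p - q := by linarith
    positivity
  · unfold sectorCoord
    rw [if_neg (by rintro rfl; exact hd ha), if_neg (by rintro rfl; exact hd hb),
      if_neg (by rintro rfl; exact hd hc)]
    simp
  · simp only [sectorCoord, Finset.sum_add_distrib, Finset.sum_ite_eq', ha, hb, hc, if_true]
    ring

theorem sectorPoint_mem {a : V} {b c : V ⊕ X.Pentagon} {s : Finset (V ⊕ X.Pentagon)}
    (hs : s ∈ X.star.faces) (ha : Sum.inl a ∈ s) (hb : b ∈ s) (hc : c ∈ s) {p q : ℝ} (hp : 0 ≤ p)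
    (hq : 0 ≤ q) (hpq : p + q ≤ 1) (d : V ⊕ X.Pentagon) (hd : (sectorPoint a b c p q).1 d ≠ 0) :
    d ∈ s := by
  by_contra h
  rw [sectorPoint_val hs ha hb hc hp hq hpq, sectorCoord, if_neg (by rintro rfl; exact h ha),
    if_neg (by rintro rfl; exact h hb), if_neg (by rintro rfl; exact h hc)] at hd
  simp at hd

theorem affineExt_sectorPoint {E : Type*} [AddCommGroup E] [Module ℝ E] (D : V ⊕ X.Pentagon → E)
    {a : V} {b c : V ⊕ X.Pentagon} {s : Finset (V ⊕ X.Pentagon)} (hs : s ∈ X.star.faces)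
    (ha : Sum.inl a ∈ s) (hb : b ∈ s) (hc : c ∈ s) {p q : ℝ} (hp : 0 ≤ p) (hq : 0 ≤ q)
    (hpq : p + q ≤ 1) :
    affineExt D (sectorPoint a b c p q) = (1 - p - q) • D (Sum.inl a) + p • D b + q • D c := by
  rw [affineExt_eq_sum D (sectorPoint_mem hs ha hb hc hp hq hpq),
    sectorPoint_val hs ha hb hc hp hq hpq]
  simp only [sectorCoord, add_smul, ite_smul, zero_smul, Finset.sum_add_distrib,
    Finset.sum_ite_eq', ha, hb, hc, if_true]

theorem sectorPoint_comm (a : V) (b c : V ⊕ X.Pentagon) (p q : ℝ) :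
    sectorPoint a b c p q = sectorPoint a c b q p := by
  have : sectorCoord a b c p q = sectorCoord a c b q p := by
    ext d
    simp only [sectorCoord, sub_right_comm 1 p q]
    ring
  rw [sectorPoint, sectorPoint, this]

theorem sectorPoint_zero (a : V) (b c c' : V ⊕ X.Pentagon) (p : ℝ) :
    sectorPoint a b c p 0 = sectorPoint a b c' p 0 := by
  have : sectorCoord a b c p 0 = sectorCoord a b c' p 0 := by
    ext d
    simp [sectorCoord]
  rw [sectorPoint, sectorPoint, this]

theorem development_self (a : V) (b b₂ : V ⊕ X.Pentagon) : development a b b₂ (Sum.inl a) = 0 :=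
  if_pos rfl

theorem development_side {a : V} {b : V ⊕ X.Pentagon} (hb : b ≠ Sum.inl a) (b₂ : V ⊕ X.Pentagon) :
    development a b b₂ b = spoke b := by
  rw [development, if_neg hb, if_pos rfl]

theorem development_upper {a : V} {b b₂ : V ⊕ X.Pentagon} (h : b₂ ≠ Sum.inl a) (h' : b ≠ b₂) :
    development a b b₂ b₂ = spoke b₂ * Complex.exp (sectorAngle b b₂ * Complex.I) := by
  rw [development, if_neg h, if_neg h'.symm, if_pos rfl, one_mul]

theorem development_lower {a : V} {b b₂ c : V ⊕ X.Pentagon} (h : c ≠ Sum.inl a) (h' : b ≠ c)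
    (h'' : c ≠ b₂) :
    development a b b₂ c = spoke c * Complex.exp ((-sectorAngle b c : ℝ) * Complex.I) := by
  rw [development, if_neg h, if_neg h'.symm, if_neg h'', neg_one_mul]

/-- The position in the plane of a point of a sector. -/
noncomputable def flat (b c : V ⊕ X.Pentagon) (p q : ℝ) : ℂ :=
  p * spoke b + q * (spoke c * Complex.exp (sectorAngle b c * Complex.I))

theorem development_sectorPoint {a : V} {b c : V ⊕ X.Pentagon} (h : X.IsSector a b c) {p q : ℝ}
    (hp : 0 ≤ p) (hq : 0 ≤ q) (hpq : p + q ≤ 1) :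
    affineExt (development a b c) (sectorPoint a b c p q) = flat b c p q := by
  obtain ⟨hb, hc, hbc, s, hs, has, hbs, hcs⟩ := h
  rw [affineExt_sectorPoint _ hs has hbs hcs hp hq hpq, development_self, development_side hb,
    development_upper hc hbc, flat]
  simp

open ComplexConjugate in
theorem development_sectorPoint_lower {a : V} {b b₂ c : V ⊕ X.Pentagon} (h : X.IsSector a b c)
    (h₂ : c ≠ b₂) {p q : ℝ} (hp : 0 ≤ p) (hq : 0 ≤ q) (hpq : p + q ≤ 1) :
    affineExt (development a b b₂) (sectorPoint a b c p q) = conj (flat b c p q) := by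
  obtain ⟨hb, hc, hbc, s, hs, has, hbs, hcs⟩ := h
  rw [affineExt_sectorPoint _ hs has hbs hcs hp hq hpq, development_self, development_side hb,
    development_lower hc hbc h₂, flat]
  simp [← Complex.exp_conj]

theorem norm_flat_comm (b c : V ⊕ X.Pentagon) (p q : ℝ) : ‖flat b c p q‖ = ‖flat c b q p‖ := by
  have e : flat b c p q = Complex.exp (sectorAngle b c * Complex.I) *
      (starRingEnd ℂ) (flat c b q p) := by
    simp only [flat, map_add, map_mul, Complex.conj_ofReal, ← Complex.exp_conj, Complex.conj_I,
      sectorAngle_comm c b, mul_neg, Complex.exp_neg]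
    field_simp [Complex.exp_ne_zero]
    ring
  rw [e, norm_mul, Complex.norm_exp_ofReal_mul_I, one_mul, RCLike.norm_conj]

theorem flat_sub (b c : V ⊕ X.Pentagon) (p q p' q' : ℝ) :
    flat b c p q - flat b c p' q' = flat b c (p - p') (q - q') := by
  simp only [flat]; push_cast; ring

theorem flat_mul (b c : V ⊕ X.Pentagon) (t p q : ℝ) :
    flat b c (t * p) (t * q) = t * flat b c p q := by
  simp only [flat]; push_cast; ring

theorem edist_sectorPoint_le {a : V} {b c : V ⊕ X.Pentagon} (h : X.IsSector a b c)
    {p q p' q' : ℝ} (hp : 0 ≤ p) (hq : 0 ≤ q) (hpq : p + q ≤ 1) (hp' : 0 ≤ p') (hq' : 0 ≤ q')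
    (hpq' : p' + q' ≤ 1) : edist (sectorPoint a b c p q) (sectorPoint a b c p' q') ≤
      ENNReal.ofReal ‖flat b c (p - p') (q - q')‖ := by
  have h' := h
  obtain ⟨hb, hc, hbc, s, hs, has, hbs, hcs⟩ := h
  rw [← flat_sub, ← development_sectorPoint h' hp hq hpq, ← development_sectorPoint h' hp' hq' hpq']
  exact edist_le_development hb hs has hbs (sectorPoint_mem hs has hbs hcs hp hq hpq)
    (sectorPoint_mem hs has hbs hcs hp' hq' hpq')

theorem sectorPoint_coord {a : V} {b c : V ⊕ X.Pentagon} (h : X.IsSector a b c) {p q : ℝ}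
    (hp : 0 ≤ p) (hq : 0 ≤ q) (hpq : p + q ≤ 1) :
    (sectorPoint a b c p q).1 (Sum.inl a) = 1 - p - q ∧ (sectorPoint a b c p q).1 b = p ∧
      (sectorPoint a b c p q).1 c = q := by
  obtain ⟨hb, hc, hbc, s, hs, has, hbs, hcs⟩ := h
  rw [sectorPoint_val hs has hbs hcs hp hq hpq]
  simp [sectorCoord, hb, hc, hbc, hb.symm, hc.symm, hbc.symm]

/-- Since p + q ≥ 2m, one of `p`, `q` is at least `m`. The first point is therefore well inside the
open star of one of the two sides at `a`, and the sector is unfolded about that side. -/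
theorem edist_sectorPoint_eq_of_near {a : V} {b c : V ⊕ X.Pentagon} (h : X.IsSector a b c)
    {p q p' q' m : ℝ} (hp : 0 ≤ p) (hq : 0 ≤ q) (hp' : 0 ≤ p') (hq' : 0 ≤ q')
    (hpq' : p' + q' ≤ 1) (hm : p + q + m ≤ 1) (hm' : 2 * m ≤ p + q) (hm₀ : 0 ≤ m)
    (hd : ‖flat b c (p - p') (q - q')‖ ≤ m / 11) :
    edist (sectorPoint a b c p q) (sectorPoint a b c p' q') =
      ENNReal.ofReal ‖flat b c (p - p') (q - q')‖ := by
  refine le_antisymm (edist_sectorPoint_le h hp hq (by linarith) hp' hq' hpq') ?_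
  have key : ∀ {b c : V ⊕ X.Pentagon} (_ : X.IsSector a b c) {p q p' q' : ℝ} (_ : 0 ≤ p) (_ : 0 ≤ q)
      (_ : 0 ≤ p') (_ : 0 ≤ q') (_ : p' + q' ≤ 1) (_ : p + q + m ≤ 1) (_ : m ≤ p)
      (_ : ‖flat b c (p - p') (q - q')‖ ≤ m / 11), ENNReal.ofReal ‖flat b c (p - p') (q - q')‖ ≤
        edist (sectorPoint a b c p q) (sectorPoint a b c p' q') := by
    intro b c h p q p' q' hp hq hp' hq' hpq' hm hmp hd
    rw [← flat_sub, ← development_sectorPoint h hp hq (by linarith),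
      ← development_sectorPoint h hp' hq' hpq'] at hd ⊢
    have hc := sectorPoint_coord h hp hq (by linarith)
    exact development_le_edist h.1 (fun P _ => h) (by rw [hc.1]; linarith)
      (by rw [hc.2.1]; linarith) hd
  rcases le_total m p with h1 | h1
  · exact key h hp hq hp' hq' hpq' hm h1 hd
  · rw [norm_flat_comm] at hd ⊢
    rw [sectorPoint_comm a b c, sectorPoint_comm a b c]
    exact key h.symm hq hp hq' hp' (by linarith) (by linarith) (by linarith) hd

/-- A straight segment in the sector that avoids `a` and the opposite side is a local geodesic,
hence a geodesic. -/
theorem dist_sectorPoint (hX : IsCAT0 X.Space) {a : V} {b c : V ⊕ X.Pentagon}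
    (h : X.IsSector a b c) {p q p' q' : ℝ} (hp : 0 ≤ p) (hq : 0 ≤ q) (hpq : p + q < 1)
    (hpq₀ : 0 < p + q) (hp' : 0 ≤ p') (hq' : 0 ≤ q') (hpq' : p' + q' < 1) (hpq₀' : 0 < p' + q') :
    letI := metric hX
    dist (sectorPoint a b c p q) (sectorPoint a b c p' q') = ‖flat b c p q - flat b c p' q'‖ := by
  let := metric hX
  set L := ‖flat b c p q - flat b c p' q'‖ with hL
  have hL0 : 0 ≤ L := norm_nonneg _
  -- The margins are affine in the point, so a value of `m` that works at both ends works along the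
  -- segment.
  obtain ⟨m, hm, m1, m2, m3, m4⟩ : ∃ m : ℝ, 0 < m ∧ p + q + m ≤ 1 ∧ p' + q' + m ≤ 1 ∧
      2 * m ≤ p + q ∧ 2 * m ≤ p' + q' := by
    refine ⟨min (min (1 - (p + q)) (1 - (p' + q'))) (min ((p + q) / 2) ((p' + q') / 2)), ?_, ?_⟩
    · simp only [lt_min_iff]
      refine ⟨⟨?_, ?_⟩, ?_, ?_⟩ <;> linarith
    · have h1 := min_le_left (min (1 - (p + q)) (1 - (p' + q'))) (min ((p + q) / 2) ((p' + q') / 2))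
      have h2 := min_le_right (min (1 - (p + q)) (1 - (p' + q'))) (min ((p + q) / 2) ((p' + q') / 2))
      obtain ⟨h3, h4⟩ := le_min_iff.1 h1
      obtain ⟨h5, h6⟩ := le_min_iff.1 h2
      refine ⟨?_, ?_, ?_, ?_⟩ <;> linarith
  have key := IsCAT0.dist_eq_of_local (metric_isCAT0 hX)
    (c := fun t => sectorPoint a b c ((1 - t) * p + t * p') ((1 - t) * q + t * q')) (L := L)
    (δ := m / 11 / (L + 1)) (by positivity) hL0 ?_
  · simpa using key
  intro s hs t ht hst
  have e : flat b c (((1 - s) * p + s * p') - ((1 - t) * p + t * p'))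
      (((1 - s) * q + s * q') - ((1 - t) * q + t * q')) =
      ((t - s : ℝ) : ℂ) * (flat b c p q - flat b c p' q') := by
    rw [flat_sub, ← flat_mul]; congr 1 <;> ring
  have e' : ‖flat b c (((1 - s) * p + s * p') - ((1 - t) * p + t * p'))
      (((1 - s) * q + s * q') - ((1 - t) * q + t * q'))‖ = |s - t| * L := by
    rw [e, norm_mul, Complex.norm_real, Real.norm_eq_abs, abs_sub_comm]
  have hs' : 0 ≤ 1 - s := by linarith [hs.2]
  have ht' : 0 ≤ 1 - t := by linarith [ht.2]
  have hs0 := hs.1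
  have ht0 := ht.1
  rw [dist_edist, edist_sectorPoint_eq_of_near h (m := m) (by positivity) (by positivity)
    (by positivity) (by positivity) (by nlinarith) (by nlinarith) (by nlinarith) hm.le, e',
    ENNReal.toReal_ofReal (by positivity)]
  rw [e']
  rw [lt_div_iff₀ (by linarith)] at hst
  nlinarith [abs_nonneg (s - t)]

-- Two sectors with common side `b` unfold to opposite sides of it; conjugation puts the sector of
-- `b₁` below. The reverse estimate comes later from the triangle inequality at a point of the
-- common side.
open ComplexConjugate in
theorem le_dist_sectorPoint_of_near (hX : IsCAT0 X.Space) {a : V} {b b₁ b₂ : V ⊕ X.Pentagon}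
    (h₁ : X.IsSector a b b₁) (h₂ : X.IsSector a b b₂) (h : b₁ ≠ b₂)
    {p q p' q' m : ℝ} (hp : 0 ≤ p) (hq : 0 ≤ q) (hp' : 0 ≤ p') (hq' : 0 ≤ q')
    (hpq' : p' + q' ≤ 1) (hm : p + q + m ≤ 1) (hm' : m ≤ p) (hm₀ : 0 ≤ m)
    (hd : ‖conj (flat b b₁ p q) - flat b b₂ p' q'‖ ≤ m / 11) :
    letI := metric hX
    ‖conj (flat b b₁ p q) - flat b b₂ p' q'‖ ≤
      dist (sectorPoint a b b₁ p q) (sectorPoint a b b₂ p' q') := by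
  let := metric hX
  rw [dist_edist]
  refine (ENNReal.ofReal_le_iff_le_toReal (edist_ne_top hX _ _)).1 ?_
  rw [← development_sectorPoint_lower h₁ h hp hq (by linarith),
    ← development_sectorPoint h₂ hp' hq' hpq'] at hd ⊢
  have hc := sectorPoint_coord h₁ hp hq (by linarith)
  exact development_le_edist h₁.1 (fun P _ => h₂) (by rw [hc.1]; linarith)
    (by rw [hc.2.1]; linarith) hd

/-! ### Chains of sectors at a vertex -/

/-- The point of the sector `b c` at the vertex `a` with polar coordinates `r` and `θ`. -/
noncomputable def polarPoint (a : V) (b c : V ⊕ X.Pentagon) (r θ : ℝ) : X.Space :=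
  sectorPoint a b c (r * Real.sin (sectorAngle b c - θ) / (spoke b * Real.sin (sectorAngle b c)))
    (r * Real.sin θ / (spoke c * Real.sin (sectorAngle b c)))

theorem polarPoint_comm (a : V) (b c : V ⊕ X.Pentagon) (r θ : ℝ) :
    polarPoint a b c r θ = polarPoint a c b r (sectorAngle b c - θ) := by
  rw [polarPoint, polarPoint, sectorPoint_comm, sectorAngle_comm c b, sub_sub_cancel]

theorem polarPoint_zero (a : V) (b c c' : V ⊕ X.Pentagon) (r : ℝ) :
    polarPoint a b c r 0 = polarPoint a b c' r 0 := by
  have h : ∀ c, r * Real.sin (sectorAngle b c) / (spoke b * Real.sin (sectorAngle b c)) =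
      r / spoke b := fun c =>
    mul_div_mul_right _ _ (by linarith [le_sin_sectorAngle b c])
  simp only [polarPoint, sub_zero, h, Real.sin_zero, mul_zero, zero_div]
  exact sectorPoint_zero _ _ _ _ _

/-- The coordinates in `polarPoint` are those supplied by `sin_sub_add_sin_mul_exp`. -/
theorem flat_polar (b c : V ⊕ X.Pentagon) (r θ : ℝ) :
    flat b c (r * Real.sin (sectorAngle b c - θ) / (spoke b * Real.sin (sectorAngle b c)))
      (r * Real.sin θ / (spoke c * Real.sin (sectorAngle b c))) =
      r * Complex.exp (θ * Complex.I) := by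
  have h1 : (spoke b : ℂ) ≠ 0 := by exact_mod_cast (spoke_pos b).ne'
  have h2 : (spoke c : ℂ) ≠ 0 := by exact_mod_cast (spoke_pos c).ne'
  have h3 : (Real.sin (sectorAngle b c) : ℂ) ≠ 0 := by
    have := le_sin_sectorAngle b c
    exact_mod_cast (by linarith : (0 : ℝ) < Real.sin (sectorAngle b c)).ne'
  have key := sin_sub_add_sin_mul_exp (sectorAngle b c) θ
  rw [flat]
  simp only [Complex.ofReal_div, Complex.ofReal_mul]
  generalize Complex.exp (θ * Complex.I) = E at key ⊢
  generalize Complex.exp (sectorAngle b c * Complex.I) = F at key ⊢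
  field_simp
  linear_combination (r : ℂ) * key

/-- Spokes exceed 0.85 and the sines are at least 0.8, so the denominators are at least 0.68 and
each coordinate is at most 3/8. Radius 1/4 thus stays clear of the side opposite `a`. -/
theorem polar_bounds (b c : V ⊕ X.Pentagon) {r θ : ℝ} (hr : 0 < r) (hr' : r ≤ 1 / 4) (hθ : 0 ≤ θ)
    (hθ' : θ ≤ sectorAngle b c) :
    0 ≤ r * Real.sin (sectorAngle b c - θ) / (spoke b * Real.sin (sectorAngle b c)) ∧
    0 ≤ r * Real.sin θ / (spoke c * Real.sin (sectorAngle b c)) ∧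
    0 < r * Real.sin (sectorAngle b c - θ) / (spoke b * Real.sin (sectorAngle b c)) +
      r * Real.sin θ / (spoke c * Real.sin (sectorAngle b c)) ∧
    r * Real.sin (sectorAngle b c - θ) / (spoke b * Real.sin (sectorAngle b c)) +
      r * Real.sin θ / (spoke c * Real.sin (sectorAngle b c)) ≤ 3 / 4 := by
  have hα := sectorAngle_le b c
  have hα0 := sectorAngle_pos b c
  have hs := le_sin_sectorAngle b c
  have hπ := Real.pi_pos
  have l1 := spoke_bounds b
  have l2 := spoke_bounds c
  have s1 : 0 ≤ Real.sin (sectorAngle b c - θ) :=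
    Real.sin_nonneg_of_nonneg_of_le_pi (by linarith) (by linarith)
  have s2 : 0 ≤ Real.sin θ := Real.sin_nonneg_of_nonneg_of_le_pi hθ (by linarith)
  have d1 : 0.68 ≤ spoke b * Real.sin (sectorAngle b c) := by nlinarith
  have d2 : 0.68 ≤ spoke c * Real.sin (sectorAngle b c) := by nlinarith
  have d1' : 0 < spoke b * Real.sin (sectorAngle b c) := by linarith
  have d2' : 0 < spoke c * Real.sin (sectorAngle b c) := by linarith
  have p1 : 0 ≤ r * Real.sin (sectorAngle b c - θ) / (spoke b * Real.sin (sectorAngle b c)) := by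
    positivity
  have p2 : 0 ≤ r * Real.sin θ / (spoke c * Real.sin (sectorAngle b c)) := by positivity
  refine ⟨p1, p2, ?_, ?_⟩
  · rcases hθ.eq_or_lt with rfl | h
    · have : 0 < Real.sin (sectorAngle b c) := by linarith
      simp only [sub_zero, Real.sin_zero, mul_zero, zero_div, add_zero]
      positivity
    · have := Real.sin_pos_of_pos_of_lt_pi h (by linarith)
      refine add_pos_of_nonneg_of_pos p1 (by positivity)
  · have e1 : r * Real.sin (sectorAngle b c - θ) / (spoke b * Real.sin (sectorAngle b c)) ≤ 3 / 8 := by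
      rw [div_le_iff₀ d1']
      nlinarith [Real.sin_le_one (sectorAngle b c - θ)]
    have e2 : r * Real.sin θ / (spoke c * Real.sin (sectorAngle b c)) ≤ 3 / 8 := by
      rw [div_le_iff₀ d2']
      nlinarith [Real.sin_le_one θ]
    linarith

theorem dist_polarPoint (hX : IsCAT0 X.Space) {a : V} {b c : V ⊕ X.Pentagon}
    (h : X.IsSector a b c) {r θ r' θ' : ℝ} (hr : 0 < r) (hr₁ : r ≤ 1 / 4) (hθ : 0 ≤ θ)
    (hθ₁ : θ ≤ sectorAngle b c) (hr' : 0 < r') (hr₁' : r' ≤ 1 / 4) (hθ' : 0 ≤ θ')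
    (hθ₁' : θ' ≤ sectorAngle b c) :
    letI := metric hX
    dist (polarPoint a b c r θ) (polarPoint a b c r' θ') =
      ‖r * Complex.exp (θ * Complex.I) - r' * Complex.exp (θ' * Complex.I)‖ := by
  obtain ⟨h1, h2, h3, h4⟩ := polar_bounds b c hr hr₁ hθ hθ₁
  obtain ⟨k1, k2, k3, k4⟩ := polar_bounds b c hr' hr₁' hθ' hθ₁'
  have := dist_sectorPoint hX h h1 h2 (by linarith) h3 k1 k2 (by linarith) k3
  rwa [flat_polar, flat_polar] at this

theorem le_dist_polarPoint_of_near (hX : IsCAT0 X.Space) {a : V} {b b₁ b₂ : V ⊕ X.Pentagon}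
    (h₁ : X.IsSector a b b₁) (h₂ : X.IsSector a b b₂) (h : b₁ ≠ b₂) {r θ r' θ' m : ℝ} (hr : 0 < r)
    (hr₁ : r ≤ 1 / 4) (hθ : 0 ≤ θ) (hθ₁ : θ ≤ sectorAngle b b₁) (hr' : 0 < r') (hr₁' : r' ≤ 1 / 4)
    (hθ' : 0 ≤ θ') (hθ₁' : θ' ≤ sectorAngle b b₂) (hm : 0 ≤ m) (hm₁ : m ≤ 1 / 4)
    (hm₂ : m ≤ r * Real.sin (sectorAngle b b₁ - θ) / (spoke b * Real.sin (sectorAngle b b₁)))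
    (hd : ‖r * Complex.exp ((-θ : ℝ) * Complex.I) - r' * Complex.exp (θ' * Complex.I)‖ ≤ m / 11) :
    letI := metric hX
    ‖r * Complex.exp ((-θ : ℝ) * Complex.I) - r' * Complex.exp (θ' * Complex.I)‖ ≤
      dist (polarPoint a b b₁ r θ) (polarPoint a b b₂ r' θ') := by
  obtain ⟨h1, h2, h3, h4⟩ := polar_bounds b b₁ hr hr₁ hθ hθ₁
  obtain ⟨k1, k2, k3, k4⟩ := polar_bounds b b₂ hr' hr₁' hθ' hθ₁'
  have e : (starRingEnd ℂ) (r * Complex.exp (θ * Complex.I)) =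
      r * Complex.exp ((-θ : ℝ) * Complex.I) := by
    simp [← Complex.exp_conj]
  have := le_dist_sectorPoint_of_near hX h₁ h₂ h (m := m) h1 h2 k1 k2 (by linarith) (by linarith)
    hm₂ hm (by rwa [flat_polar, flat_polar, e])
  rwa [flat_polar, flat_polar, e] at this

-- One more sector is unfolded. As Θ < π, the planar segment from s to r exp(iΘ) crosses the spoke
-- of `c`, at radius `t`. Its image is a geodesic up to the crossing by `ih`, and beyond it because
-- the new sector is flat. Close to the crossing the two sectors unfold about the spoke, so the
-- pieces fit together by `IsCAT0.dist_eq_add_of_local'`.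
open Filter Topology in
theorem dist_polarPoint_step (hX : IsCAT0 X.Space) {a : V} {x : X.Space} {b c d : V ⊕ X.Pentagon}
    (h₁ : X.IsSector a b c) (h₂ : X.IsSector a c d) (h : b ≠ d) {s Θ₀ : ℝ} (hs : 0 < s)
    (hs' : s ≤ 1 / 4) (hΘ₀ : 0 ≤ Θ₀)
    (ih : letI := metric hX
      ∀ r φ : ℝ, 0 < r → r ≤ 1 / 4 → 0 ≤ φ → φ ≤ sectorAngle b c → Θ₀ + φ < Real.pi →
        dist x (polarPoint a b c r φ) = ‖s - r * Complex.exp ((Θ₀ + φ : ℝ) * Complex.I)‖)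
    {r φ : ℝ} (hr : 0 < r) (hr' : r ≤ 1 / 4) (hφ : 0 ≤ φ) (hφ' : φ ≤ sectorAngle c d)
    (hπ : Θ₀ + sectorAngle b c + φ < Real.pi) :
    letI := metric hX
    dist x (polarPoint a c d r φ) =
      ‖s - r * Complex.exp ((Θ₀ + sectorAngle b c + φ : ℝ) * Complex.I)‖ := by
  let := metric hX
  have hα := sectorAngle_pos b c
  have edge : ∀ r, polarPoint a c d r 0 = polarPoint a b c r (sectorAngle b c) := by
    intro r
    rw [polarPoint_zero a c d b, polarPoint_comm, sub_zero, sectorAngle_comm]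
  rcases hφ.eq_or_lt with rfl | hφ
  · rw [edge, ih r _ hr hr' hα.le le_rfl (by linarith), add_zero]
  set α := sectorAngle b c with hα_def
  set Θ' := Θ₀ + α with hΘ'
  set Θ := Θ' + φ with hΘ
  have hΘ'0 : 0 < Θ' := by linarith
  have hΘ0 : 0 < Θ := by linarith
  have hmem : Θ' ∈ Set.Icc 0 Θ := ⟨hΘ'0.le, by linarith⟩
  set t := chordRadius s r Θ Θ' with ht
  have ht0 : 0 < t := chordRadius_pos hs hr hΘ0 hπ hmem
  have ht1 : t ≤ 1 / 4 := chordRadius_le hs hr hΘ0 hπ hmem hs' hr'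
  have hnhds : Set.Icc 0 Θ ∈ 𝓝 Θ' := Icc_mem_nhds hΘ'0 (by linarith)
  have cR := (continuousOn_chordRadius hs hr hΘ0 hπ).continuousAt hnhds
  have cP := (continuousOn_chordPoint hs hr hΘ0 hπ).continuousAt hnhds
  have hsin := le_sin_sectorAngle c b
  have hsp := spoke_bounds c
  have t1 : Tendsto (fun ψ : ℝ => Θ' - ψ) (𝓝 0) (𝓝 Θ') := by
    have : Continuous fun ψ : ℝ => Θ' - ψ := by fun_prop
    simpa using this.tendsto 0
  have t2 : Tendsto (fun ψ : ℝ => Θ' + ψ) (𝓝 0) (𝓝 Θ') := by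
    have : Continuous fun ψ : ℝ => Θ' + ψ := by fun_prop
    simpa using this.tendsto 0
  -- At ψ = 0 the coordinate at `c` is `t / spoke c`, which is at least `t`; so `t / 2` can serve as
  -- the margin `m` for small ψ.
  have ev1 : ∀ᶠ ψ in 𝓝 (0 : ℝ), t / 2 ≤ chordRadius s r Θ (Θ' - ψ) *
      Real.sin (sectorAngle c b - ψ) / (spoke c * Real.sin (sectorAngle c b)) := by
    have c2 : Tendsto (fun ψ : ℝ => Real.sin (sectorAngle c b - ψ)) (𝓝 0)
        (𝓝 (Real.sin (sectorAngle c b))) := by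
      have : Continuous fun ψ : ℝ => Real.sin (sectorAngle c b - ψ) := by fun_prop
      simpa using this.tendsto 0
    have := ((cR.tendsto.comp t1).mul c2).div_const (spoke c * Real.sin (sectorAngle c b))
    refine (this.eventually_const_lt ?_).mono fun ψ h => h.le
    rw [mul_div_mul_right _ _ (by linarith), ← ht, lt_div_iff₀ (by linarith)]
    nlinarith
  have ev2 : ∀ᶠ ψ in 𝓝 (0 : ℝ),
      ‖chordPoint s r Θ (Θ' - ψ) - chordPoint s r Θ (Θ' + ψ)‖ ≤ t / 2 / 11 := by
    have := ((cP.tendsto.comp t1).sub (cP.tendsto.comp t2)).norm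
    rw [sub_self, norm_zero] at this
    exact (this.eventually_lt_const (by positivity)).mono fun ψ h => h.le
  have ev3 : ∀ᶠ ψ in 𝓝 (0 : ℝ), ψ < min α φ := Iio_mem_nhds (lt_min hα hφ)
  obtain ⟨ψ, ⟨⟨e1, e2⟩, e3⟩, hψ : 0 < ψ⟩ :=
    ((((ev1.and ev2).and ev3).filter_mono nhdsWithin_le_nhds).and
      (self_mem_nhdsWithin (s := Set.Ioi (0 : ℝ)))).exists
  obtain ⟨hψα, hψφ⟩ := lt_min_iff.1 e3
  have m₁ : Θ' - ψ ∈ Set.Icc 0 Θ := ⟨by linarith, by linarith⟩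
  have m₂ : Θ' + ψ ∈ Set.Icc 0 Θ := ⟨by linarith, by linarith⟩
  set ρ := chordRadius s r Θ (Θ' - ψ) with hρ
  set ρ' := chordRadius s r Θ (Θ' + ψ) with hρ'
  have r1 : 0 < ρ := chordRadius_pos hs hr hΘ0 hπ m₁
  have r2 : ρ ≤ 1 / 4 := chordRadius_le hs hr hΘ0 hπ m₁ hs' hr'
  have r3 : 0 < ρ' := chordRadius_pos hs hr hΘ0 hπ m₂
  have r4 : ρ' ≤ 1 / 4 := chordRadius_le hs hr hΘ0 hπ m₂ hs' hr'
  have P0 : chordPoint s r Θ 0 = s := chordPoint_zero hr hΘ0 hπ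
  have PΘ : chordPoint s r Θ Θ = r * Complex.exp (Θ * Complex.I) := by
    rw [chordPoint, chordRadius_self hs hΘ0 hπ]
  have d1 : dist x (polarPoint a b c ρ (α - ψ)) =
      ‖chordPoint s r Θ 0 - chordPoint s r Θ (Θ' - ψ)‖ := by
    rw [ih ρ (α - ψ) r1 r2 (by linarith) (by linarith) (by linarith), P0, chordPoint, ← hρ,
      show Θ₀ + (α - ψ) = Θ' - ψ by ring]
  have d2 : dist x (polarPoint a b c t α) = ‖chordPoint s r Θ 0 - chordPoint s r Θ Θ'‖ := by
    rw [ih t α ht0 ht1 hα.le le_rfl (by linarith), P0, chordPoint]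
  have d3 : dist (polarPoint a b c ρ (α - ψ)) (polarPoint a b c t α) =
      ‖chordPoint s r Θ (Θ' - ψ) - chordPoint s r Θ Θ'‖ := by
    rw [dist_polarPoint hX h₁ r1 r2 (by linarith) (by linarith) ht0 ht1 hα.le le_rfl]
    exact norm_polar_sub_eq _ _ (by ring)
  have d4 : dist (polarPoint a b c t α) (polarPoint a c d ρ' ψ) =
      ‖chordPoint s r Θ Θ' - chordPoint s r Θ (Θ' + ψ)‖ := by
    rw [← edge, dist_polarPoint hX h₂ ht0 ht1 le_rfl (sectorAngle_pos _ _).le r3 r4 hψ.le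
      (by linarith)]
    exact norm_polar_sub_eq _ _ (by ring)
  have d5 : dist (polarPoint a b c t α) (polarPoint a c d r φ) =
      ‖chordPoint s r Θ Θ' - chordPoint s r Θ Θ‖ := by
    rw [← edge, dist_polarPoint hX h₂ ht0 ht1 le_rfl (sectorAngle_pos _ _).le hr hr' hφ.le hφ', PΘ]
    exact norm_polar_sub_eq _ _ (by ring)
  have d6 : dist (polarPoint a c d ρ' ψ) (polarPoint a c d r φ) =
      ‖chordPoint s r Θ (Θ' + ψ) - chordPoint s r Θ Θ‖ := by
    rw [dist_polarPoint hX h₂ r3 r4 hψ.le (by linarith) hr hr' hφ.le hφ', PΘ]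
    exact norm_polar_sub_eq _ _ (by ring)
  have d7 : ‖chordPoint s r Θ (Θ' - ψ) - chordPoint s r Θ (Θ' + ψ)‖ ≤
      dist (polarPoint a b c ρ (α - ψ)) (polarPoint a c d ρ' ψ) := by
    have e : ‖chordPoint s r Θ (Θ' - ψ) - chordPoint s r Θ (Θ' + ψ)‖ =
        ‖ρ * Complex.exp ((-ψ : ℝ) * Complex.I) - ρ' * Complex.exp (ψ * Complex.I)‖ :=
      norm_polar_sub_eq _ _ (by ring)
    rw [polarPoint_comm a b c, ← hα_def, sub_sub_cancel, e]
    rw [e] at e2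
    exact le_dist_polarPoint_of_near hX h₁.symm h₂ h (m := t / 2) r1 r2 hψ.le
      (by rw [sectorAngle_comm]; linarith) r3 r4 hψ.le (by linarith) (by positivity) (by linarith)
      e1 e2
  have a1 := norm_chordPoint_add hs hr hΘ0 hπ le_rfl m₁.1 (by linarith : Θ' - ψ ≤ Θ') hmem.2
  have a2 := norm_chordPoint_add hs hr hΘ0 hπ m₁.1 (by linarith : Θ' - ψ ≤ Θ')
    (by linarith : Θ' ≤ Θ' + ψ) m₂.2
  have a3 := norm_chordPoint_add hs hr hΘ0 hπ hmem.1 (by linarith : Θ' ≤ Θ' + ψ) m₂.2 le_rfl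
  have a4 := norm_chordPoint_add hs hr hΘ0 hπ le_rfl hmem.1 hmem.2 le_rfl
  have key := IsCAT0.dist_eq_add_of_local' (metric_isCAT0 hX) (x := x)
    (x' := polarPoint a b c ρ (α - ψ)) (e := polarPoint a b c t α) (y' := polarPoint a c d ρ' ψ)
    (y := polarPoint a c d r φ)
    (by rw [d3]; exact norm_chordPoint_sub_pos hs hr hΘ0 hπ m₁.1 (by linarith) hmem.2)
    (by rw [d4]; exact norm_chordPoint_sub_pos hs hr hΘ0 hπ hmem.1 (by linarith) m₂.2)
    (by rw [d1, d2, d3]; exact a1) (by rw [d4, d5, d6]; exact a3)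
    (le_antisymm (by rw [d3, d4, a2]; exact d7) (dist_triangle _ _ _))
  rw [← key, d2, d5, a4, P0, PΘ]

theorem dist_polarPoint_chain (hX : IsCAT0 X.Space) {a : V} {b : ℕ → V ⊕ X.Pentagon} {s : ℝ}
    (hs : 0 < s) (hs' : s ≤ 1 / 4) (n : ℕ) (h₁ : ∀ i ≤ n, X.IsSector a (b i) (b (i + 1)))
    (h₂ : ∀ i < n, b i ≠ b (i + 2)) {r φ : ℝ} (hr : 0 < r) (hr' : r ≤ 1 / 4) (hφ : 0 ≤ φ)
    (hφ' : φ ≤ sectorAngle (b n) (b (n + 1)))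
    (hπ : ∑ i ∈ Finset.range n, sectorAngle (b i) (b (i + 1)) + φ < Real.pi) :
    letI := metric hX
    dist (polarPoint a (b 0) (b 1) s 0) (polarPoint a (b n) (b (n + 1)) r φ) =
      ‖s - r * Complex.exp
        ((∑ i ∈ Finset.range n, sectorAngle (b i) (b (i + 1)) + φ : ℝ) * Complex.I)‖ := by
  induction n generalizing r φ with
  | zero =>
    rw [dist_polarPoint hX (h₁ 0 le_rfl) hs hs' le_rfl (sectorAngle_pos _ _).le hr hr' hφ hφ']
    simp
  | succ n ih =>
    rw [Finset.sum_range_succ] at hπ ⊢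
    exact dist_polarPoint_step hX (h₁ n (by omega)) (h₁ (n + 1) le_rfl) (h₂ n (by omega)) hs hs'
      (Finset.sum_nonneg fun i _ => (sectorAngle_pos _ _).le)
      (fun r φ hr hr' hφ hφ' hπ => ih (fun i hi => h₁ i (by omega)) (fun i hi => h₂ i (by omega))
        hr hr' hφ hφ' hπ) hr hr' hφ hφ' hπ

theorem eq_of_norm_one_sub_exp_eq {θ θ' : ℝ} (hθ : θ ∈ Set.Icc 0 Real.pi)
    (hθ' : θ' ∈ Set.Icc 0 Real.pi) {r : ℝ} (hr : 0 < r)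
    (h : ‖r - r * Complex.exp (θ * Complex.I)‖ = ‖r - r * Complex.exp (θ' * Complex.I)‖) :
    θ = θ' := by
  have e : ∀ θ : ℝ, ‖r - r * Complex.exp (θ * Complex.I)‖ ^ 2 = r ^ 2 * (2 - 2 * Real.cos θ) := by
    intro θ
    rw [Complex.sq_norm, Complex.normSq_apply, Complex.sub_re, Complex.sub_im,
      Complex.re_ofReal_mul, Complex.im_ofReal_mul, Complex.exp_ofReal_mul_I_re,
      Complex.exp_ofReal_mul_I_im, Complex.ofReal_re, Complex.ofReal_im]
    linear_combination r ^ 2 * Real.sin_sq_add_cos_sq θ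
  refine Real.injOn_cos hθ hθ' ?_
  have := congrArg (· ^ 2) h
  simp only [e] at this
  have := mul_left_cancel₀ (pow_pos hr 2).ne' this
  linarith

/-- The links of the vertices of a CAT(0) triangle-pentagon complex have girth at least `2π`. -/
theorem two_pi_le_sum_sectorAngle (hX : IsCAT0 X.Space) {a : V} {b : ℕ → V ⊕ X.Pentagon} {k : ℕ}
    (hk : 0 < k) (hbk : b k = b 0) (h₁ : ∀ i < k, X.IsSector a (b i) (b (i + 1)))
    (h₂ : ∀ i, i + 2 ≤ k → b i ≠ b (i + 2)) :
    2 * Real.pi ≤ ∑ i ∈ Finset.range k, sectorAngle (b i) (b (i + 1)) := by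
  by_contra! hlt
  set T : ℕ → ℝ := fun j => ∑ i ∈ Finset.range j, sectorAngle (b i) (b (i + 1)) with hT
  have hT0 : T 0 = 0 := by simp [hT]
  have hTs : ∀ j, T (j + 1) = T j + sectorAngle (b j) (b (j + 1)) := fun j =>
    Finset.sum_range_succ _ _
  have hTk : 0 < T k := Finset.sum_pos (fun i _ => sectorAngle_pos _ _) (by simpa using hk.ne')
  have hex : ∃ j, T k / 2 < T j := ⟨k, by linarith⟩
  -- Sector `j` is the one in which the angle first exceeds half of the total.
  obtain ⟨j, hj⟩ : ∃ j, Nat.find hex = j + 1 := by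
    refine Nat.exists_eq_succ_of_ne_zero fun h => ?_
    have := Nat.find_spec hex
    rw [h, hT0] at this
    linarith
  have hj1 : T k / 2 < T (j + 1) := hj ▸ Nat.find_spec hex
  have hj0 : T j ≤ T k / 2 := not_lt.1 (Nat.find_min hex (by omega))
  have hjk : j + 1 ≤ k := hj ▸ Nat.find_min' hex (by linarith)
  -- θ lies beyond half the total, so that θ and T k - θ differ, but below π, so that both
  -- directions can be unfolded.
  obtain ⟨θ, hθ, hθ'⟩ := exists_between
    (lt_min hj1 (by change T k < _ at hlt; linarith : T k / 2 < Real.pi))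
  obtain ⟨hθ1, hθ2⟩ := lt_min_iff.1 hθ'
  rw [hTs] at hθ1
  have fwd := dist_polarPoint_chain hX (s := 1 / 4) (by norm_num) le_rfl j
    (fun i hi => h₁ i (by omega)) (fun i hi => h₂ i (by omega)) (r := 1 / 4) (φ := θ - T j)
    (by norm_num) le_rfl (by linarith) (by linarith) (by change T j + _ < _; linarith)
  have hrev : ∀ m ≤ k, ∑ i ∈ Finset.range m, sectorAngle (b (k - i)) (b (k - (i + 1))) =
      T k - T (k - m) := by
    intro m hm
    induction m with
    | zero => simp
    | succ m ih =>
      rw [Finset.sum_range_succ, ih (by omega), sectorAngle_comm]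
      have := hTs (k - (m + 1))
      rw [show k - (m + 1) + 1 = k - m by omega] at this
      linarith
  have hsum := hrev (k - (j + 1)) (by omega)
  rw [show k - (k - (j + 1)) = j + 1 by omega, hTs] at hsum
  have hTjk : 0 ≤ T k - (T j + sectorAngle (b j) (b (j + 1))) :=
    hsum ▸ Finset.sum_nonneg fun i _ => (sectorAngle_pos _ _).le
  -- The chain read backwards from `b k = b 0` reaches the same point at angle T k - θ.
  have bwd := dist_polarPoint_chain hX (a := a) (b := fun i => b (k - i)) (s := 1 / 4) (by norm_num)
    le_rfl (k - (j + 1))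
    (fun i hi => by
      have := (h₁ (k - (i + 1)) (by omega)).symm
      rwa [show k - (i + 1) + 1 = k - i by omega] at this)
    (fun i hi => by
      have := (h₂ (k - (i + 2)) (by omega)).symm
      rwa [show k - (i + 2) + 2 = k - i by omega] at this) (r := 1 / 4)
    (φ := sectorAngle (b j) (b (j + 1)) - (θ - T j))
    (by norm_num) le_rfl (by linarith)
    (by
      rw [show k - (k - (j + 1)) = j + 1 by omega, show k - (k - (j + 1) + 1) = j by omega,
        sectorAngle_comm]
      linarith) (by rw [hsum]; linarith)
  rw [hsum, show k - (k - (j + 1)) = j + 1 by omega, show k - (k - (j + 1) + 1) = j by omega,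
    ← polarPoint_comm, Nat.sub_zero, hbk, polarPoint_zero a (b 0) (b (k - 1)) (b 1), fwd] at bwd
  have := eq_of_norm_one_sub_exp_eq ⟨by linarith, by linarith⟩ ⟨by linarith, by linarith⟩
    (by norm_num) bwd
  change T j + (θ - T j) = _ at this
  linarith

/-! ### Edges are geodesics -/

theorem edge_mem_faces (X : TrianglePentagonComplex G) {a b : V} (h : G.Adj a b) :
    ({Sum.inl a, Sum.inl b} : Finset (V ⊕ X.Pentagon)) ∈ X.star.faces :=
  ⟨by simp, Or.inr (Or.inl ⟨a, b, h, by simp⟩)⟩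

/-- The point at distance `t` from `a` of the edge from `a` to `b`. -/
noncomputable def edgePoint (X : TrianglePentagonComplex G) (a b : V) (t : ℝ) : X.Space :=
  sectorPoint a (Sum.inl b) (Sum.inl a) t 0

theorem edgePoint_val {a b : V} (h : G.Adj a b) {t : ℝ} (ht : t ∈ Set.Icc (0 : ℝ) 1) :
    (edgePoint X a b t).1 = sectorCoord a (Sum.inl b) (Sum.inl a) t 0 :=
  sectorPoint_val (edge_mem_faces X h) (by simp) (by simp) (by simp) ht.1 le_rfl (by simpa using ht.2)

theorem affineExt_edgePoint {E : Type*} [AddCommGroup E] [Module ℝ E] (D : V ⊕ X.Pentagon → E)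
    {a b : V} (h : G.Adj a b) {t : ℝ} (ht : t ∈ Set.Icc (0 : ℝ) 1) :
    affineExt D (edgePoint X a b t) = (1 - t) • D (Sum.inl a) + t • D (Sum.inl b) := by
  rw [edgePoint, affineExt_sectorPoint D (edge_mem_faces X h) (by simp) (by simp) (by simp) ht.1
    le_rfl (by simpa using ht.2)]
  simp

theorem edgePoint_zero {a b : V} (h : G.Adj a b) : edgePoint X a b 0 = vertexPoint X a := by
  refine Subtype.ext ((edgePoint_val h (by simp)).trans ?_)
  ext d
  simp [sectorCoord, vertexPoint]

theorem edgePoint_one {a b : V} (h : G.Adj a b) : edgePoint X a b 1 = vertexPoint X b := by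
  refine Subtype.ext ((edgePoint_val h (by simp)).trans ?_)
  ext d
  simp [sectorCoord, vertexPoint]

theorem development_edgePoint {a b : V} (h : G.Adj a b) {s t : ℝ} (hs : s ∈ Set.Icc (0 : ℝ) 1)
    (ht : t ∈ Set.Icc (0 : ℝ) 1) :
    ‖affineExt (development a (Sum.inl b) (Sum.inl a)) (edgePoint X a b s) -
      affineExt (development a (Sum.inl b) (Sum.inl a)) (edgePoint X a b t)‖ = |s - t| := by
  have hb : (Sum.inl b : V ⊕ X.Pentagon) ≠ Sum.inl a := by simpa using h.ne'
  rw [affineExt_edgePoint _ h hs, affineExt_edgePoint _ h ht, development_self,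
    development_side hb]
  simp only [smul_zero, zero_add, spoke, Complex.ofReal_one, Complex.real_smul, mul_one]
  rw [← Complex.ofReal_sub, Complex.norm_real, Real.norm_eq_abs]

theorem edist_edgePoint_le {a b : V} (h : G.Adj a b) {s t : ℝ} (hs : s ∈ Set.Icc (0 : ℝ) 1)
    (ht : t ∈ Set.Icc (0 : ℝ) 1) :
    edist (edgePoint X a b s) (edgePoint X a b t) ≤ ENNReal.ofReal |s - t| := by
  have hb : (Sum.inl b : V ⊕ X.Pentagon) ≠ Sum.inl a := by simpa using h.ne'
  rw [← development_edgePoint h hs ht]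
  have hm : ∀ t ∈ Set.Icc (0 : ℝ) 1, ∀ c, (edgePoint X a b t).1 c ≠ 0 →
      c ∈ ({Sum.inl a, Sum.inl b} : Finset (V ⊕ X.Pentagon)) := fun t ht =>
    sectorPoint_mem (edge_mem_faces X h) (by simp) (by simp) (by simp) ht.1 le_rfl
      (by simpa using ht.2)
  exact edist_le_development hb (edge_mem_faces X h) (by simp) (by simp) (hm s hs) (hm t ht)

/-- Between interior points both coordinates stay at least `m`, so unfolding about the edge shows
that the segment is a local geodesic. -/
theorem dist_edgePoint_of_mem_Ioo (hX : IsCAT0 X.Space) {a b : V} (h : G.Adj a b) {s t : ℝ}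
    (hs : s ∈ Set.Ioo (0 : ℝ) 1) (ht : t ∈ Set.Ioo (0 : ℝ) 1) :
    letI := metric hX
    dist (edgePoint X a b s) (edgePoint X a b t) = |s - t| := by
  let := metric hX
  have hb : (Sum.inl b : V ⊕ X.Pentagon) ≠ Sum.inl a := by simpa using h.ne'
  obtain ⟨m, hm, m1, m2, m3, m4⟩ : ∃ m : ℝ, 0 < m ∧ m ≤ s ∧ m ≤ t ∧ m ≤ 1 - s ∧ m ≤ 1 - t := by
    refine ⟨min (min s t) (min (1 - s) (1 - t)), ?_, ?_⟩
    · simp only [lt_min_iff]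
      refine ⟨⟨hs.1, ht.1⟩, ?_, ?_⟩ <;> linarith [hs.2, ht.2]
    · obtain ⟨h3, h4⟩ := le_min_iff.1 (min_le_left (min s t) (min (1 - s) (1 - t)))
      obtain ⟨h5, h6⟩ := le_min_iff.1 (min_le_right (min s t) (min (1 - s) (1 - t)))
      exact ⟨h3, h4, h5, h6⟩
  have key := IsCAT0.dist_eq_of_local (metric_isCAT0 hX)
    (c := fun u => edgePoint X a b ((1 - u) * s + u * t)) (L := |s - t|)
    (δ := m / 11 / (|s - t| + 1)) (by positivity) (abs_nonneg _) ?_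
  · simpa using key
  intro u hu w hw huw
  have mem : ∀ u ∈ Set.Icc (0 : ℝ) 1, m ≤ (1 - u) * s + u * t ∧ (1 - u) * s + u * t ≤ 1 - m := by
    intro u hu
    have h1 := hu.1
    have h2 : 0 ≤ 1 - u := by linarith [hu.2]
    constructor <;> nlinarith
  have mem' : ∀ u ∈ Set.Icc (0 : ℝ) 1, (1 - u) * s + u * t ∈ Set.Icc (0 : ℝ) 1 := fun u hu =>
    ⟨by linarith [(mem u hu).1], by linarith [(mem u hu).2]⟩
  have e : |((1 - u) * s + u * t) - ((1 - w) * s + w * t)| = |u - w| * |s - t| := by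
    rw [← abs_mul, ← abs_neg ((u - w) * (s - t))]; congr 1; ring
  have hle : |((1 - u) * s + u * t) - ((1 - w) * s + w * t)| ≤ m / 11 := by
    rw [e]
    rw [lt_div_iff₀ (by positivity)] at huw
    nlinarith [abs_nonneg (u - w)]
  have up := edist_edgePoint_le (X := X) h (mem' u hu) (mem' w hw)
  have lo := development_le_edist (X := X) (b₂ := Sum.inl a) (m := m) hb (fun P hP => by simp at hP)
    (x := edgePoint X a b ((1 - u) * s + u * t)) (y := edgePoint X a b ((1 - w) * s + w * t))
    (by
      rw [edgePoint_val h (mem' u hu)]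
      simp only [sectorCoord, if_true, if_neg hb.symm]
      linarith [(mem u hu).2])
    (by
      rw [edgePoint_val h (mem' u hu)]
      simp only [sectorCoord, if_true, if_neg hb]
      linarith [(mem u hu).1])
    (by rwa [development_edgePoint h (mem' u hu) (mem' w hw)])
  rw [development_edgePoint h (mem' u hu) (mem' w hw)] at lo
  rw [dist_edist, le_antisymm up lo, ENNReal.toReal_ofReal (abs_nonneg _), e]

theorem dist_edgePoint (hX : IsCAT0 X.Space) {a b : V} (h : G.Adj a b) {s t : ℝ}
    (hs : s ∈ Set.Icc (0 : ℝ) 1) (ht : t ∈ Set.Icc (0 : ℝ) 1) :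
    letI := metric hX
    dist (edgePoint X a b s) (edgePoint X a b t) = |s - t| := by
  let := metric hX
  have up : ∀ s ∈ Set.Icc (0 : ℝ) 1, ∀ t ∈ Set.Icc (0 : ℝ) 1,
      dist (edgePoint X a b s) (edgePoint X a b t) ≤ |s - t| := by
    intro s hs t ht
    rw [dist_edist]
    exact ENNReal.toReal_le_of_le_ofReal (abs_nonneg _) (edist_edgePoint_le h hs ht)
  refine le_antisymm (up s hs t ht) (le_of_forall_pos_le_add fun ε hε => ?_)
  obtain ⟨η, hη, hη1, hηε⟩ : ∃ η : ℝ, 0 < η ∧ η < 1 ∧ 3 * η ≤ ε :=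
    ⟨min (1 / 2) (ε / 3), by positivity, (min_le_left _ _).trans_lt (by norm_num),
      by linarith [min_le_right (1 / 2) (ε / 3)]⟩
  -- Contracting the interval towards 1/2 by the factor 1 - η makes all points interior and moves
  -- each by at most η/2.
  have mem : ∀ s ∈ Set.Icc (0 : ℝ) 1, (1 - η) * s + η / 2 ∈ Set.Ioo (0 : ℝ) 1 := by
    intro s hs
    have h1 := hs.1
    have h2 := hs.2
    constructor <;> nlinarith
  have near : ∀ s ∈ Set.Icc (0 : ℝ) 1,
      dist (edgePoint X a b s) (edgePoint X a b ((1 - η) * s + η / 2)) ≤ η := by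
    intro s hs
    refine (up s hs _ (Set.Ioo_subset_Icc_self (mem s hs))).trans ?_
    have h1 := hs.1
    have h2 := hs.2
    rw [abs_le]
    constructor <;> nlinarith
  have mid := dist_edgePoint_of_mem_Ioo hX h (mem s hs) (mem t ht)
  rw [show (1 - η) * s + η / 2 - ((1 - η) * t + η / 2) = (1 - η) * (s - t) by ring, abs_mul,
    abs_of_pos (by linarith : 0 < 1 - η)] at mid
  have tri := dist_triangle4 (edgePoint X a b ((1 - η) * s + η / 2)) (edgePoint X a b s)
    (edgePoint X a b t) (edgePoint X a b ((1 - η) * t + η / 2))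
  have n1 := near s hs
  have n2 := near t ht
  rw [dist_comm] at n1
  have hst : |s - t| ≤ 1 := by
    have h1 := hs.1
    have h2 := hs.2
    have h3 := ht.1
    have h4 := ht.2
    rw [abs_le]
    constructor <;> linarith
  nlinarith

/-! ### Triangles of `G` are solid -/

/-- The inner product of e₁ and e₂ is 1 - d²/2. The hypotheses say that the quadratic form ‖p e₁ + q
e₂‖² - (p g + q g')² has positive leading coefficient and nonnegative determinant, hence is
semidefinite. -/
theorem abs_add_le_norm {e₁ e₂ : ℂ} {d g g' : ℝ} (h₁ : ‖e₁‖ = 1) (h₂ : ‖e₂‖ = 1)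
    (h : ‖e₁ - e₂‖ = d) (hg : g ^ 2 < 1)
    (hd : (1 - d ^ 2 / 2 - g * g') ^ 2 ≤ (1 - g ^ 2) * (1 - g' ^ 2)) (p q : ℝ) :
    |p * g + q * g'| ≤ ‖p * e₁ + q * e₂‖ := by
  have n1 : e₁.re ^ 2 + e₁.im ^ 2 = 1 := by
    have := Complex.sq_norm e₁
    rw [h₁, Complex.normSq_apply] at this
    linarith
  have n2 : e₂.re ^ 2 + e₂.im ^ 2 = 1 := by
    have := Complex.sq_norm e₂
    rw [h₂, Complex.normSq_apply] at this
    linarith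
  have n3 : (e₁.re - e₂.re) ^ 2 + (e₁.im - e₂.im) ^ 2 = d ^ 2 := by
    have := Complex.sq_norm (e₁ - e₂)
    rw [h, Complex.normSq_apply, Complex.sub_re, Complex.sub_im] at this
    linarith
  refine abs_le_of_sq_le_sq ?_ (norm_nonneg _)
  have n4 : ‖p * e₁ + q * e₂‖ ^ 2 = p ^ 2 + q ^ 2 + 2 * p * q * (1 - d ^ 2 / 2) := by
    rw [Complex.sq_norm, Complex.normSq_apply, Complex.add_re, Complex.add_im,
      Complex.re_ofReal_mul, Complex.im_ofReal_mul, Complex.re_ofReal_mul, Complex.im_ofReal_mul]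
    linear_combination (p ^ 2 + p * q) * n1 + (q ^ 2 + p * q) * n2 - p * q * n3
  rw [n4]
  have hA : 0 < 1 - g ^ 2 := by linarith
  refine le_of_mul_le_mul_left ?_ hA
  have := mul_nonneg (sub_nonneg.2 hd) (sq_nonneg q)
  nlinarith [sq_nonneg ((1 - g ^ 2) * p + (1 - d ^ 2 / 2 - g * g') * q)]

/-- A function on the neighbours of `a` that separates `b` from the neighbours of `a` that do not
span a solid triangle with `a` and `b`. -/
noncomputable def separatingWeight (X : TrianglePentagonComplex G) (a b u : V) : ℝ :=
  if u = a then 0 else if u = b then -1 / 2 else if {a, b, u} ∈ X.triangles then 1 / 2 else 11 / 20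

/-- The extension of `separatingWeight` to the centers of the pentagons at `a` that is affine on
each pentagon near `a`. -/
noncomputable def separatingWeightStar (X : TrianglePentagonComplex G) (a b : V) :
    V ⊕ X.Pentagon → ℝ
  | Sum.inl u => separatingWeight X a b u
  | Sum.inr P => ∑ i, if X.boundary P i = a then pentagonRadius ^ 2 *
      (separatingWeight X a b (X.boundary P (i + 1)) +
        separatingWeight X a b (X.boundary P (i - 1))) else 0

theorem separatingWeightStar_inr (a b : V) {P : X.Pentagon} {i : Fin 5} (hi : X.boundary P i = a) :
    separatingWeightStar X a b (Sum.inr P) = pentagonRadius ^ 2 *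
      (separatingWeight X a b (X.boundary P (i + 1)) +
        separatingWeight X a b (X.boundary P (i - 1))) := by
  rw [separatingWeightStar, Finset.sum_eq_single i, if_pos hi]
  · intro j _ hj
    rw [if_neg fun h => hj ((X.boundary P).injective (h.trans hi.symm))]
  · simp

theorem separatingWeight_mem {a b u : V} (h : u ≠ a) : separatingWeight X a b u = -1 / 2 ∨
    separatingWeight X a b u = 1 / 2 ∨ separatingWeight X a b u = 11 / 20 := by
  unfold separatingWeight
  rw [if_neg h]
  split_ifs <;> simp

/-- If one of the two vertices is `b`, the other has weight exactly 1/2, as the triangle is solid;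
weights -1/2 and 1/2 give equality in the criterion. Otherwise both weights are 1/2 or 11/20. -/
theorem abs_separatingWeight_triangle {a b u v : V} (h : {a, u, v} ∈ X.triangles) {e₁ e₂ : ℂ}
    (h₁ : ‖e₁‖ = 1) (h₂ : ‖e₂‖ = 1) (h₁₂ : ‖e₁ - e₂‖ = 1) (p q : ℝ) :
    |p * separatingWeight X a b u + q * separatingWeight X a b v| ≤ ‖p * e₁ + q * e₂‖ := by
  obtain ⟨n1, n2, n3⟩ := pairwise_ne_of_mem_triangles h
  have c1 : u = b → separatingWeight X a b v = 1 / 2 := by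
    rintro rfl
    rw [separatingWeight, if_neg n2.symm, if_neg n3.symm, if_pos h]
  have c2 : v = b → separatingWeight X a b u = 1 / 2 := by
    rintro rfl
    rw [separatingWeight, if_neg n1.symm, if_neg n3, if_pos]
    convert h using 2
    exact Finset.pair_comm _ _
  have c3 : ∀ u, u ≠ a → u ≠ b → separatingWeight X a b u = 1 / 2 ∨
      separatingWeight X a b u = 11 / 20 := by
    intro u h1 h2
    rw [separatingWeight, if_neg h1, if_neg h2]
    split_ifs <;> simp
  have c4 : separatingWeight X a b b = -1 / 2 ∨ b = a := by
    by_cases hba : b = a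
    · exact Or.inr hba
    · left; rw [separatingWeight, if_neg hba, if_pos rfl]
  have key : (separatingWeight X a b u = -1 / 2 ∧ separatingWeight X a b v = 1 / 2) ∨
      (separatingWeight X a b u = 1 / 2 ∧ separatingWeight X a b v = -1 / 2) ∨
      ((separatingWeight X a b u = 1 / 2 ∨ separatingWeight X a b u = 11 / 20) ∧
        (separatingWeight X a b v = 1 / 2 ∨ separatingWeight X a b v = 11 / 20)) := by
    by_cases hu : u = b
    · exact Or.inl ⟨by rw [hu]; exact c4.resolve_right fun h => n1 (h ▸ hu.symm), c1 hu⟩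
    · by_cases hv : v = b
      · exact Or.inr (Or.inl ⟨c2 hv, by rw [hv]; exact c4.resolve_right fun h => n2 (h ▸ hv.symm)⟩)
      · exact Or.inr (Or.inr ⟨c3 u n1.symm hu, c3 v n2.symm hv⟩)
  rcases key with ⟨e1, e2⟩ | ⟨e1, e2⟩ | ⟨e1 | e1, e2 | e2⟩ <;> rw [e1, e2] <;>
    exact abs_add_le_norm h₁ h₂ h₁₂ (by norm_num) (by norm_num) p q

/-- At the corner angle 3π/5 every pair of weights is admissible, even 11/20 with itself. This
leaves room for a value above 1/2. -/
theorem abs_separatingWeight_pentagon {a b u v : V} (hu : u ≠ a) (hv : v ≠ a) {e₁ e₂ : ℂ}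
    (h₁ : ‖e₁‖ = 1) (h₂ : ‖e₂‖ = 1) (h₁₂ : ‖e₁ - e₂‖ = (1 + √5) / 2) (p q : ℝ) :
    |p * separatingWeight X a b u + q * separatingWeight X a b v| ≤ ‖p * e₁ + q * e₂‖ := by
  have h5 := sqrt_five_bounds
  have hs : √5 ^ 2 = (5 : ℝ) := Real.sq_sqrt (by norm_num)
  have hd : 1 - ((1 + √5) / 2) ^ 2 / 2 = (1 - √5) / 4 := by linear_combination (-1 / 8) * hs
  rcases separatingWeight_mem (X := X) (b := b) hu with e1 | e1 | e1 <;>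
  rcases separatingWeight_mem (X := X) (b := b) hv with e2 | e2 | e2 <;> rw [e1, e2] <;>
    refine abs_add_le_norm h₁ h₂ h₁₂ (by norm_num) ?_ p q <;> rw [hd] <;> nlinarith

/-- Near `a` the function is affine on each cell, and so determined by its increments along the
edges at `a`. In a pentagon, `pentagon_center_eq` eliminates the center. -/
theorem edist_separatingWeight_le (a b : V) (C : X.Cell) {x y : X.Space}
    (hx : x ∈ C.carrier) (hy : y ∈ C.carrier) (hxa : x.1 (Sum.inl a) ≠ 0)
    (hya : y.1 (Sum.inl a) ≠ 0) :
    edist (affineExt (separatingWeightStar X a b) x) (affineExt (separatingWeightStar X a b) y) ≤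
      edist (C.chart x) (C.chart y) := by
  rw [edist_dist, edist_dist, dist_eq_norm, dist_eq_norm]
  refine ENNReal.ofReal_le_ofReal ?_
  have ha0 : separatingWeight X a b a = 0 := if_pos rfl
  cases C with
  | edge u v h =>
    have key : ∀ w, G.Adj a w → (∀ z : X.Space, z ∈ (Cell.edge u v h : X.Cell).carrier →
        ∀ c, z.1 c ≠ 0 → c ∈ ({Sum.inl a, Sum.inl w} : Finset (V ⊕ X.Pentagon))) →
        (Sum.inl a ∈ (Cell.edge u v h : X.Cell).starVertices) →
        (Sum.inl w ∈ (Cell.edge u v h : X.Cell).starVertices) →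
        ‖affineExt (separatingWeightStar X a b) x - affineExt (separatingWeightStar X a b) y‖ ≤
          ‖(Cell.edge u v h : X.Cell).chart x - (Cell.edge u v h : X.Cell).chart y‖ := by
      intro w haw hJ hac hwc
      have hs := sum_sub_eq_zero (hJ x hx) (hJ y hy)
      have hne : (Sum.inl a : V ⊕ X.Pentagon) ∉ ({Sum.inl w} : Finset _) := by simpa using haw.ne
      rw [Finset.sum_insert hne, Finset.sum_singleton] at hs
      have e := Cell.norm_pos_sub _ hwc hac (edge_mem_faces X haw) (by simp) (by simp)
      rw [starLength, if_neg haw.ne'] at e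
      rw [Cell.chart_eq, Cell.chart_eq, affineExt_sub _ (hJ x hx) (hJ y hy),
        affineExt_sub _ (hJ x hx) (hJ y hy), Finset.sum_insert hne, Finset.sum_insert hne,
        Finset.sum_singleton, Finset.sum_singleton, eq_neg_of_add_eq_zero_left hs, neg_smul,
        neg_smul, neg_add_eq_sub, neg_add_eq_sub, ← smul_sub, ← smul_sub, norm_smul, norm_smul, e]
      refine mul_le_mul_of_nonneg_left ?_ (norm_nonneg _)
      simp only [separatingWeightStar, ha0, sub_zero]
      rcases separatingWeight_mem (X := X) (b := b) haw.ne' with e | e | e <;> rw [e] <;> norm_num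
    have hJ : ∀ z : X.Space, z ∈ (Cell.edge u v h : X.Cell).carrier →
        ∀ a, z.1 a ≠ 0 → a ∈ ({Sum.inl u, Sum.inl v} : Finset (V ⊕ X.Pentagon)) :=
      fun z hz a ha => by simpa [Cell.starVertices] using hz a ha
    have := hJ x hx _ hxa
    simp only [Finset.mem_insert, Finset.mem_singleton, Sum.inl.injEq] at this
    rcases this with rfl | rfl
    · exact key v h hJ (by simp [Cell.starVertices]) (by simp [Cell.starVertices])
    · exact key u h.symm (fun z hz c hc => by rw [Finset.pair_comm]; exact hJ z hz c hc)
        (by simp [Cell.starVertices]) (by simp [Cell.starVertices])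
  | triangle u v w h =>
    obtain ⟨v', w', h', hJ⟩ : ∃ v' w', {a, v', w'} ∈ X.triangles ∧ ∀ c : V ⊕ X.Pentagon,
        c ∈ (Cell.triangle u v w h : X.Cell).starVertices ↔
          c = Sum.inl a ∨ c = Sum.inl v' ∨ c = Sum.inl w' := by
      have := hx _ hxa
      simp only [Cell.starVertices, Set.mem_insert_iff, Set.mem_singleton_iff, Sum.inl.injEq]
        at this
      rcases this with rfl | rfl | rfl
      · exact ⟨v, w, h, fun c => by simp [Cell.starVertices]⟩
      · refine ⟨u, w, ?_, fun c => ?_⟩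
        · convert h using 1
          exact Finset.insert_comm _ _ _
        · simp only [Cell.starVertices, Set.mem_insert_iff, Set.mem_singleton_iff]; tauto
      · refine ⟨u, v, ?_, fun c => ?_⟩
        · convert h using 1
          ext z; simp only [Finset.mem_insert, Finset.mem_singleton]; tauto
        · simp only [Cell.starVertices, Set.mem_insert_iff, Set.mem_singleton_iff]; tauto
    obtain ⟨n1, n2, n3⟩ := pairwise_ne_of_mem_triangles h'
    have hface : ({Sum.inl a, Sum.inl v', Sum.inl w'} : Finset (V ⊕ X.Pentagon)) ∈ X.star.faces :=
      ⟨by simp, Or.inr (Or.inr (Or.inl ⟨_, h', by simp⟩))⟩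
    have hJ' : ∀ z : X.Space, z ∈ (Cell.triangle u v w h : X.Cell).carrier → ∀ c, z.1 c ≠ 0 →
        c ∈ ({Sum.inl a, Sum.inl v', Sum.inl w'} : Finset (V ⊕ X.Pentagon)) :=
      fun z hz c hc => by simpa using (hJ c).1 (hz c hc)
    have hs := sum_sub_eq_zero (hJ' x hx) (hJ' y hy)
    have ma := (hJ (Sum.inl a)).2 (by simp)
    have mv := (hJ (Sum.inl v')).2 (by simp)
    have mw := (hJ (Sum.inl w')).2 (by simp)
    have e1 := Cell.norm_pos_sub _ mv ma hface (by simp) (by simp)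
    have e2 := Cell.norm_pos_sub _ mw ma hface (by simp) (by simp)
    have e3 := Cell.norm_pos_sub _ mv mw hface (by simp) (by simp)
    rw [starLength, if_neg n1.symm] at e1
    rw [starLength, if_neg n2.symm] at e2
    rw [starLength, if_neg n3] at e3
    have hne1 : (Sum.inl a : V ⊕ X.Pentagon) ∉ ({Sum.inl v', Sum.inl w'} : Finset _) := by
      simp [n1, n2]
    have hne2 : (Sum.inl v' : V ⊕ X.Pentagon) ∉ ({Sum.inl w'} : Finset _) := by simpa using n3
    have key := abs_separatingWeight_triangle (b := b) h' e1 e2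
      (by rw [sub_sub_sub_cancel_right]; exact e3) (x.1 (Sum.inl v') - y.1 (Sum.inl v'))
      (x.1 (Sum.inl w') - y.1 (Sum.inl w'))
    rw [Finset.sum_insert hne1, Finset.sum_insert hne2, Finset.sum_singleton] at hs
    rw [Cell.chart_eq, Cell.chart_eq, affineExt_sub _ (hJ' x hx) (hJ' y hy),
      affineExt_sub _ (hJ' x hx) (hJ' y hy), Finset.sum_insert hne1, Finset.sum_insert hne1,
      Finset.sum_insert hne2, Finset.sum_insert hne2, Finset.sum_singleton, Finset.sum_singleton,
      eq_neg_of_add_eq_zero_left hs]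
    simp only [separatingWeightStar, ha0, smul_eq_mul, Real.norm_eq_abs]
    refine (le_of_eq (congrArg _ ?_)).trans (key.trans (le_of_eq (congrArg _ ?_)))
    · ring
    · simp only [Complex.real_smul]
      push_cast
      ring
  | pentagon P =>
    obtain ⟨i, hi⟩ : ∃ i, X.boundary P i = a := by
      rcases hx _ hxa with h | ⟨i, h⟩
      · simp at h
      · exact ⟨i, Sum.inl_injective h⟩
    set u := X.boundary P (i + 1) with hu
    set v := X.boundary P (i - 1) with hv
    have n1 : u ≠ a := by rw [hu, ← hi]; exact (X.boundary P).injective.ne (by simp)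
    have n2 : v ≠ a := by rw [hv, ← hi]; exact (X.boundary P).injective.ne (by simp)
    have n3 : u ≠ v := (X.boundary P).injective.ne ((by decide : ∀ i : Fin 5, i + 1 ≠ i - 1) i)
    have hJ : ∀ z : X.Space, z ∈ (Cell.pentagon P).carrier → z.1 (Sum.inl a) ≠ 0 → ∀ c, z.1 c ≠ 0 →
        c ∈ ({Sum.inl a, Sum.inl u, Sum.inl v, Sum.inr P} : Finset (V ⊕ X.Pentagon)) := by
      intro z hz hza c hc
      by_cases hca : c = Sum.inl a
      · simp [hca]
      obtain ⟨j, hj, h⟩ := mem_face_of_mem_carrier_edge hz hza hc hca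
      obtain rfl : j = i := (X.boundary P).injective (hj.trans hi.symm)
      rcases h with ⟨rfl, -⟩ | ⟨rfl | rfl, -⟩ <;> simp [hu, hv]
    have hs := sum_sub_eq_zero (hJ x hx hxa) (hJ y hy hya)
    have hne1 : (Sum.inl a : V ⊕ X.Pentagon) ∉
        ({Sum.inl u, Sum.inl v, Sum.inr P} : Finset _) := by simp [n1.symm, n2.symm]
    have hne2 : (Sum.inl u : V ⊕ X.Pentagon) ∉ ({Sum.inl v, Sum.inr P} : Finset _) := by simp [n3]
    have hne3 : (Sum.inl v : V ⊕ X.Pentagon) ∉ ({Sum.inr P} : Finset _) := by simp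
    have p1 : (Cell.pentagon P).pos (Sum.inl u) = regularPolygonVertex 5 (i + 1) :=
      Cell.pos_boundary P _
    have p2 : (Cell.pentagon P).pos (Sum.inl v) = regularPolygonVertex 5 (i - 1) :=
      Cell.pos_boundary P _
    have p3 : (Cell.pentagon P).pos (Sum.inl a) = regularPolygonVertex 5 i :=
      hi ▸ Cell.pos_boundary P _
    have e1 := norm_pentagonVertex_succ_sub i
    have e2 := norm_pentagonVertex_succ_sub (i - 1)
    have e3 := norm_pentagonVertex_add_two_sub (i - 1)
    rw [sub_add_cancel, norm_sub_rev] at e2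
    rw [(by decide : ∀ i : Fin 5, i - 1 + 2 = i + 1) i] at e3
    have key := abs_separatingWeight_pentagon (X := X) (b := b) n1 n2 e1 e2
      (by rw [sub_sub_sub_cancel_right]; exact e3)
      ((x.1 (Sum.inl u) - y.1 (Sum.inl u)) +
        (x.1 (Sum.inr P) - y.1 (Sum.inr P)) * pentagonRadius ^ 2)
      ((x.1 (Sum.inl v) - y.1 (Sum.inl v)) +
        (x.1 (Sum.inr P) - y.1 (Sum.inr P)) * pentagonRadius ^ 2)
    have center := pentagon_center_eq i
    rw [Finset.sum_insert hne1, Finset.sum_insert hne2, Finset.sum_insert hne3,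
      Finset.sum_singleton] at hs
    rw [Cell.chart_eq, Cell.chart_eq, affineExt_sub _ (hJ x hx hxa) (hJ y hy hya),
      affineExt_sub _ (hJ x hx hxa) (hJ y hy hya), Finset.sum_insert hne1, Finset.sum_insert hne1,
      Finset.sum_insert hne2, Finset.sum_insert hne2, Finset.sum_insert hne3,
      Finset.sum_insert hne3, Finset.sum_singleton, Finset.sum_singleton,
      eq_neg_of_add_eq_zero_left hs, p1, p2, p3, Cell.pos_inr, separatingWeightStar_inr a b hi]
    simp only [separatingWeightStar, ha0, smul_eq_mul, Real.norm_eq_abs]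
    refine (le_of_eq (congrArg _ ?_)).trans (key.trans (le_of_eq (congrArg _ ?_)))
    · ring
    · simp only [Complex.real_smul]
      push_cast
      linear_combination ((x.1 (Sum.inr P) : ℂ) - y.1 (Sum.inr P)) * center

/-- Take the points at distance 1/100 from `a` on the edges to `b` and `c`. Comparison with an
equilateral triangle puts them at distance at most 1/100. If the triangle were not solid, the
separating function would differ by (11/20 + 1/2)/100 > 1/100 between them. -/
theorem mem_triangles_of_adj (hX : IsCAT0 X.Space) {a b c : V} (hab : G.Adj a b) (hac : G.Adj a c)
    (hbc : G.Adj b c) : {a, b, c} ∈ X.triangles := by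
  by_contra hT
  let := metric hX
  have hC := metric_isCAT0 hX
  have m0 : (0 : ℝ) ∈ Set.Icc (0 : ℝ) 1 := by norm_num
  have m1 : (1 : ℝ) ∈ Set.Icc (0 : ℝ) 1 := by norm_num
  have ms : (1 / 100 : ℝ) ∈ Set.Icc (0 : ℝ) 1 := by norm_num
  have edge : ∀ {a b : V}, G.Adj a b → dist (vertexPoint X a) (vertexPoint X b) = 1 := by
    intro a b h
    rw [← edgePoint_zero h, ← edgePoint_one h, dist_edgePoint hX h m0 m1]
    norm_num
  have start : ∀ {a b : V}, G.Adj a b →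
      dist (vertexPoint X a) (edgePoint X a b (1 / 100)) = 1 / 100 := by
    intro a b h
    rw [← edgePoint_zero h, dist_edgePoint hX h m0 ms]
    norm_num
  have rest : ∀ {a b : V}, G.Adj a b →
      dist (edgePoint X a b (1 / 100)) (vertexPoint X b) = 99 / 100 := by
    intro a b h
    rw [← edgePoint_one h, dist_edgePoint hX h ms m1]
    norm_num [abs_of_neg]
  -- Stewart's inequality twice: from `c` to the point of `a b`, then from that point to the point
  -- of `a c`.
  have s1 := IsCAT0.stewart hC (p := vertexPoint X c) (q := vertexPoint X a)
    (m := edgePoint X a b (1 / 100)) (r := vertexPoint X b) (by rw [start hab]; norm_num)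
    (by rw [rest hab]; norm_num) (by rw [start hab, rest hab, edge hab]; norm_num)
  have s2 := IsCAT0.stewart hC (p := edgePoint X a b (1 / 100)) (q := vertexPoint X a)
    (m := edgePoint X a c (1 / 100)) (r := vertexPoint X c) (by rw [start hac]; norm_num)
    (by rw [rest hac]; norm_num) (by rw [start hac, rest hac, edge hac]; norm_num)
  rw [start hab, rest hab, edge hab, edge hac.symm, edge hbc.symm] at s1
  rw [start hac, rest hac, edge hac, dist_comm _ (vertexPoint X a), start hab,
    dist_comm _ (vertexPoint X c)] at s2
  have up : dist (edgePoint X a b (1 / 100)) (edgePoint X a c (1 / 100)) ≤ 1 / 100 := by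
    refine abs_le_of_sq_le_sq' ?_ (by norm_num) |>.2
    linarith
  -- The coordinate at `a` is 99/100, so m = 1/2 is allowed, and m/11 = 1/22 exceeds the difference
  -- 21/2000 of the values.
  have lo := le_edist_of_lipschitz_on_star (affineExt (separatingWeightStar X a b)) {Sum.inl a}
    (fun C x y hx hy hxσ hyσ => edist_separatingWeight_le a b C hx hy (hxσ _ (by simp))
      (hyσ _ (by simp))) (x := edgePoint X a b (1 / 100)) (y := edgePoint X a c (1 / 100))
    (m := 1 / 2) (by
      intro d hd
      rw [Finset.mem_singleton.1 hd, edgePoint_val hab ms]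
      simp only [sectorCoord, if_true, if_neg (Sum.inl_injective.ne hab.ne)]
      norm_num)
  rw [affineExt_edgePoint _ hab ms, affineExt_edgePoint _ hac ms] at lo
  have w1 : separatingWeight X a b a = 0 := if_pos rfl
  have w2 : separatingWeight X a b b = -1 / 2 := by
    rw [separatingWeight, if_neg hab.ne', if_pos rfl]
  have w3 : separatingWeight X a b c = 11 / 20 := by
    rw [separatingWeight, if_neg hac.ne', if_neg hbc.ne', if_neg hT]
  simp only [separatingWeightStar, w1, w2, w3, smul_eq_mul] at lo
  rw [edist_dist, edist_dist, Real.dist_eq, ← ENNReal.ofReal_min,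
    ENNReal.ofReal_le_ofReal_iff dist_nonneg] at lo
  have := lo.trans up
  norm_num [abs_of_neg] at this

end TrianglePentagonComplex

/-! ### Flagness and wheels -/

namespace AbstractSimplicialComplex

variable {U : Type*} {K : AbstractSimplicialComplex U}

theorem IsFullWheel.exists_face {c : U} {k : ℕ} {γ : ZMod k → U} (h : K.IsFullWheel c γ)
    (i : ZMod k) : ∃ s ∈ K.faces, c ∈ s ∧ γ i ∈ s ∧ γ (i + 1) ∈ s := by
  classical
  exact ⟨_, h.full.1 ⟨by simp, i, subset_rfl⟩, by simp⟩

theorem IsFullCycle.ne_add_natCast {k : ℕ} {γ : ZMod k → U} (h : K.IsFullCycle γ) (i : ZMod k)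
    {n : ℕ} (hn : 0 < n) (hnk : n < 3) : γ i ≠ γ (i + n) := by
  refine fun e => ?_
  have := h.injective e
  rw [left_eq_add, ZMod.natCast_eq_zero_iff] at this
  exact absurd (Nat.le_of_dvd hn this) (by have := h.three_le; omega)

end AbstractSimplicialComplex

namespace TrianglePentagonComplex

open scoped Classical
open AbstractSimplicialComplex

variable {V : Type*} {G : SimpleGraph V} {X : TrianglePentagonComplex G}

theorem isSector_of_adj (hX : IsCAT0 X.Space) {a b c : V} (hab : G.Adj a b) (hac : G.Adj a c)
    (hbc : G.Adj b c) : X.IsSector a (Sum.inl b) (Sum.inl c) :=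
  ⟨by simpa using hab.ne', by simpa using hac.ne', by simpa using hbc.ne,
    ({a, b, c} : Finset V).map Function.Embedding.inl,
    ⟨by simp, Or.inr (Or.inr (Or.inl ⟨_, mem_triangles_of_adj hX hab hac hbc, subset_rfl⟩))⟩,
    by simp⟩

/-- The three triangles at `a` would form a closed chain of total angle only π. -/
theorem cliqueFree_four (hX : IsCAT0 X.Space) : G.CliqueFree 4 := by
  intro t ht
  obtain ⟨a, b, c, d, hab, hac, had, hbc, hbd, hcd, rfl⟩ := Finset.card_eq_four.1 ht.card_eq
  have hcl := ht.isClique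
  replace hab : G.Adj a b := hcl (by simp) (by simp) hab
  replace hac : G.Adj a c := hcl (by simp) (by simp) hac
  replace had : G.Adj a d := hcl (by simp) (by simp) had
  replace hbc : G.Adj b c := hcl (by simp) (by simp) hbc
  replace hbd : G.Adj b d := hcl (by simp) (by simp) hbd
  replace hcd : G.Adj c d := hcl (by simp) (by simp) hcd
  have key := two_pi_le_sum_sectorAngle hX (a := a) (k := 3)
    (b := fun i => Sum.inl (if i % 3 = 0 then b else if i % 3 = 1 then c else d))
    (by norm_num) (by simp)
    (by
      intro i hi
      interval_cases i
      · exact isSector_of_adj hX hab hac hbc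
      · exact isSector_of_adj hX hac had hcd
      · exact isSector_of_adj hX had hab hbd.symm)
    (by
      intro i hi
      have : i ≤ 1 := by omega
      interval_cases i
      · exact Sum.inl_injective.ne hbd.ne
      · exact Sum.inl_injective.ne hbc.ne')
  have := key.trans (Finset.sum_le_card_nsmul _ _ _ fun i _ => sectorAngle_le _ _)
  rw [Finset.card_range, nsmul_eq_mul] at this
  push_cast at this
  linarith [Real.pi_pos]

/-- If a center occurs, the other vertices are pairwise adjacent on the boundary of its pentagon,
hence on one edge of it. Otherwise the set is a clique of G, which has at most three vertices and is
solid if it has three. -/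
theorem star_isFlag (hX : IsCAT0 X.Space) : X.star.IsFlag := by
  intro s hs hadj
  have face : ∀ a ∈ s, ∀ b ∈ s, ∃ t ∈ X.star.faces, a ∈ t ∧ b ∈ t := fun a ha b hb =>
    ⟨_, hadj a ha b hb, by simp, by simp⟩
  refine ⟨hs, ?_⟩
  by_cases hP : ∃ P, Sum.inr P ∈ s
  · obtain ⟨P, hP⟩ := hP
    have hb : ∀ b ∈ s, b = Sum.inr P ∨ ∃ i, b = Sum.inl (X.boundary P i) := by
      intro b hb
      obtain ⟨t, ht, hPt, hbt⟩ := face _ hP b hb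
      obtain ⟨i, hi⟩ := exists_of_inr_mem_face ht hPt
      rcases hi b hbt with h | h | h
      · exact Or.inl h
      · exact Or.inr ⟨_, h⟩
      · exact Or.inr ⟨_, h⟩
    have h : ∀ i j : Fin 5, Sum.inl (X.boundary P i) ∈ s → Sum.inl (X.boundary P j) ∈ s →
        i = j ∨ j = i + 1 ∨ i = j + 1 := by
      intro i j hi hj
      rcases eq_or_ne i j with hij | hij
      · exact Or.inl hij
      · obtain ⟨t, ht, hit, hjt⟩ := face _ hi _ hj
        exact Or.inr (adj_boundary.1 (adj_of_mem_face ht hit hjt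
          fun h => hij ((X.boundary P).injective h)))
    have dec : ∀ f : Fin 5 → Bool,
        (∀ i j, f i = true → f j = true → i = j ∨ j = i + 1 ∨ i = j + 1) →
        ∃ j, ∀ i, i ≠ j → i ≠ j + 1 → f i = false := by decide
    obtain ⟨j, hj⟩ := dec (fun i => decide (Sum.inl (X.boundary P i) ∈ s)) (by simpa using h)
    refine Or.inr (Or.inr (Or.inr ⟨P, j, fun b hbs => ?_⟩))
    rcases hb b hbs with rfl | ⟨i, rfl⟩
    · simp
    · by_contra hi
      simp only [Finset.mem_insert, Finset.mem_singleton, reduceCtorEq, false_or, not_or] at hi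
      exact of_decide_eq_false (hj i (fun h => hi.1 (by rw [h])) fun h => hi.2 (by rw [h])) hbs
  · have hsub : ∀ a ∈ s, ∃ v, a = Sum.inl v := by
      rintro (v | P) ha
      · exact ⟨v, rfl⟩
      · exact absurd ⟨P, ha⟩ hP
    set t : Finset V := s.preimage Sum.inl Sum.inl_injective.injOn with ht
    have hst : s ⊆ t.map Function.Embedding.inl := by
      intro a ha
      obtain ⟨v, rfl⟩ := hsub a ha
      simpa [ht] using ha
    have hclique : G.IsClique (t : Set V) := by
      intro a ha b hb hab
      obtain ⟨r, hr, har, hbr⟩ := face (Sum.inl a) (by simpa [ht] using ha) (Sum.inl b)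
        (by simpa [ht] using hb)
      exact adj_of_mem_face hr har hbr hab
    have hcard : t.card < 4 := by
      by_contra! h
      obtain ⟨r, hrt, hr⟩ := Finset.exists_subset_card_eq h
      exact cliqueFree_four hX r ⟨hclique.subset (by exact_mod_cast hrt), hr⟩
    interval_cases h : t.card
    · obtain ⟨a, ha⟩ := hs
      simpa [Finset.card_eq_zero.1 h] using hst ha
    · obtain ⟨v, hv⟩ := Finset.card_eq_one.1 h
      rw [hv] at hst
      exact Or.inl ⟨v, by simpa using hst⟩
    · obtain ⟨u, v, huv, hv⟩ := Finset.card_eq_two.1 h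
      rw [hv] at hst hclique
      exact Or.inr (Or.inl ⟨u, v, hclique (by simp) (by simp) huv, fun a ha => by
        simpa [eq_comm] using hst ha⟩)
    · obtain ⟨a, b, c, hab, hac, hbc, h3⟩ := Finset.card_eq_three.1 h
      rw [h3] at hst hclique
      exact Or.inr (Or.inr (Or.inl ⟨_, mem_triangles_of_adj hX (hclique (by simp) (by simp) hab)
        (hclique (by simp) (by simp) hac) (hclique (by simp) (by simp) hbc), hst⟩))

/-! ### Lengths of full wheels and of dwheels -/

theorem two_pi_le_sum_of_isFullWheel (hX : IsCAT0 X.Space) {a : V} {k : ℕ}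
    {γ : ZMod k → V ⊕ X.Pentagon} (h : X.star.IsFullWheel (Sum.inl a) γ) :
    2 * Real.pi ≤ ∑ i ∈ Finset.range k, sectorAngle (γ i) (γ (i + 1)) := by
  have h1 := fun i => h.isFullCycle.ne_add_natCast i one_pos (by norm_num)
  have h2 := fun i => h.isFullCycle.ne_add_natCast i two_pos (by norm_num)
  have := two_pi_le_sum_sectorAngle hX (a := a) (b := fun i : ℕ => γ i) (k := k)
    (by have := h.isFullCycle.three_le; omega) (by simp)
    (fun i _ => ⟨(h.center_ne _).symm, (h.center_ne _).symm, by simpa using h1 i, by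
      obtain ⟨s, hs, h⟩ := h.exists_face (i : ZMod k)
      exact ⟨s, hs, by simpa using h⟩⟩)
    (fun i _ => by simpa using h2 i)
  simpa using this

theorem six_le_of_isFullWheel_inl (hX : IsCAT0 X.Space) {a : V} {k : ℕ}
    {γ : ZMod k → V ⊕ X.Pentagon} (h : X.star.IsFullWheel (Sum.inl a) γ) : 6 ≤ k := by
  have := (two_pi_le_sum_of_isFullWheel hX h).trans
    (Finset.sum_le_card_nsmul _ _ _ fun i _ => sectorAngle_le _ _)
  rw [Finset.card_range, nsmul_eq_mul] at this
  have h6 : (6 : ℝ) ≤ k := by nlinarith [Real.pi_pos]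
  exact_mod_cast h6

/-- A sector at a pentagon center has angle 3π/10 < π/3, so six sectors would total less than 2π. -/
theorem seven_le_of_isFullWheel_inl (hX : IsCAT0 X.Space) {a : V} {k : ℕ}
    {γ : ZMod k → V ⊕ X.Pentagon} (h : X.star.IsFullWheel (Sum.inl a) γ) {j : ZMod k}
    {P : X.Pentagon} (hj : γ j = Sum.inr P) : 7 ≤ k := by
  have : NeZero k := ⟨by have := h.isFullCycle.three_le; omega⟩
  have lt : ∑ i ∈ Finset.range k, sectorAngle (γ i) (γ (i + 1)) <
      ∑ i ∈ Finset.range k, Real.pi / 3 := by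
    refine Finset.sum_lt_sum (fun i _ => sectorAngle_le _ _)
      ⟨j.val, Finset.mem_range.2 j.val_lt, ?_⟩
    rw [ZMod.natCast_zmod_val, hj]
    simp only [sectorAngle]
    linarith [Real.pi_pos]
  have := (two_pi_le_sum_of_isFullWheel hX h).trans_lt lt
  rw [Finset.sum_const, Finset.card_range, nsmul_eq_mul] at this
  have h6 : (6 : ℝ) < k := by nlinarith [Real.pi_pos]
  exact_mod_cast h6

/-- The rim is a closed walk on the boundary 5-cycle of `P` without backtracking, and there is none
of length 3 or 4. -/
theorem five_le_of_isFullWheel_inr {P : X.Pentagon} {k : ℕ} {γ : ZMod k → V ⊕ X.Pentagon}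
    (h : X.star.IsFullWheel (Sum.inr P) γ) : 5 ≤ k := by
  have hf : ∀ i, ∃ j, γ i = Sum.inl (X.boundary P j) := by
    intro i
    obtain ⟨s, hs, hc, hi, -⟩ := h.exists_face i
    obtain ⟨j, hj⟩ := exists_of_inr_mem_face hs hc
    rcases hj _ hi with h' | h' | h'
    · exact absurd h'.symm (h.center_ne i)
    · exact ⟨_, h'⟩
    · exact ⟨_, h'⟩
  choose f hf using hf
  have hadj : ∀ i, f (i + 1) = f i + 1 ∨ f i = f (i + 1) + 1 := by
    intro i
    obtain ⟨s, hs, hc, hi, hi'⟩ := h.exists_face i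
    have hne := h.isFullCycle.ne_add_natCast i one_pos (by norm_num)
    rw [Nat.cast_one, hf, hf] at hne
    rw [hf] at hi hi'
    exact adj_boundary.1 (adj_of_mem_face hs hi hi' fun e => hne (by rw [e]))
  have hne : ∀ i, f i ≠ f (i + 2) := by
    intro i e
    have := h.isFullCycle.ne_add_natCast i two_pos (by norm_num)
    rw [Nat.cast_two, hf, hf (i + 2), e] at this
    exact this rfl
  by_contra! hk
  have := h.isFullCycle.three_le
  interval_cases k
  · have dec : ∀ a b c : Fin 5, (b = a + 1 ∨ a = b + 1) → (c = b + 1 ∨ b = c + 1) →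
        (a = c + 1 ∨ c = a + 1) → False := by decide
    exact dec _ _ _ (hadj 0) (hadj 1) (hadj 2)
  · have dec : ∀ a b c d : Fin 5, (b = a + 1 ∨ a = b + 1) → (c = b + 1 ∨ b = c + 1) →
        (d = c + 1 ∨ c = d + 1) → (a = d + 1 ∨ d = a + 1) → a ≠ c → b ≠ d → False := by decide
    exact dec _ _ _ _ (hadj 0) (hadj 1) (hadj 2) (hadj 3) (hne 0) (hne 1)

/-- Each hub lies on the rim of the other wheel. So if one hub is a pentagon center, the wheel about
the other one has at least 7 sides; distinct pentagon centers are never adjacent. -/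
theorem twelve_le_of_isDwheel (hX : IsCAT0 X.Space) {k l : ℕ} {v : ZMod k → V ⊕ X.Pentagon}
    {w : ZMod l → V ⊕ X.Pentagon} (h : X.star.IsDwheel v w) : 12 ≤ k + l := by
  have h₁ := h.wheel₁
  have h₂ := h.wheel₂
  rcases ha : w 0 with a | P <;> rcases hb : v 2 with b | Q <;> rw [ha] at h₁ <;> rw [hb] at h₂
  · have := six_le_of_isFullWheel_inl hX h₁
    have := six_le_of_isFullWheel_inl hX h₂
    omega
  · have := seven_le_of_isFullWheel_inl hX h₁ hb
    have := five_le_of_isFullWheel_inr h₂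
    omega
  · have := five_le_of_isFullWheel_inr h₁
    have := seven_le_of_isFullWheel_inl hX h₂ ha
    omega
  · obtain ⟨s, hs, hc, hi, -⟩ := h₁.exists_face 2
    rw [hb] at hi
    exact absurd (by rw [hb, inr_eq_of_mem_face hs hc hi]) (h₁.center_ne 2)

/-- The planar case is the extreme one, with 12 - 4 = 8. -/
theorem seven_lt_dwheelBoundaryLength (hX : IsCAT0 X.Space) {k l : ℕ}
    {v : ZMod k → V ⊕ X.Pentagon} {w : ZMod l → V ⊕ X.Pentagon} (h : X.star.IsDwheel v w) :
    7 < dwheelBoundaryLength v w := by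
  have := twelve_le_of_isDwheel hX h
  unfold dwheelBoundaryLength
  split_ifs <;> omega

end TrianglePentagonComplex

open AbstractSimplicialComplex in
theorem theorem3p3 {V : Type*} {G : SimpleGraph V} (X : TrianglePentagonComplex G)
    (hX : IsCAT0 X.Space) :
    X.star.IsLocated 7 ∧
    ∀ (k l : ℕ) (v : ZMod k → V ⊕ X.Pentagon) (w : ZMod l → V ⊕ X.Pentagon),
      X.star.IsDwheel v w → dwheelBoundaryLength v w ≤ 7 →
      ∃ u : V ⊕ X.Pentagon, dwheelBoundaryFaces v w ⊆ X.star.linkFaces u :=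
  ⟨⟨TrianglePentagonComplex.star_isFlag hX, fun _ _ _ _ h h7 =>
    absurd h7 (TrianglePentagonComplex.seven_lt_dwheelBoundaryLength hX h).not_ge⟩,
    fun _ _ _ _ h h7 =>
      absurd h7 (TrianglePentagonComplex.seven_lt_dwheelBoundaryLength hX h).not_ge⟩
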